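/- Let $K$ be a commutative ring. All dg-categories below are small dg-categories over $K$. For a dg-category $\mathcal{C}$, $\mathrm{DgMod}(\mathcal{C})$ is the dg-category of dg-functors from $\mathcal{C}$ to the dg-category $\mathrm{DgMod}(K)$ of dg $K$-modules; its morphisms of degree $n$ are the dg-natural transformations of degree $n$. Dg-functors $i^{*}:\mathcal{A}\to\mathcal{C}$, $i_{*}:\mathcal{C}\to\mathcal{A}$, $j_{!}:\mathcal{B}\to\mathcal{A}$, $j^{!}:\mathcal{A}\to\mathcal{B}$ between dg-categories form a left dg-recollement $\mathcal{C}\rightleftarrows\mathcal{A}\rightleftarrows\mathcal{B}$ if $(i^{*},i_{*})$ and $(j_{!},j^{!})$ are dg-adjoint pairs, $j^{!}i_{*}=0$ (every value of $j^{!}i_{*}$ is a zero object), and $i_{*}$ and $j_{!}$ are dg-fully faithful. Dg-functors $i_{!}:\mathcal{C}\to\mathcal{A}$, $i^{!}:\mathcal{A}\to\mathcal{C}$, $j^{*}:\mathcal{A}\to\mathcal{B}$, $j_{*}:\mathcal{B}\to\mathcal{A}$ form a right dg-recollement if $(i_{!},i^{!})$ and $(j^{*},j_{*})$ are dg-adjoint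 pairs, $j^{*}i_{!}=0$, and $i_{!}$ and $j_{*}$ are dg-fully faithful. For $M\in\mathrm{DgMod}(\mathcal{R}\otimes\mathcal{T}^{op})$, the triangular matrix dg-category $\left[\begin{smallmatrix}\mathcal{T}&0\\ M&\mathcal{R}\end{smallmatrix}\right]$ has as objects the pairs $(T,R)$ of an object of $\mathcal{T}$ and an object of $\mathcal{R}$, and the complex of morphisms from $(T,R)$ to $(T',R')$ is $\mathcal{T}(T,T')\oplus M(R',T)\oplus\mathcal{R}(R,R')$, with composition $$(t_{2},m_{2},r_{2})\circ(t_{1},m_{1},r_{1})=\big(t_{2}t_{1},\ (-1)^{|m_{2}||t_{1}|}M(1\otimes t_{1}^{op})(m_{2})+M(r_{2}\otimes 1)(m_{1}),\ r_{2}r_{1}\big).$$ For a dg-functor $F:\mathrm{DgMod}(\mathcal{R})\to\mathrm{DgMod}(\mathcal{S})$, the dg-bimodule $F(M)\in\mathrm{DgMod}(\mathcal{S}\otimes\mathcal{T}^{op})$ is given by $F(M)(S,T)=F(M(-,T))(S)$ on objects and by $F(M)(g\otimes t^{op})=F(M(-,T'))(g)\circ F(M(-,t))_{S}$ for $g:S\to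 S'$ in $\mathcal{S}$ and $t:T'\to T$ in $\mathcal{T}$. **Theorem.** Let $\mathcal{R},\mathcal{S},\mathcal{C},\mathcal{T}$ be small dg-categories over $K$, where $\mathcal{S}$ and $\mathcal{T}$ have at least one object, and let $M\in\mathrm{DgMod}(\mathcal{R}\otimes\mathcal{T}^{op})$. Put $\Lambda=\left[\begin{smallmatrix}\mathcal{T}&0\\ M&\mathcal{R}\end{smallmatrix}\right]$. (a) If $i^{*},i_{*},j_{!},j^{!}$ form a left dg-recollement $\mathrm{DgMod}(\mathcal{C})\rightleftarrows\mathrm{DgMod}(\mathcal{S})\rightleftarrows\mathrm{DgMod}(\mathcal{R})$, then there are dg-functors $\tilde{i^{*}},\tilde{i_{*}},\tilde{j_{!}},\tilde{j^{!}}$ which form a left dg-recollement $\mathrm{DgMod}(\mathcal{C})\rightleftarrows\mathrm{DgMod}(\Lambda^{!})\rightleftarrows\mathrm{DgMod}(\Lambda)$, where $\Lambda^{!}=\left[\begin{smallmatrix}\mathcal{T}&0\\ j_{!}(M)&\mathcal{S}\end{smallmatrix}\right]$. (b) If $i_{!},i^{!},j^{*},j_{*}$ form a right dg-recollement $\mathrm{DgMod}(\mathcal{C})\rightleftarrows\mathrm{DgMod}(\mathcal{S})\rightleftarrows\mathrm{DgMod}(\mathcal{R})$,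 then there are dg-functors $\tilde{i_{!}},\tilde{i^{!}},\tilde{j^{*}},\tilde{j_{*}}$ which form a right dg-recollement $\mathrm{DgMod}(\mathcal{C})\rightleftarrows\mathrm{DgMod}(\Lambda^{*})\rightleftarrows\mathrm{DgMod}(\Lambda)$, where $\Lambda^{*}=\left[\begin{smallmatrix}\mathcal{T}&0\\ j_{*}(M)&\mathcal{S}\end{smallmatrix}\right]$. -/

import Mathlib

open CategoryTheory CochainComplex.HomComplex
open scoped TensorProduct

set_option linter.checkUnivs false

universe w w' w'' v v' v'' u

/-- A differential graded category over `K`.  The graded `K`-module of morphisms from `X` to `Y` is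
given by its homogeneous components `Hom X Y n`; composition is a `K`-bilinear map of degree `0`
which satisfies the graded Leibniz rule.  `comp h g f` is the composite `g ∘ f`, where the proof `h`
records the degree of the composite. -/
structure DGCat (K : Type u) [CommRing K] where
  Obj : Type w
  Hom : Obj → Obj → ℤ → Type v
  [addCommGroupHom : ∀ X Y n, AddCommGroup (Hom X Y n)]
  [moduleHom : ∀ X Y n, Module K (Hom X Y n)]
  d : ∀ {X Y : Obj} (n : ℤ), Hom X Y n →ₗ[K] Hom X Y (n + 1)
  id : ∀ X : Obj, Hom X X 0
  comp : ∀ {X Y Z : Obj} {n m p : ℤ}, n + m = p → (Hom Y Z n →ₗ[K] Hom X Y m →ₗ[K] Hom X Z p)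
  d_d : ∀ {X Y : Obj} (n : ℤ) (f : Hom X Y n), d (n + 1) (d n f) = 0
  id_comp : ∀ {X Y : Obj} {n : ℤ} (f : Hom X Y n), comp (zero_add n) (id Y) f = f
  comp_id : ∀ {X Y : Obj} {n : ℤ} (f : Hom X Y n), comp (add_zero n) f (id X) = f
  assoc : ∀ {W X Y Z : Obj} {n m l nm ml p : ℤ} (h₁ : n + m = nm) (h₂ : nm + l = p)
    (h₃ : m + l = ml) (h₄ : n + ml = p) (h : Hom Y Z n) (g : Hom X Y m) (f : Hom W X l),
    comp h₂ (comp h₁ h g) f = comp h₄ h (comp h₃ g f)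
  leibniz : ∀ {X Y Z : Obj} {n m p : ℤ} (h : n + m = p) (g : Hom Y Z n) (f : Hom X Y m),
    d p (comp h g f) = comp (by omega) (d n g) f + n.negOnePow • comp (by omega) g (d m f)

namespace DGCat

variable {K : Type u} [CommRing K]

attribute [instance] DGCat.addCommGroupHom DGCat.moduleHom

/-- A sign may be moved through a `K`-linear map. -/
theorem map_sign {P Q : Type*} [AddCommGroup P] [AddCommGroup Q] [Module K P] [Module K Q]
    (φ : P →ₗ[K] Q) (s : ℤˣ) (x : P) : φ (s • x) = s • φ x :=
  LinearMap.map_smul_of_tower φ s x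

/-- A sign may be moved through the first variable of a `K`-bilinear map. -/
theorem map_sign₂ {P Q N : Type*} [AddCommGroup P] [AddCommGroup Q] [AddCommGroup N] [Module K P]
    [Module K Q] [Module K N] (φ : P →ₗ[K] Q →ₗ[K] N) (s : ℤˣ) (x : P) (y : Q) :
    φ (s • x) y = s • φ x y := by
  rw [map_sign, LinearMap.smul_apply]

/-- The product of two signs acting on the same element. -/
theorem sign_sign {P : Type*} [AddCommGroup P] (a b : ℤ) (x : P) :
    a.negOnePow • b.negOnePow • x = (a + b).negOnePow • x := by
  rw [smul_smul, Int.negOnePow_add]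

/-- Signs with exponents of the same parity are equal. -/
theorem sign_congr {P : Type*} [AddCommGroup P] {a b : ℤ} (h : Even (a - b)) (x : P) :
    a.negOnePow • x = b.negOnePow • x := by
  rw [(Int.negOnePow_eq_iff a b).2 h]

theorem d_id (A : DGCat.{w, v} K) (X : A.Obj) : A.d 0 (A.id X) = 0 := by
  have h := A.leibniz (add_zero 0) (A.id X) (A.id X)
  rw [A.comp_id, Int.negOnePow_zero, one_smul, A.id_comp] at h
  have h' : A.comp (by omega) (A.d 0 (A.id X)) (A.id X) = A.d 0 (A.id X) := A.comp_id _
  rw [h'] at h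
  simpa using h

/-- The dg-category `DgMod(K)` of dg `K`-modules: its objects are the cochain complexes of
`K`-modules, its morphisms of degree `n` are the families of `K`-linear maps `X.X p → Y.X q` with
`p + n = q`, and the differential of `f` is `d ∘ f - (-1) ^ n • f ∘ d`. -/
@[reducible]
def dgModBase (K : Type u) [CommRing K] : DGCat.{max u (v + 1), v} K where
  Obj := CochainComplex (ModuleCat.{v} K) ℤ
  Hom X Y n := Cochain X Y n
  d n := δ_hom K _ _ n (n + 1)
  id X := Cochain.ofHom (𝟙 X)
  comp {X Y Z n m p} h := LinearMap.mk₂ K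
    (fun (g : Cochain Y Z n) (f : Cochain X Y m) => f.comp g (by omega))
    (fun _ _ _ => Cochain.comp_add _ _ _ _) (fun _ _ _ => Cochain.comp_smul _ _ _ _)
    (fun _ _ _ => Cochain.add_comp _ _ _ _) (fun _ _ _ => Cochain.smul_comp _ _ _ _)
  d_d n f := δ_δ _ _ _ f
  id_comp f := Cochain.comp_id f
  comp_id f := Cochain.id_comp f
  assoc {W X Y Z n m l nm ml p} h₁ h₂ h₃ h₄ h g f :=
    (Cochain.comp_assoc f g h (show l + m = ml by omega) (show m + n = nm by omega)
      (by omega)).symm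
  leibniz {X Y Z n m p} h g f := by
    have := δ_comp f g (show m + n = p by omega) (m + 1) (n + 1) (p + 1) rfl rfl rfl
    simpa using this

/-- The opposite dg-category: `β ∘ᵒᵖ α = (-1) ^ (|α| * |β|) • (α ∘ β)`. -/
@[reducible]
def op (A : DGCat.{w, v} K) : DGCat.{w, v} K where
  Obj := A.Obj
  Hom X Y n := A.Hom Y X n
  d n := A.d n
  id X := A.id X
  comp {X Y Z n m p} h := (n * m).negOnePow • (A.comp (show m + n = p by omega)).flip
  d_d n f := A.d_d n f
  id_comp f := by simpa using A.comp_id f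
  comp_id f := by simpa using A.id_comp f
  assoc {W X Y Z n m l nm ml p} h₁ h₂ h₃ h₄ h g f := by
    simp only [LinearMap.smul_apply, LinearMap.flip_apply, map_sign, sign_sign]
    rw [A.assoc (show l + m = ml by omega) (show ml + n = p by omega)
      (show m + n = nm by omega) (show l + nm = p by omega)]
    subst h₁ h₃
    exact sign_congr ⟨0, by ring⟩ _
  leibniz {X Y Z n m p} h g f := by
    simp only [LinearMap.smul_apply, LinearMap.flip_apply, map_sign, sign_sign]
    rw [A.leibniz, smul_add, sign_sign]
    refine (add_comm _ _).trans (congrArg₂ _ ?_ ?_)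
    · exact sign_congr ⟨0, by ring⟩ _
    · exact sign_congr ⟨-n, by ring⟩ _
end DGCat

/-- A dg-functor: a `K`-linear functor which preserves degrees and commutes with the
differentials. -/
structure DGFunctor {K : Type u} [CommRing K] (A : DGCat.{w, v} K) (B : DGCat.{w', v'} K) where
  obj : A.Obj → B.Obj
  map : ∀ {X Y : A.Obj} {n : ℤ}, A.Hom X Y n →ₗ[K] B.Hom (obj X) (obj Y) n
  map_id : ∀ X : A.Obj, map (A.id X) = B.id (obj X)
  map_comp : ∀ {X Y Z : A.Obj} {n m p : ℤ} (h : n + m = p) (g : A.Hom Y Z n) (f : A.Hom X Y m),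
    map (A.comp h g f) = B.comp h (map g) (map f)
  map_d : ∀ {X Y : A.Obj} {n : ℤ} (f : A.Hom X Y n), map (A.d n f) = B.d n (map f)

namespace DGFunctor

variable {K : Type u} [CommRing K] {A : DGCat.{w, v} K} {B : DGCat.{w', v'} K}
  {D : DGCat.{w'', v''} K}

/-- The composite `G ∘ F` of two dg-functors. -/
def comp (F : DGFunctor A B) (G : DGFunctor B D) : DGFunctor A D where
  obj X := G.obj (F.obj X)
  map := G.map ∘ₗ F.map
  map_id X := by simp [F.map_id, G.map_id]
  map_comp h g f := by simp [F.map_comp, G.map_comp]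
  map_d f := by simp [F.map_d, G.map_d]

/-- The `K`-module of dg-natural transformations of degree `n`: families of morphisms
`η X : F X → G X` of degree `n` with `G(f) ∘ η X = (-1) ^ (n * m) • (η Y ∘ F(f))` for each
homogeneous `f : X → Y` of degree `m`. -/
def dgNat (F G : DGFunctor A B) (n : ℤ) : Submodule K (∀ X, B.Hom (F.obj X) (G.obj X) n) where
  carrier := {η | ∀ {X Y : A.Obj} {m p : ℤ} (h : m + n = p) (f : A.Hom X Y m),
    B.comp h (G.map f) (η X) =
      (n * m).negOnePow • B.comp (show n + m = p by omega) (η Y) (F.map f)}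
  add_mem' ha hb := by
    intro X Y m p h f
    simp [ha h f, hb h f]
  zero_mem' := by
    intro X Y m p h f
    simp
  smul_mem' c η hη := by
    intro X Y m p h f
    simp [hη h f, smul_comm c]

end DGFunctor

/-- The dg-category of dg-functors from `A` to `B`, with the dg-natural transformations as morphisms
and the componentwise differential. -/
@[reducible]
def dgFun {K : Type u} [CommRing K] (A : DGCat.{w, v} K) (B : DGCat.{w', v'} K) :
    DGCat.{max w w' v v', max w v'} K where
  Obj := DGFunctor A B
  Hom F G n := DGFunctor.dgNat F G n
  d {F G} n :=
    { toFun := fun η => ⟨fun X => B.d n (η.1 X), by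
        intro X Y m p h f
        obtain ⟨q, rfl⟩ : ∃ q, p = q + 1 := ⟨p - 1, by omega⟩
        have h1 := B.leibniz (show m + n = q by omega) (G.map f) (η.1 X)
        have h2 := B.leibniz (show n + m = q by omega) (η.1 Y) (F.map f)
        have h3 := congrArg (B.d q) (η.2 (show m + n = q by omega) f)
        have h4 := η.2 (show (m + 1) + n = q + 1 by omega) (A.d m f)
        rw [G.map_d, F.map_d] at h4
        rw [DGCat.map_sign, h1, h2, h4, smul_add, DGCat.sign_sign,
          DGCat.sign_congr (a := n * (m + 1)) (b := n * m + n) ⟨0, by ring⟩] at h3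
        have h5 := congrArg (fun x => m.negOnePow • x) (add_right_cancel ((add_comm _ _).trans h3))
        simp only [DGCat.sign_sign] at h5
        rw [DGCat.sign_congr (a := m + m) (b := 0) ⟨m, by ring⟩, Int.negOnePow_zero, one_smul] at h5
        exact h5.trans (DGCat.sign_congr ⟨0, by ring⟩ _)⟩
      map_add' := fun η θ => by ext X; simp
      map_smul' := fun c η => by ext X; simp }
  id F := ⟨fun X => B.id (F.obj X), by
    intro X Y m p h f
    obtain rfl : m = p := by omega
    rw [B.comp_id, B.id_comp]; simp⟩
  comp {F G H n m p} h := LinearMap.mk₂ K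
    (fun β α => ⟨fun X => B.comp h (β.1 X) (α.1 X), by
      intro X Y l q hq f
      rw [← B.assoc (show l + n = l + n from rfl) (show (l + n) + m = q by omega) h hq, β.2 rfl f,
        DGCat.map_sign, LinearMap.smul_apply,
        B.assoc _ _ (show l + m = l + m from rfl) (show n + (l + m) = q by omega), α.2 rfl f,
        DGCat.map_sign, DGCat.sign_sign,
        B.assoc h (show p + l = q by omega) (show m + l = l + m by omega)
          (show n + (l + m) = q by omega)]
      exact DGCat.sign_congr ⟨0, by subst h; ring⟩ _⟩)
    (fun _ _ _ => by ext X; simp) (fun _ _ _ => by ext X; simp)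
    (fun _ _ _ => by ext X; simp) (fun _ _ _ => by ext X; simp)
  d_d n η := by ext X; exact B.d_d n _
  id_comp η := by ext X; exact B.id_comp _
  comp_id η := by ext X; exact B.comp_id _
  assoc h₁ h₂ h₃ h₄ h g f := by ext X; exact B.assoc h₁ h₂ h₃ h₄ _ _ _
  leibniz h g f := by ext X; exact B.leibniz h _ _

section

variable {K : Type u} [CommRing K] {A : DGCat.{w, v} K} {B : DGCat.{w', v'} K}

theorem dgFun_id_apply (F : DGFunctor A B) (X : A.Obj) :
    ((dgFun A B).id F).1 X = B.id (F.obj X) := rfl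

theorem dgFun_comp_apply {F G H : DGFunctor A B} {n m p : ℤ} (h : n + m = p)
    (β : (dgFun A B).Hom G H n) (α : (dgFun A B).Hom F G m) (X : A.Obj) :
    ((dgFun A B).comp h β α).1 X = B.comp h (β.1 X) (α.1 X) := rfl

theorem dgFun_d_apply {F G : DGFunctor A B} {n : ℤ} (α : (dgFun A B).Hom F G n) (X : A.Obj) :
    ((dgFun A B).d n α).1 X = B.d n (α.1 X) := rfl

end

/-- The `K`-module of morphisms of degree `n` in a tensor product of dg-categories: the direct sum
of the `K`-modules `Hom_A(X, X')^i ⊗ Hom_B(Y, Y')^j` over all `i + j = n`. -/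
abbrev tensorHom {K : Type u} [CommRing K] (A : DGCat.{w, v} K) (B : DGCat.{w', v'} K)
    (X X' : A.Obj) (Y Y' : B.Obj) (n : ℤ) : Type (max v v') :=
  DirectSum {ij : ℤ × ℤ // ij.1 + ij.2 = n} fun ij => A.Hom X X' ij.1.1 ⊗[K] B.Hom Y Y' ij.1.2

namespace tensorHom

variable {K : Type u} [CommRing K] {A : DGCat.{w, v} K} {B : DGCat.{w', v'} K}
  {X X' X'' : A.Obj} {Y Y' Y'' : B.Obj}

/-- The elementary tensor `a ⊗ b`, of degree `n = |a| + |b|`. -/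
def tmul {i j n : ℤ} (h : i + j = n) :
    A.Hom X X' i →ₗ[K] B.Hom Y Y' j →ₗ[K] tensorHom A B X X' Y Y' n :=
  (TensorProduct.mk K _ _).compr₂ (DirectSum.lof K {ij : ℤ × ℤ // ij.1 + ij.2 = n}
    (fun ij => A.Hom X X' ij.1.1 ⊗[K] B.Hom Y Y' ij.1.2) ⟨(i, j), h⟩)

/-- The linear map given by a family of bilinear maps on elementary tensors. -/
def lift {P : Type*} [AddCommGroup P] [Module K P] {n : ℤ}
    (φ : ∀ i j : ℤ, i + j = n → (A.Hom X X' i →ₗ[K] B.Hom Y Y' j →ₗ[K] P)) :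
    tensorHom A B X X' Y Y' n →ₗ[K] P :=
  DirectSum.toModule K _ P fun ij => TensorProduct.lift (φ ij.1.1 ij.1.2 ij.2)

@[simp]
theorem lift_tmul {P : Type*} [AddCommGroup P] [Module K P] {n : ℤ}
    (φ : ∀ i j : ℤ, i + j = n → (A.Hom X X' i →ₗ[K] B.Hom Y Y' j →ₗ[K] P))
    {i j : ℤ} (h : i + j = n) (a : A.Hom X X' i) (b : B.Hom Y Y' j) :
    lift φ (tmul h a b) = φ i j h a b := by
  simp [lift, tmul, DirectSum.toModule_lof]

theorem ext_map {P : Type*} [AddCommGroup P] [Module K P] {n : ℤ}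
    {φ ψ : tensorHom A B X X' Y Y' n →ₗ[K] P}
    (H : ∀ (i j : ℤ) (h : i + j = n) (a : A.Hom X X' i) (b : B.Hom Y Y' j),
      φ (tmul h a b) = ψ (tmul h a b)) : φ = ψ := by
  refine DirectSum.linearMap_ext K fun ij => TensorProduct.ext' fun a b => ?_
  exact H ij.1.1 ij.1.2 ij.2 a b

theorem induction {n : ℤ} {P : tensorHom A B X X' Y Y' n → Prop} (f : tensorHom A B X X' Y Y' n)
    (zero : P 0) (add : ∀ f g, P f → P g → P (f + g))
    (tmul : ∀ (i j : ℤ) (h : i + j = n) (a : A.Hom X X' i) (b : B.Hom Y Y' j), P (tmul h a b)) :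
    P f := by
  induction f using DirectSum.induction_on with
  | zero => exact zero
  | add f g hf hg => exact add f g hf hg
  | of ij x =>
    induction x using TensorProduct.induction_on with
    | zero => rw [map_zero]; exact zero
    | add x y hx hy => rw [map_add]; exact add _ _ hx hy
    | tmul a b => exact tmul ij.1.1 ij.1.2 ij.2 a b

/-- The differential `a ⊗ b ↦ d a ⊗ b + (-1) ^ |a| • a ⊗ d b`. -/
def d (n : ℤ) : tensorHom A B X X' Y Y' n →ₗ[K] tensorHom A B X X' Y Y' (n + 1) :=
  lift fun i j h =>
    (tmul (show (i + 1) + j = n + 1 by omega)).comp (A.d i) +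
      i.negOnePow • (tmul (show i + (j + 1) = n + 1 by omega)).compl₂ (B.d j)

@[simp]
theorem d_tmul {i j n : ℤ} (h : i + j = n) (a : A.Hom X X' i) (b : B.Hom Y Y' j) :
    d n (tmul h a b) = tmul (show (i + 1) + j = n + 1 by omega) (A.d i a) b +
      i.negOnePow • tmul (show i + (j + 1) = n + 1 by omega) a (B.d j b) := by
  simp [d]

/-- The composition `(a₂ ⊗ b₂) ∘ (a₁ ⊗ b₁) = (-1) ^ (|b₂| * |a₁|) • (a₂ ∘ a₁) ⊗ (b₂ ∘ b₁)`. -/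
def comp {n m p : ℤ} (h : n + m = p) :
    tensorHom A B X' X'' Y' Y'' n →ₗ[K] tensorHom A B X X' Y Y' m →ₗ[K]
      tensorHom A B X X'' Y Y'' p :=
  lift fun i j hij => LinearMap.mk₂ K
    (fun a₂ b₂ => lift fun i' j' hij' =>
      (j * i').negOnePow • (tmul (show (i + i') + (j + j') = p by omega)).compl₁₂
        (A.comp rfl a₂) (B.comp rfl b₂))
    (fun _ _ _ => ext_map fun _ _ _ _ _ => by simp)
    (fun _ _ _ => ext_map fun _ _ _ _ _ => by simp; rw [smul_comm])
    (fun _ _ _ => ext_map fun _ _ _ _ _ => by simp)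
    (fun _ _ _ => ext_map fun _ _ _ _ _ => by simp; rw [smul_comm])

theorem comp_tmul {n m p i j i' j' k l : ℤ} (h : n + m = p) (h₁ : i + j = n) (h₂ : i' + j' = m)
    (hk : i + i' = k) (hl : j + j' = l) (a₂ : A.Hom X' X'' i) (b₂ : B.Hom Y' Y'' j)
    (a₁ : A.Hom X X' i') (b₁ : B.Hom Y Y' j') :
    comp h (tmul h₁ a₂ b₂) (tmul h₂ a₁ b₁) =
      (j * i').negOnePow • tmul (show k + l = p by omega) (A.comp hk a₂ a₁) (B.comp hl b₂ b₁) := by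
  subst hk hl
  simp [comp]

end tensorHom

/-- The tensor product of two dg-categories. -/
@[reducible]
def DGCat.tensor {K : Type u} [CommRing K] (A : DGCat.{w, v} K) (B : DGCat.{w', v'} K) :
    DGCat.{max w w', max v v'} K where
  Obj := A.Obj × B.Obj
  Hom P Q n := tensorHom A B P.1 Q.1 P.2 Q.2 n
  d n := tensorHom.d n
  id P := tensorHom.tmul (add_zero 0) (A.id P.1) (B.id P.2)
  comp h := tensorHom.comp h
  d_d {P Q} n f := by
    have H : (tensorHom.d (A := A) (B := B) (X := P.1) (X' := Q.1) (Y := P.2) (Y' := Q.2)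
        (n + 1)).comp (tensorHom.d n) = 0 := by
      refine tensorHom.ext_map fun i j h a b => ?_
      simp [A.d_d, B.d_d, Int.negOnePow_succ]
    exact LinearMap.congr_fun H f
  id_comp {P Q n} f := by
    have H : tensorHom.comp (zero_add n)
        (tensorHom.tmul (add_zero 0) (A.id Q.1) (B.id Q.2)) =
        (LinearMap.id : tensorHom A B P.1 Q.1 P.2 Q.2 n →ₗ[K] _) := by
      refine tensorHom.ext_map fun i j h a b => ?_
      rw [tensorHom.comp_tmul _ _ _ (zero_add i) (zero_add j), A.id_comp, B.id_comp]
      simp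
    exact LinearMap.congr_fun H f
  comp_id {P Q n} f := by
    have H : (tensorHom.comp (add_zero n)).flip
        (tensorHom.tmul (add_zero 0) (A.id P.1) (B.id P.2)) =
        (LinearMap.id : tensorHom A B P.1 Q.1 P.2 Q.2 n →ₗ[K] _) := by
      refine tensorHom.ext_map fun i j h a b => ?_
      rw [LinearMap.flip_apply, tensorHom.comp_tmul _ _ _ (add_zero i) (add_zero j), A.comp_id,
        B.comp_id]
      simp
    exact LinearMap.congr_fun H f
  assoc {P₁ P₂ P₃ P₄ n m l nm ml p} h₁ h₂ h₃ h₄ h g f := by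
    induction h using tensorHom.induction with
    | zero => simp
    | add x y hx hy => simp only [map_add, LinearMap.add_apply, hx, hy]
    | tmul i₁ j₁ e₁ a₁ b₁ =>
    induction g using tensorHom.induction with
    | zero => simp
    | add x y hx hy => simp only [map_add, LinearMap.add_apply, hx, hy]
    | tmul i₂ j₂ e₂ a₂ b₂ =>
    induction f using tensorHom.induction with
    | zero => simp
    | add x y hx hy => simp only [map_add, hx, hy]
    | tmul i₃ j₃ e₃ a₃ b₃ =>
    rw [tensorHom.comp_tmul h₁ e₁ e₂ rfl rfl, tensorHom.comp_tmul h₃ e₂ e₃ rfl rfl, map_sign,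
      map_sign₂, tensorHom.comp_tmul h₂ (by omega) e₃ rfl rfl,
      tensorHom.comp_tmul h₄ e₁ (by omega) (add_assoc i₁ i₂ i₃).symm (add_assoc j₁ j₂ j₃).symm,
      sign_sign, sign_sign, A.assoc rfl rfl rfl (add_assoc i₁ i₂ i₃).symm,
      B.assoc rfl rfl rfl (add_assoc j₁ j₂ j₃).symm]
    exact sign_congr ⟨0, by ring⟩ _
  leibniz {P₁ P₂ P₃ n m p} h g f := by
    induction g using tensorHom.induction with
    | zero => simp
    | add x y hx hy =>
      simp only [map_add, LinearMap.add_apply, hx, hy, smul_add]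
      abel
    | tmul i₁ j₁ e₁ a₁ b₁ =>
    induction f using tensorHom.induction with
    | zero => simp
    | add x y hx hy =>
      simp only [map_add, hx, hy, smul_add]
      abel
    | tmul i₂ j₂ e₂ a₂ b₂ =>
    rw [tensorHom.comp_tmul h e₁ e₂ rfl rfl, map_sign]
    simp only [tensorHom.d_tmul, map_add, LinearMap.add_apply, map_sign, map_sign₂]
    rw [tensorHom.comp_tmul _ _ _ (show i₁ + 1 + i₂ = i₁ + i₂ + 1 by omega) rfl,
      tensorHom.comp_tmul _ _ _ rfl (show j₁ + 1 + j₂ = j₁ + j₂ + 1 by omega),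
      tensorHom.comp_tmul _ _ _ (show i₁ + (i₂ + 1) = i₁ + i₂ + 1 by omega) rfl,
      tensorHom.comp_tmul _ _ _ rfl (show j₁ + (j₂ + 1) = j₁ + j₂ + 1 by omega),
      A.leibniz, B.leibniz]
    simp only [map_add, LinearMap.add_apply, map_sign, map_sign₂, smul_add, sign_sign]
    rw [sign_congr (a := n + j₁ * (i₂ + 1)) (b := j₁ * i₂ + i₁) ⟨j₁, by subst e₁; ring⟩,
      sign_congr (a := i₁ + (j₁ + 1) * i₂) (b := j₁ * i₂ + (i₁ + i₂)) ⟨0, by ring⟩,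
      sign_congr (a := n + (i₂ + j₁ * i₂)) (b := j₁ * i₂ + (i₁ + i₂ + j₁)) ⟨0, by subst e₁; ring⟩]
    exact add_add_add_comm _ _ _ _

namespace DGCat

variable {K : Type u} [CommRing K] {A : DGCat.{w, v} K} {B : DGCat.{w', v'} K}

/-- The object `(X, Y)` of the tensor product of two dg-categories. -/
def tobj (X : A.Obj) (Y : B.Obj) : (A.tensor B).Obj := (X, Y)

/-- The morphism `f ⊗ g : (X, Y) → (X', Y')` of the tensor product of two dg-categories. -/
def ten {X X' : A.Obj} {Y Y' : B.Obj} {i j n : ℤ} (h : i + j = n) :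
    A.Hom X X' i →ₗ[K] B.Hom Y Y' j →ₗ[K] (A.tensor B).Hom (tobj X Y) (tobj X' Y') n :=
  tensorHom.tmul h

theorem ten_id (X : A.Obj) (Y : B.Obj) :
    (A.tensor B).id (tobj X Y) = ten (add_zero 0) (A.id X) (B.id Y) := rfl

theorem ten_comp {X X' X'' : A.Obj} {Y Y' Y'' : B.Obj} {n m p i j i' j' k l : ℤ} (h : n + m = p)
    (h₁ : i + j = n) (h₂ : i' + j' = m) (hk : i + i' = k) (hl : j + j' = l)
    (a₂ : A.Hom X' X'' i) (b₂ : B.Hom Y' Y'' j) (a₁ : A.Hom X X' i') (b₁ : B.Hom Y Y' j') :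
    (A.tensor B).comp h (ten h₁ a₂ b₂) (ten h₂ a₁ b₁) =
      (j * i').negOnePow • ten (show k + l = p by omega) (A.comp hk a₂ a₁) (B.comp hl b₂ b₁) :=
  tensorHom.comp_tmul h h₁ h₂ hk hl a₂ b₂ a₁ b₁

theorem ten_d {X X' : A.Obj} {Y Y' : B.Obj} {i j n : ℤ} (h : i + j = n) (a : A.Hom X X' i)
    (b : B.Hom Y Y' j) :
    (A.tensor B).d n (ten h a b) = ten (show (i + 1) + j = n + 1 by omega) (A.d i a) b +
      i.negOnePow • ten (show i + (j + 1) = n + 1 by omega) a (B.d j b) :=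
  tensorHom.d_tmul h a b

theorem ten_induction {X X' : A.Obj} {Y Y' : B.Obj} {n : ℤ}
    {P : (A.tensor B).Hom (tobj X Y) (tobj X' Y') n → Prop} (f : (A.tensor B).Hom (tobj X Y) (tobj X' Y') n)
    (zero : P 0) (add : ∀ f g, P f → P g → P (f + g))
    (ten : ∀ (i j : ℤ) (h : i + j = n) (a : A.Hom X X' i) (b : B.Hom Y Y' j), P (ten h a b)) :
    P f :=
  tensorHom.induction f zero add ten

/-- The linear map on morphisms of a tensor product given by its values on the `f ⊗ g`. -/
def tenLift {X X' : A.Obj} {Y Y' : B.Obj} {P : Type*} [AddCommGroup P] [Module K P] {n : ℤ}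
    (φ : ∀ i j : ℤ, i + j = n → (A.Hom X X' i →ₗ[K] B.Hom Y Y' j →ₗ[K] P)) :
    (A.tensor B).Hom (tobj X Y) (tobj X' Y') n →ₗ[K] P :=
  tensorHom.lift φ

@[simp]
theorem tenLift_ten {X X' : A.Obj} {Y Y' : B.Obj} {P : Type*} [AddCommGroup P] [Module K P] {n : ℤ}
    (φ : ∀ i j : ℤ, i + j = n → (A.Hom X X' i →ₗ[K] B.Hom Y Y' j →ₗ[K] P))
    {i j : ℤ} (h : i + j = n) (a : A.Hom X X' i) (b : B.Hom Y Y' j) :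
    tenLift φ (ten h a b) = φ i j h a b :=
  tensorHom.lift_tmul φ h a b

end DGCat

namespace DGFunctor

open DGCat

variable {K : Type u} [CommRing K] {A : DGCat.{w, v} K} {B : DGCat.{w', v'} K}
  {D : DGCat.{w'', v''} K}

/-- For a dg-functor `F : A ⊗ B → D` and an object `Y` of `B`, the dg-functor `F (-, Y) : A → D`,
given on morphisms by `f ↦ F (f ⊗ 1)`. -/
def curryObj (F : DGFunctor (A.tensor B) D) (Y : B.Obj) : DGFunctor A D where
  obj X := F.obj (tobj X Y)
  map {X X' n} := F.map ∘ₗ (ten (add_zero n)).flip (B.id Y)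
  map_id X := F.map_id (tobj X Y)
  map_comp {X X' X'' n m p} h g f := by
    simp only [LinearMap.comp_apply, LinearMap.flip_apply]
    rw [← F.map_comp, ten_comp h _ _ h (add_zero 0), B.id_comp]
    simp
  map_d {X X' n} f := by
    simp only [LinearMap.comp_apply, LinearMap.flip_apply]
    rw [← F.map_d, ten_d, B.d_id]
    simp

theorem curryObj_map (F : DGFunctor (A.tensor B) D) (Y : B.Obj) {X X' : A.Obj} {n : ℤ}
    (f : A.Hom X X' n) : (F.curryObj Y).map f = F.map (ten (add_zero n) f (B.id Y)) := rfl

/-- For a dg-functor `F : A ⊗ B → D`, the dg-natural transformation `X ↦ F (1 ⊗ g)` attached to a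
morphism `g` of `B`. -/
def curryMap (F : DGFunctor (A.tensor B) D) (Y Y' : B.Obj) (n : ℤ) :
    B.Hom Y Y' n →ₗ[K] dgNat (F.curryObj Y) (F.curryObj Y') n :=
  LinearMap.codRestrict _ (LinearMap.pi fun X => F.map ∘ₗ ten (zero_add n) (A.id X)) <| by
    intro g X X' m p h f
    change D.comp h (F.map (ten (add_zero m) f (B.id Y'))) (F.map (ten (zero_add n) (A.id X) g)) =
      (n * m).negOnePow • D.comp (show n + m = p by omega) (F.map (ten (zero_add n) (A.id X') g))
        (F.map (ten (add_zero m) f (B.id Y)))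
    rw [← F.map_comp, ← F.map_comp, ← map_sign, ten_comp h _ _ (add_zero m) (zero_add n),
      ten_comp _ _ _ (zero_add m) (add_zero n), A.id_comp, A.comp_id, B.id_comp, B.comp_id,
      sign_sign, sign_congr (a := n * m + n * m) (b := 0) ⟨n * m, by ring⟩]
    simp

theorem curryMap_apply (F : DGFunctor (A.tensor B) D) {Y Y' : B.Obj} {n : ℤ} (g : B.Hom Y Y' n)
    (X : A.Obj) : (F.curryMap Y Y' n g).1 X = F.map (ten (zero_add n) (A.id X) g) := rfl

/-- The dg-functor `B → DgFun(A, D)` attached to a dg-functor `F : A ⊗ B → D`. -/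
def curry (F : DGFunctor (A.tensor B) D) : DGFunctor B (dgFun A D) where
  obj := F.curryObj
  map {Y Y' n} := F.curryMap Y Y' n
  map_id Y := Subtype.ext <| funext fun X => F.map_id (tobj X Y)
  map_comp {Y Y' Y'' n m p} h g f := Subtype.ext <| funext fun X => by
    refine Eq.trans ?_ (F.map_comp h (ten (zero_add n) (A.id X) g) (ten (zero_add m) (A.id X) f))
    rw [ten_comp h _ _ (add_zero 0) h, A.id_comp, curryMap_apply, mul_zero,
      Int.negOnePow_zero, one_smul]
  map_d {Y Y' n} g := Subtype.ext <| funext fun X => by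
    refine Eq.trans ?_ (F.map_d (ten (zero_add n) (A.id X) g))
    rw [ten_d, A.d_id, curryMap_apply, map_zero, LinearMap.zero_apply, zero_add,
      Int.negOnePow_zero, one_smul]

/-- The map `f ⊗ g ↦ (G Y')(f) ∘ G(g)_X` on morphisms of degree `n`. -/
def uncurryMap (G : DGFunctor B (dgFun A D)) (X X' : A.Obj) (Y Y' : B.Obj) (n : ℤ) :
    (A.tensor B).Hom (tobj X Y) (tobj X' Y') n →ₗ[K]
      D.Hom ((G.obj Y).obj X) ((G.obj Y').obj X') n :=
  tenLift fun i j h => LinearMap.mk₂ K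
    (fun f g => D.comp h ((G.obj Y').map f) ((G.map g).1 X))
    (fun _ _ _ => by simp) (fun _ _ _ => by simp)
    (fun _ _ _ => by
      rw [map_add]
      exact map_add _ _ _)
    (fun _ _ _ => by
      rw [map_smul]
      exact map_smul _ _ _)

theorem uncurryMap_ten (G : DGFunctor B (dgFun A D)) {X X' : A.Obj} {Y Y' : B.Obj} {i j n : ℤ}
    (h : i + j = n) (f : A.Hom X X' i) (g : B.Hom Y Y' j) :
    uncurryMap G X X' Y Y' n (ten h f g) = D.comp h ((G.obj Y').map f) ((G.map g).1 X) :=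
  tenLift_ten _ h f g

theorem uncurryMap_comp (G : DGFunctor B (dgFun A D)) {X₁ X₂ X₃ : A.Obj} {Y₁ Y₂ Y₃ : B.Obj}
    {n m p : ℤ} (h : n + m = p) (g : (A.tensor B).Hom (tobj X₂ Y₂) (tobj X₃ Y₃) n)
    (f : (A.tensor B).Hom (tobj X₁ Y₁) (tobj X₂ Y₂) m) :
    uncurryMap G X₁ X₃ Y₁ Y₃ p ((A.tensor B).comp h g f) =
      D.comp h (uncurryMap G X₂ X₃ Y₂ Y₃ n g) (uncurryMap G X₁ X₂ Y₁ Y₂ m f) := by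
  induction g using ten_induction with
  | zero => simp
  | add x y hx hy => simp only [map_add, LinearMap.add_apply, hx, hy]
  | ten i₁ j₁ e₁ a₁ b₁ =>
  induction f using ten_induction with
  | zero => simp
  | add x y hx hy => simp only [map_add, hx, hy]
  | ten i₂ j₂ e₂ a₂ b₂ =>
  rw [ten_comp h e₁ e₂ rfl rfl, map_sign, uncurryMap_ten, uncurryMap_ten, uncurryMap_ten,
    G.map_comp, DGFunctor.map_comp]
  have h₁ := (G.map b₁).2 (show i₂ + j₁ = i₂ + j₁ from rfl) a₂
  have h₂ := congrArg (fun z => (j₁ * i₂).negOnePow • z) h₁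
  simp only [sign_sign] at h₂
  rw [sign_congr (a := j₁ * i₂ + j₁ * i₂) (b := 0) ⟨j₁ * i₂, by ring⟩, Int.negOnePow_zero, one_smul] at h₂
  rw [D.assoc e₁ h (show j₁ + m = j₁ + m from rfl) (by omega),
    ← D.assoc (show j₁ + i₂ = i₂ + j₁ by omega) (by omega) e₂ rfl, ← h₂, map_sign₂, map_sign]
  rw [D.assoc rfl _ (show i₂ + (j₁ + j₂) = j₁ + m by omega) (by omega),
    D.assoc (show i₂ + j₁ = i₂ + j₁ from rfl) _ (show j₁ + j₂ = j₁ + j₂ from rfl) (by omega), dgFun_comp_apply]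

theorem uncurryMap_d (G : DGFunctor B (dgFun A D)) {X X' : A.Obj} {Y Y' : B.Obj} {n : ℤ}
    (f : (A.tensor B).Hom (tobj X Y) (tobj X' Y') n) :
    uncurryMap G X X' Y Y' (n + 1) ((A.tensor B).d n f) =
      D.d n (uncurryMap G X X' Y Y' n f) := by
  induction f using ten_induction with
  | zero => simp
  | add x y hx hy => simp only [map_add, hx, hy]
  | ten i j e a b =>
  rw [ten_d, map_add, map_sign, uncurryMap_ten, uncurryMap_ten, uncurryMap_ten, D.leibniz, G.map_d,
    DGFunctor.map_d]
  rfl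

/-- The dg-functor `A ⊗ B → D` attached to a dg-functor `G : B → DgFun(A, D)`, with
`(X, Y) ↦ G Y X` on objects and `f ⊗ g ↦ (G Y')(f) ∘ G(g)_X` on morphisms. -/
def uncurry (G : DGFunctor B (dgFun A D)) : DGFunctor (A.tensor B) D where
  obj := fun P : A.Obj × B.Obj => (G.obj P.2).obj P.1
  map := fun {P Q : A.Obj × B.Obj} {n} => uncurryMap G P.1 Q.1 P.2 Q.2 n
  map_id := fun P : A.Obj × B.Obj => by
    refine (uncurryMap_ten G (add_zero 0) (A.id P.1) (B.id P.2)).trans ?_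
    rw [G.map_id, DGFunctor.map_id]
    exact D.id_comp _
  map_comp := fun h g f => uncurryMap_comp G h g f
  map_d := fun f => uncurryMap_d G f

theorem uncurry_map_ten (G : DGFunctor B (dgFun A D)) {X X' : A.Obj} {Y Y' : B.Obj} {i j n : ℤ}
    (h : i + j = n) (f : A.Hom X X' i) (g : B.Hom Y Y' j) :
    G.uncurry.map (ten h f g) = D.comp h ((G.obj Y').map f) ((G.map g).1 X) :=
  uncurryMap_ten G h f g

end DGFunctor

/-- The dg-category `DgMod(C)` of left dg `C`-modules: dg-functors from `C` to `DgMod(K)`. -/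
abbrev dgMod {K : Type u} [CommRing K] (C : DGCat.{w, v} K) :
    DGCat.{max w v u (v' + 1), max w v'} K :=
  dgFun C (DGCat.dgModBase.{v'} K)

namespace DGFunctor

open DGCat

variable {K : Type u} [CommRing K]

/-- A cochain between dg `K`-modules, as a bilinear evaluation on homogeneous elements. -/
def evalCochain {F G : CochainComplex (ModuleCat.{v} K) ℤ} {n m p : ℤ} (h : n + m = p) :
    Cochain F G n →ₗ[K] F.X m →ₗ[K] G.X p :=
  LinearMap.mk₂ K (fun φ x => (φ.v m p (by omega)).hom x)
    (fun _ _ _ => by simp) (fun _ _ _ => by simp) (fun _ _ _ => map_add _ _ _) (fun _ _ _ => map_smul _ _ _)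

/-- The differential of a dg `K`-module, as a linear map on homogeneous components. -/
def diffCochain (F : CochainComplex (ModuleCat.{v} K) ℤ) (n : ℤ) : F.X n →ₗ[K] F.X (n + 1) :=
  (F.d n (n + 1)).hom

theorem evalCochain_apply {F G : CochainComplex (ModuleCat.{v} K) ℤ} {n m p : ℤ} (h : n + m = p)
    (φ : Cochain F G n) (x : F.X m) : evalCochain h φ x = (φ.v m p (by omega)).hom x := rfl

theorem evalCochain_id (F : CochainComplex (ModuleCat.{v} K) ℤ) {n : ℤ} (x : F.X n) :
    evalCochain (zero_add n) ((dgModBase K).id F) x = x := by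
  change evalCochain _ (Cochain.ofHom (𝟙 F)) x = x
  rw [evalCochain_apply, Cochain.ofHom_v]
  rfl

theorem evalCochain_comp {F G H : CochainComplex (ModuleCat.{v} K) ℤ} {n m l nm ml p : ℤ}
    (h₁ : n + m = nm) (h₂ : nm + l = p) (h₃ : m + l = ml) (h₄ : n + ml = p)
    (g : Cochain G H n) (f : Cochain F G m) (x : F.X l) :
    evalCochain h₂ ((dgModBase K).comp h₁ g f) x = evalCochain h₄ g (evalCochain h₃ f x) := by
  change evalCochain h₂ (f.comp g (show m + n = nm by omega)) x = _
  rw [evalCochain_apply, evalCochain_apply, evalCochain_apply, Cochain.comp_v f g _ l ml p (by omega) (by omega)]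
  rfl

theorem evalCochain_d {F G : CochainComplex (ModuleCat.{v} K) ℤ} {n m p : ℤ} (h : n + m = p)
    (f : Cochain F G n) (x : F.X m) :
    diffCochain G p (evalCochain h f x) =
      evalCochain (show (n + 1) + m = p + 1 by omega) ((dgModBase K).d n f) x +
        n.negOnePow • evalCochain (show n + (m + 1) = p + 1 by omega) f (diffCochain F m x) := by
  change _ = evalCochain _ (δ n (n + 1) f) x + _
  simp only [evalCochain_apply, diffCochain]
  rw [δ_v n (n + 1) rfl f m (p + 1) (by omega) p (m + 1) (by omega) rfl]
  simp [Int.negOnePow_succ]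

theorem diffCochain_diffCochain (F : CochainComplex (ModuleCat.{v} K) ℤ) (n : ℤ) (x : F.X n) :
    diffCochain F (n + 1) (diffCochain F n x) = 0 := by
  have := F.d_comp_d n (n + 1) (n + 1 + 1)
  exact LinearMap.congr_fun (congrArg ModuleCat.Hom.hom this) x

/-! Here `M` is a dg-bimodule, that is, a dg-functor `R ⊗ Tᵒᵖ → DgMod(K)`. -/

variable {R : DGCat.{w, v} K} {T : DGCat.{w', v'} K}

/-- The left action `r • m = M (r ⊗ 1) m` on a dg-bimodule. -/
def lact (M : (dgMod.{_, _, v''} (R.tensor T.op)).Obj) {X Y : R.Obj} (Z : T.Obj) {n m p : ℤ}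
    (h : n + m = p) :
    R.Hom X Y n →ₗ[K] (M.obj (tobj X Z)).X m →ₗ[K] (M.obj (tobj Y Z)).X p :=
  evalCochain h ∘ₗ M.map ∘ₗ (ten (B := T.op) (add_zero n)).flip (T.op.id Z)

/-- The right action `m • t = (-1) ^ (|m| * |t|) • M (1 ⊗ t) m` on a dg-bimodule. -/
def ract (M : (dgMod.{_, _, v''} (R.tensor T.op)).Obj) (X : R.Obj) {Y Z : T.Obj} {n m p : ℤ}
    (h : n + m = p) :
    (M.obj (tobj X Z)).X n →ₗ[K] T.Hom Y Z m →ₗ[K] (M.obj (tobj X Y)).X p :=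
  (n * m).negOnePow • (evalCochain (show m + n = p by omega) ∘ₗ M.map ∘ₗ
    ten (B := T.op) (X := X) (X' := X) (zero_add m) (R.id X)).flip

variable (M : (dgMod.{_, _, v''} (R.tensor T.op)).Obj)

theorem lact_apply {X Y : R.Obj} (Z : T.Obj) {n m p : ℤ} (h : n + m = p) (r : R.Hom X Y n)
    (x : (M.obj (tobj X Z)).X m) :
    lact M Z h r x = evalCochain h (M.map (ten (B := T.op) (add_zero n) r (T.op.id Z))) x := rfl

theorem ract_apply (X : R.Obj) {Y Z : T.Obj} {n m p : ℤ} (h : n + m = p)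
    (x : (M.obj (tobj X Z)).X n) (t : T.Hom Y Z m) :
    ract M X h x t = (n * m).negOnePow • evalCochain (show m + n = p by omega)
      (M.map (ten (B := T.op) (X := X) (X' := X) (zero_add m) (R.id X) t)) x := rfl

theorem id_lact (X : R.Obj) (Z : T.Obj) {n : ℤ} (x : (M.obj (tobj X Z)).X n) :
    lact M Z (zero_add n) (R.id X) x = x := by
  rw [lact_apply, ← ten_id, M.map_id, evalCochain_id]

theorem ract_id (X : R.Obj) (Z : T.Obj) {n : ℤ} (x : (M.obj (tobj X Z)).X n) :
    ract M X (add_zero n) x (T.id Z) = x := by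
  rw [ract_apply]
  change _ • evalCochain _ (M.map (ten (B := T.op) _ (R.id X) (T.op.id Z))) x = x
  rw [← ten_id, M.map_id, evalCochain_id]
  simp

theorem lact_lact {X Y W : R.Obj} (Z : T.Obj) {n m l nm ml p : ℤ} (h₁ : n + m = nm)
    (h₂ : nm + l = p) (h₃ : m + l = ml) (h₄ : n + ml = p) (r : R.Hom Y W n) (s : R.Hom X Y m)
    (x : (M.obj (tobj X Z)).X l) :
    lact M Z h₂ (R.comp h₁ r s) x = lact M Z h₄ r (lact M Z h₃ s x) := by
  rw [lact_apply, lact_apply, lact_apply, ← evalCochain_comp h₁ h₂, ← M.map_comp,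
    ten_comp h₁ _ _ h₁ (add_zero 0), T.op.id_comp]
  simp

theorem ract_ract (X : R.Obj) {W Y Z : T.Obj} {n m l nm ml p : ℤ} (h₁ : n + m = nm)
    (h₂ : nm + l = p) (h₃ : m + l = ml) (h₄ : n + ml = p) (x : (M.obj (tobj X Z)).X n)
    (t : T.Hom Y Z m) (s : T.Hom W Y l) :
    ract M X h₂ (ract M X h₁ x t) s = ract M X h₄ x (T.comp h₃ t s) := by
  rw [ract_apply, ract_apply, ract_apply, map_sign,
    ← evalCochain_comp (show l + m = ml by omega) (show ml + n = p by omega), ← M.map_comp,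
    ten_comp (show l + m = ml by omega) _ _ (add_zero 0) (show l + m = ml by omega), R.id_comp]
  simp only [LinearMap.smul_apply, LinearMap.flip_apply, map_sign, sign_sign]
  exact sign_congr ⟨l * m, by subst h₁ h₃; ring⟩ _

theorem lact_ract {X Y : R.Obj} {W Z : T.Obj} {n m l nm ml p : ℤ} (h₁ : n + m = nm)
    (h₂ : nm + l = p) (h₃ : m + l = ml) (h₄ : n + ml = p) (r : R.Hom X Y n)
    (x : (M.obj (tobj X Z)).X m) (t : T.Hom W Z l) :
    ract M Y h₂ (lact M Z h₁ r x) t = lact M W h₄ r (ract M X h₃ x t) := by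
  rw [ract_apply, lact_apply, lact_apply, ract_apply, map_sign,
    ← evalCochain_comp (show l + n = l + n from rfl) (by omega), ← M.map_comp,
    ← evalCochain_comp (show n + l = l + n by omega) (by omega), ← M.map_comp,
    ten_comp _ _ _ (zero_add n) (add_zero l), ten_comp _ _ _ (add_zero n) (zero_add l), R.id_comp,
    R.comp_id, T.op.id_comp, T.op.comp_id, map_sign, map_sign₂, sign_sign, mul_zero, Int.negOnePow_zero, one_smul]
  exact sign_congr ⟨l * n, by subst h₁; ring⟩ _

theorem lact_d {X Y : R.Obj} (Z : T.Obj) {n m p : ℤ} (h : n + m = p) (r : R.Hom X Y n)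
    (x : (M.obj (tobj X Z)).X m) :
    diffCochain _ p (lact M Z h r x) = lact M Z (show (n + 1) + m = p + 1 by omega) (R.d n r) x +
      n.negOnePow • lact M Z (show n + (m + 1) = p + 1 by omega) r (diffCochain _ m x) := by
  rw [lact_apply, evalCochain_d, ← M.map_d, ten_d, T.op.d_id, map_zero, smul_zero, add_zero]
  rfl

theorem ract_d (X : R.Obj) {Y Z : T.Obj} {n m p : ℤ} (h : n + m = p)
    (x : (M.obj (tobj X Z)).X n) (t : T.Hom Y Z m) :
    diffCochain _ p (ract M X h x t) =
      ract M X (show (n + 1) + m = p + 1 by omega) (diffCochain _ n x) t +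
      n.negOnePow • ract M X (show n + (m + 1) = p + 1 by omega) x (T.d m t) := by
  rw [ract_apply, map_sign, evalCochain_d, ← M.map_d, ten_d, R.d_id, map_zero,
    LinearMap.zero_apply, zero_add, Int.negOnePow_zero, one_smul, smul_add, sign_sign,
    ract_apply, ract_apply, sign_sign]
  refine (add_comm _ _).trans (congrArg₂ _ ?_ ?_)
  · exact sign_congr ⟨0, by ring⟩ _
  · exact sign_congr ⟨-n, by ring⟩ _

end DGFunctor

open DGFunctor in
/-- The triangular matrix dg-category `[[T, 0], [M, R]]`.  Its objects are the pairs of an object of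
`T` and an object of `R`; a morphism `(X, Y) → (X', Y')` of degree `n` is a triple `(t, m, r)`
consisting of the entries `t : X → X'`, `m ∈ M (Y', X)`, `r : Y → Y'` of degree `n` of a lower
triangular matrix.  Composition is matrix multiplication, and the differential is taken entrywise. -/
@[reducible]
def triMat {K : Type u} [CommRing K] (T : DGCat.{w', v'} K) (R : DGCat.{w, v} K)
    (M : (dgMod.{_, _, v''} (R.tensor T.op)).Obj) : DGCat.{max w w', max v v' v''} K where
  Obj := T.Obj × R.Obj
  Hom P Q n := T.Hom P.1 Q.1 n × (M.obj (DGCat.tobj Q.2 P.1)).X n × R.Hom P.2 Q.2 n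
  d n := (T.d n).prodMap ((diffCochain _ n).prodMap (R.d n))
  id P := (T.id P.1, 0, R.id P.2)
  comp {P P' P'' n m p} h := LinearMap.mk₂ K
    (fun g f => (T.comp h g.1 f.1, ract M P''.2 h g.2.1 f.1 + lact M P.1 h g.2.2 f.2.1,
      R.comp h g.2.2 f.2.2))
    (fun g g' f => by
      simp only [Prod.fst_add, Prod.snd_add, map_add, LinearMap.add_apply, Prod.mk_add_mk]
      rw [add_add_add_comm])
    (fun c g f => by
      simp only [Prod.smul_fst, Prod.smul_snd, map_smul, LinearMap.smul_apply, Prod.smul_mk,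
        smul_add])
    (fun g f f' => by
      simp only [Prod.fst_add, Prod.snd_add, map_add, Prod.mk_add_mk]
      rw [add_add_add_comm])
    (fun c g f => by
      simp only [Prod.smul_fst, Prod.smul_snd, map_smul, Prod.smul_mk, smul_add])
  d_d n f := by
    simp only [LinearMap.prodMap_apply, T.d_d, R.d_d, diffCochain_diffCochain]
    rfl
  id_comp f := by
    simp only [LinearMap.mk₂_apply, T.id_comp, R.id_comp, id_lact, map_zero, LinearMap.zero_apply,
      zero_add]
  comp_id f := by
    simp only [LinearMap.mk₂_apply, T.comp_id, R.comp_id, ract_id, map_zero, add_zero]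
  assoc {P₁ P₂ P₃ P₄ n m l nm ml p} h₁ h₂ h₃ h₄ h g f := by
    simp only [LinearMap.mk₂_apply, map_add, LinearMap.add_apply, T.assoc h₁ h₂ h₃ h₄,
      R.assoc h₁ h₂ h₃ h₄, ract_ract M _ h₁ h₂ h₃ h₄, lact_ract M h₁ h₂ h₃ h₄,
      lact_lact M _ h₁ h₂ h₃ h₄, add_assoc]
  leibniz {P₁ P₂ P₃ n m p} h g f := by
    simp only [LinearMap.mk₂_apply, LinearMap.prodMap_apply, map_add, T.leibniz, R.leibniz,
      ract_d, lact_d, Prod.smul_mk, Prod.mk_add_mk, smul_add]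
    rw [add_add_add_comm]

/-- The dg-bimodule `F(M)` obtained by applying a dg-functor `F : DgMod(R) → DgMod(S)` to a
dg-bimodule `M : R ⊗ Tᵒᵖ → DgMod(K)` in the variable of `R`: it is given by
`F(M)(Y, X) = F(M_X)(Y)`, where `M_X = M(-, X)`, on objects and by
`F(M)(g ⊗ t) = F(M_X')(g) ∘ F(M(-, t))_Y` on morphisms. -/
def pushBimodule {K : Type u} [CommRing K] {R : DGCat.{w, v} K} {S : DGCat.{w'', v''} K}
    {T : DGCat.{w', v'} K} (F : DGFunctor (dgMod.{_, _, u} R) (dgMod.{_, _, u} S))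
    (M : (dgMod.{_, _, u} (R.tensor T.op)).Obj) : (dgMod.{_, _, u} (S.tensor T.op)).Obj :=
  ((DGFunctor.curry M).comp F).uncurry

theorem pushBimodule_obj {K : Type u} [CommRing K] {R : DGCat.{w, v} K} {S : DGCat.{w'', v''} K}
    {T : DGCat.{w', v'} K} (F : DGFunctor (dgMod.{_, _, u} R) (dgMod.{_, _, u} S))
    (M : (dgMod.{_, _, u} (R.tensor T.op)).Obj) (Y : S.Obj) (X : T.Obj) :
    (pushBimodule F M).obj (DGCat.tobj Y X) = DGFunctor.obj (F.obj (M.curryObj X)) Y := rfl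

theorem pushBimodule_map {K : Type u} [CommRing K] {R : DGCat.{w, v} K} {S : DGCat.{w'', v''} K}
    {T : DGCat.{w', v'} K} (F : DGFunctor (dgMod.{_, _, u} R) (dgMod.{_, _, u} S))
    (M : (dgMod.{_, _, u} (R.tensor T.op)).Obj) {Y Y' : S.Obj} {X X' : T.Obj} {i j n : ℤ}
    (h : i + j = n) (g : S.Hom Y Y' i) (t : T.Hom X' X j) :
    (pushBimodule F M).map (DGCat.ten (B := T.op) (X := Y) (X' := Y') (Y := X) (Y' := X') h g t) =
      (DGCat.dgModBase K).comp h ((F.obj (M.curryObj X')).map g)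
        ((F.map (M.curryMap (B := T.op) X X' j t)).1 Y) :=
  DGFunctor.uncurry_map_ten ((DGFunctor.curry M).comp F) h g t

section

variable {K : Type u} [CommRing K] {A : DGCat.{w, v} K} {B : DGCat.{w', v'} K}
  {C : DGCat.{w'', v''} K}

/-- A dg-adjunction between dg-functors `F : A → B` and `G : B → A`: an isomorphism of complexes
`B(F X, Y) ≃ A(X, G Y)` which is natural in `X` and `Y`. -/
structure DGAdjunction (F : DGFunctor A B) (G : DGFunctor B A) where
  homEquiv : ∀ (X : A.Obj) (Y : B.Obj) (n : ℤ), B.Hom (F.obj X) Y n ≃ₗ[K] A.Hom X (G.obj Y) n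
  homEquiv_d : ∀ (X : A.Obj) (Y : B.Obj) (n : ℤ) (f : B.Hom (F.obj X) Y n),
    homEquiv X Y (n + 1) (B.d n f) = A.d n (homEquiv X Y n f)
  homEquiv_naturality_left : ∀ {X' X : A.Obj} {Y : B.Obj} {n m p : ℤ} (h : n + m = p)
    (f : B.Hom (F.obj X) Y n) (a : A.Hom X' X m),
    homEquiv X' Y p (B.comp h f (F.map a)) = A.comp h (homEquiv X Y n f) a
  homEquiv_naturality_right : ∀ {X : A.Obj} {Y Y' : B.Obj} {n m p : ℤ} (h : n + m = p)
    (b : B.Hom Y Y' n) (f : B.Hom (F.obj X) Y m),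
    homEquiv X Y' p (B.comp h b f) = A.comp h (G.map b) (homEquiv X Y m f)

/-- A dg-functor is dg-fully faithful if it is an isomorphism on all complexes of morphisms. -/
def DGFunctor.FullyFaithful (F : DGFunctor A B) : Prop :=
  ∀ (X Y : A.Obj) (n : ℤ),
    Function.Bijective (F.map : A.Hom X Y n → B.Hom (F.obj X) (F.obj Y) n)

/-- A dg-functor is zero if its values are zero objects, that is, objects whose identity is `0`. -/
def DGFunctor.IsZero (F : DGFunctor A B) : Prop :=
  ∀ X : A.Obj, B.id (F.obj X) = 0

/-- The dg-functors `iU = i^*`, `iL = i_*`, `jL = j_!`, `jU = j^!` in the diagram `C ⇄ A ⇄ B` form a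
left dg-recollement. -/
structure IsLeftDGRecollement (iU : DGFunctor A C) (iL : DGFunctor C A) (jL : DGFunctor B A)
    (jU : DGFunctor A B) : Prop where
  adj_i : Nonempty (DGAdjunction iU iL)
  adj_j : Nonempty (DGAdjunction jL jU)
  comp_isZero : (iL.comp jU).IsZero
  fullyFaithful_i : iL.FullyFaithful
  fullyFaithful_j : jL.FullyFaithful

/-- The dg-functors `iL = i_!`, `iU = i^!`, `jU = j^*`, `jL = j_*` in the diagram `C ⇄ A ⇄ B` form a
right dg-recollement. -/
structure IsRightDGRecollement (iL : DGFunctor C A) (iU : DGFunctor A C) (jU : DGFunctor A B)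
    (jL : DGFunctor B A) : Prop where
  adj_i : Nonempty (DGAdjunction iL iU)
  adj_j : Nonempty (DGAdjunction jU jL)
  comp_isZero : (iL.comp jU).IsZero
  fullyFaithful_i : iL.FullyFaithful
  fullyFaithful_j : jL.FullyFaithful

end

/-! Write `P = curry M` for the dg-functor `t ↦ M(-, t)` from `Tᵒᵖ` to `DgMod(R)`. The identity of
an object `(t, r)` of `Λ` is the sum of two orthogonal closed idempotents, so a dg-module over `Λ`
splits as `F (t, r) ≅ X t ⊕ Y r`, with `X` a dg `T`-module and `Y` a dg `R`-module. The lower left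
entries act by a pairing of `M (r, t)` with `X t` into `Y r`, and such a pairing is the same as a
closed morphism `X → DgMod(R)(P(-), Y)` of degree `0`. Hence `DgMod(Λ)` is equivalent to the
dg-category `glue P` of these triples as soon as `T` and `R` have objects
(`exists_isDGEquivalence_glueToModule`).

Triples make sense for any dg-functor `P : Tᵒᵖ → D`, and in this language the theorem is formal. Let
`j` be the fully faithful dg-functor `j_!` or `j_*`. The bimodule `j(M)` corresponds to `P.comp j`,
so `glue (P.comp j)` has to be related to `glue P` and to `DgMod(C)`.

The new `j` is `(X, Y) ↦ (X, j Y)`; it is fully faithful because `j` is. Its adjoint is `(X, Y) ↦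
(X, H Y)`, where `H` is the given adjoint of `j`. To define its structure map, natural maps from
`Hom(j Q, Y)` to `Hom(Q, H Y)` are needed. If `H` is right adjoint to `j`, the adjunction supplies
them. If `H` is left adjoint to `j`, they are `f ↦ H f` composed with the inverse of the counit `H j
Q → Q`, which is invertible because `j` is fully faithful. The dg-adjunctions are
`glueRightAdjunction` and `glueLeftAdjunction`.

The new `i` is `Z ↦ (0, i Z)`, and its adjoint is the given adjoint of `i` applied to the second
component. In the right case this is immediate, since `Y ↦ (0, Y)` is left adjoint to `(X, Y) ↦ Y`.
In the left case a morphism `(X, Y) → (0, i Z)` is a morphism `Y → i Z` subject to an equation in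
`Hom(j (P t), i Z)`, and this complex vanishes because `j^! i_* = 0` (`glueSndAdjunction`).

The recollement of triples is then transported along the equivalences with dg-modules. If `R` has no
object, `Λ` has none either and `DgMod(Λ)` consists of zero objects; then the same `i` part is kept
and the `j` part is taken to be zero. -/

namespace DGFunctor

open DGCat

variable {K : Type u} [CommRing K]

/-! ### Dg-modules and dg-natural transformations on homogeneous elements -/

section Cochain

variable {F G : CochainComplex (ModuleCat.{v} K) ℤ}

theorem evalCochain_ext {n : ℤ} {φ ψ : Cochain F G n}
    (H : ∀ {m p : ℤ} (h : n + m = p) (x : F.X m), evalCochain h φ x = evalCochain h ψ x) :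
    φ = ψ := by
  refine Cochain.ext _ _ fun m p h => ?_
  ext x
  exact H (by omega) x

/-- The cochain given by a family of linear maps on homogeneous components. -/
def mkCochain {n : ℤ} (f : ∀ {m p : ℤ}, n + m = p → (F.X m →ₗ[K] G.X p)) : Cochain F G n :=
  Cochain.mk fun m p h => ModuleCat.ofHom (f (m := m) (p := p) (by omega))

@[simp]
theorem evalCochain_mkCochain {n m p : ℤ} (f : ∀ {m p : ℤ}, n + m = p → (F.X m →ₗ[K] G.X p))
    (h : n + m = p) (x : F.X m) : evalCochain h (mkCochain f) x = f h x := by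
  rw [evalCochain_apply, mkCochain, Cochain.mk_v]
  rfl

end Cochain

variable {A : DGCat.{w, v} K}

/-- The action of a morphism on a homogeneous element of a dg-module. -/
def act (F : DGFunctor A (dgModBase.{v''} K)) {X Y : A.Obj} {n m p : ℤ} (h : n + m = p) :
    A.Hom X Y n →ₗ[K] (F.obj X).X m →ₗ[K] (F.obj Y).X p :=
  evalCochain h ∘ₗ F.map

section Act

variable (F : DGFunctor A (dgModBase.{v''} K))

theorem act_apply {X Y : A.Obj} {n m p : ℤ} (h : n + m = p) (f : A.Hom X Y n) (x : (F.obj X).X m) :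
    F.act h f x = evalCochain h (F.map f) x := rfl

theorem id_act {X : A.Obj} {n : ℤ} (x : (F.obj X).X n) : F.act (zero_add n) (A.id X) x = x := by
  rw [act_apply, F.map_id, evalCochain_id]

theorem comp_act {X Y Z : A.Obj} {n m l nm ml p : ℤ} (h₁ : n + m = nm)
    (h₂ : nm + l = p) (h₃ : m + l = ml) (h₄ : n + ml = p) (g : A.Hom Y Z n) (f : A.Hom X Y m)
    (x : (F.obj X).X l) : F.act h₂ (A.comp h₁ g f) x = F.act h₄ g (F.act h₃ f x) := by
  rw [act_apply, F.map_comp, evalCochain_comp h₁ h₂ h₃ h₄]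
  rfl

theorem diff_act {X Y : A.Obj} {n m p : ℤ} (h : n + m = p) (f : A.Hom X Y n)
    (x : (F.obj X).X m) :
    diffCochain _ p (F.act h f x) = F.act (show (n + 1) + m = p + 1 by omega) (A.d n f) x +
      n.negOnePow • F.act (show n + (m + 1) = p + 1 by omega) f (diffCochain _ m x) := by
  rw [act_apply, evalCochain_d, ← F.map_d]
  rfl

end Act

/-- The dg-module given by a family of complexes and a compatible action of the morphisms. -/
def ofAction (obj : A.Obj → CochainComplex (ModuleCat.{v''} K) ℤ)
    (ρ : ∀ {X Y : A.Obj} {n m p : ℤ}, n + m = p →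
      (A.Hom X Y n →ₗ[K] (obj X).X m →ₗ[K] (obj Y).X p))
    (id_act : ∀ {X : A.Obj} {n : ℤ} (x : (obj X).X n), ρ (zero_add n) (A.id X) x = x)
    (comp_act : ∀ {X Y Z : A.Obj} {n m l nm ml p : ℤ} (h₁ : n + m = nm)
      (h₂ : nm + l = p) (h₃ : m + l = ml) (h₄ : n + ml = p) (g : A.Hom Y Z n) (f : A.Hom X Y m)
      (x : (obj X).X l), ρ h₂ (A.comp h₁ g f) x = ρ h₄ g (ρ h₃ f x))
    (diff_act : ∀ {X Y : A.Obj} {n m p : ℤ} (h : n + m = p) (f : A.Hom X Y n) (x : (obj X).X m),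
      diffCochain _ p (ρ h f x) = ρ (show (n + 1) + m = p + 1 by omega) (A.d n f) x +
        n.negOnePow • ρ (show n + (m + 1) = p + 1 by omega) f (diffCochain _ m x)) :
    DGFunctor A (dgModBase.{v''} K) where
  obj := obj
  map {X Y n} :=
    { toFun := fun f => mkCochain fun h => ρ h f
      map_add' := fun f g => evalCochain_ext fun h x => by
        rw [map_add (evalCochain h), LinearMap.add_apply]; simp
      map_smul' := fun c f => evalCochain_ext fun h x => by
        rw [map_smul (evalCochain h), LinearMap.smul_apply]; simp }
  map_id X := evalCochain_ext fun {m p} h x => by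
    obtain rfl : m = p := by omega
    exact (evalCochain_mkCochain _ _ _).trans ((id_act x).trans (evalCochain_id _ x).symm)
  map_comp h g f := evalCochain_ext fun {l q} h' x => by
    refine (evalCochain_mkCochain _ _ _).trans ?_
    rw [evalCochain_comp h h' rfl (by omega), comp_act h h' rfl (by omega)]
    simp
  map_d {X Y n} f := evalCochain_ext fun {l q} h' x => by
    obtain ⟨p, rfl⟩ : ∃ p, q = p + 1 := ⟨q - 1, by omega⟩
    -- Both `ρ` and evaluation of cochains obey the Leibniz rule with the same term in `d x`.
    -- Cancelling it leaves the equality of the terms in `d f`.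
    have h₁ := evalCochain_d (show n + l = p by omega)
      (mkCochain (F := obj X) (G := obj Y) fun h => ρ h f) x
    rw [evalCochain_mkCochain, evalCochain_mkCochain, diff_act] at h₁
    exact (evalCochain_mkCochain _ _ _).trans (add_right_cancel h₁)

@[simp]
theorem ofAction_act (obj : A.Obj → CochainComplex (ModuleCat.{v''} K) ℤ)
    (ρ : ∀ {X Y : A.Obj} {n m p : ℤ}, n + m = p →
      (A.Hom X Y n →ₗ[K] (obj X).X m →ₗ[K] (obj Y).X p)) (h₁ h₂ h₃)
    {X Y : A.Obj} {n m p : ℤ} (h : n + m = p) (f : A.Hom X Y n) (x : (obj X).X m) :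
    (ofAction obj ρ h₁ h₂ h₃).act h f x = ρ h f x :=
  evalCochain_mkCochain _ _ _

section App

variable {F G H : DGFunctor A (dgModBase.{v''} K)}

/-- The value of a dg-natural transformation of dg-modules on a homogeneous element. -/
def app {X : A.Obj} {n m p : ℤ} (h : n + m = p) :
    (dgMod A).Hom F G n →ₗ[K] (F.obj X).X m →ₗ[K] (G.obj X).X p :=
  evalCochain h ∘ₗ LinearMap.proj (φ := fun X => Cochain (F.obj X) (G.obj X) n) X ∘ₗ
    (dgNat F G n).subtype

theorem app_ext {n : ℤ} {η θ : (dgMod A).Hom F G n}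
    (H : ∀ {X : A.Obj} {m p : ℤ} (h : n + m = p) (x : (F.obj X).X m), app h η x = app h θ x) :
    η = θ :=
  Subtype.ext <| funext fun _ => evalCochain_ext fun h x => H h x

theorem app_id {X : A.Obj} {n : ℤ} (x : (F.obj X).X n) :
    app (zero_add n) ((dgMod A).id F) x = x :=
  evalCochain_id _ x

theorem app_comp {X : A.Obj} {n m l nm ml p : ℤ} (h₁ : n + m = nm)
    (h₂ : nm + l = p) (h₃ : m + l = ml) (h₄ : n + ml = p) (β : (dgMod A).Hom G H n)
    (α : (dgMod A).Hom F G m) (x : (F.obj X).X l) :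
    app h₂ ((dgMod A).comp h₁ β α) x = app h₄ β (app h₃ α x) :=
  evalCochain_comp h₁ h₂ h₃ h₄ _ _ x

theorem diff_app {X : A.Obj} {n m p : ℤ} (h : n + m = p) (η : (dgMod A).Hom F G n)
    (x : (F.obj X).X m) :
    diffCochain _ p (app h η x) = app (show (n + 1) + m = p + 1 by omega) ((dgMod A).d n η) x +
      n.negOnePow • app (show n + (m + 1) = p + 1 by omega) η (diffCochain _ m x) :=
  evalCochain_d h _ x

/-- Evaluation of the naturality relation of `η` at `x`. The sign is the Koszul sign for exchanging
`η`, of degree `n`, with `f`, of degree `m`. -/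
theorem act_app {X Y : A.Obj} {n m l p nl ml : ℤ} (h₁ : m + nl = p) (h₂ : n + l = nl)
    (h₃ : n + ml = p) (h₄ : m + l = ml) (η : (dgMod A).Hom F G n) (f : A.Hom X Y m)
    (x : (F.obj X).X l) :
    G.act h₁ f (app h₂ η x) = (n * m).negOnePow • app h₃ η (F.act h₄ f x) := by
  have h := congrArg (fun z => evalCochain (show (m + n) + l = p by omega) z x) (η.2 rfl f)
  simp only [map_sign₂] at h
  rwa [evalCochain_comp rfl _ h₂ h₁, evalCochain_comp (add_comm n m) _ h₄ h₃] at h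

/-- The dg-natural transformation given by its values on homogeneous elements. -/
def mkNat {n : ℤ} (f : ∀ {X : A.Obj} {m p : ℤ}, n + m = p → ((F.obj X).X m →ₗ[K] (G.obj X).X p))
    (hf : ∀ {X Y : A.Obj} {m l p nl ml : ℤ} (h₁ : m + nl = p) (h₂ : n + l = nl)
      (h₃ : n + ml = p) (h₄ : m + l = ml) (a : A.Hom X Y m) (x : (F.obj X).X l),
      G.act h₁ a (f h₂ x) = (n * m).negOnePow • f h₃ (F.act h₄ a x)) :
    (dgMod A).Hom F G n :=
  ⟨fun _ => mkCochain fun h => f h, fun {X Y m p} h a => evalCochain_ext fun {l q} hq x => by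
    rw [evalCochain_comp h hq (ml := n + l) rfl (by omega), map_sign₂,
      evalCochain_comp _ hq (ml := m + l) rfl (by omega), evalCochain_mkCochain,
      evalCochain_mkCochain]
    exact hf (by omega) rfl (by omega) rfl a x⟩

@[simp]
theorem app_mkNat {n : ℤ}
    (f : ∀ {X : A.Obj} {m p : ℤ}, n + m = p → ((F.obj X).X m →ₗ[K] (G.obj X).X p)) (hf)
    {X : A.Obj} {m p : ℤ} (h : n + m = p) (x : (F.obj X).X m) :
    app h (mkNat (F := F) (G := G) f hf) x = f h x :=
  evalCochain_mkCochain _ _ _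

end App

end DGFunctor

open DGCat DGFunctor

/-! ### The dg-category of triples over a dg-functor `P : Tᵒᵖ → D` -/

section Glue

variable {K : Type u} [CommRing K] {T : DGCat.{w', v'} K} {D : DGCat.{w, v} K}

/-- For a dg-functor `P : Tᵒᵖ → D`, a triple of a dg `T`-module `X`, an object `Y` of `D` and a
closed morphism of degree `0` of dg `T`-modules `X → D(P(-), Y)`. -/
structure GlueObj (P : DGFunctor T.op D) where
  fst : (dgMod.{_, _, v''} T).Obj
  snd : D.Obj
  hom : ∀ {t : T.Obj} {n : ℤ}, (fst.obj t).X n →ₗ[K] D.Hom (P.obj t) snd n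
  hom_d : ∀ {t : T.Obj} {n : ℤ} (x : (fst.obj t).X n), hom (diffCochain _ n x) = D.d n (hom x)
  hom_act : ∀ {t t' : T.Obj} {n m p : ℤ} (h : n + m = p) (a : T.Hom t t' n) (x : (fst.obj t).X m),
    hom (fst.act h a x) =
      (n * m).negOnePow • D.comp (show m + n = p by omega) (hom x) (P.map (X := t') (Y := t) a)

namespace GlueObj

variable {P : DGFunctor T.op D}

/-- The morphisms of degree `n` between two triples: the pairs of morphisms of degree `n` which are
compatible with the structure morphisms. -/
def homs (A B : GlueObj.{w, w', v, v', v''} P) (n : ℤ) :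
    Submodule K ((dgMod.{_, _, v''} T).Hom A.fst B.fst n × D.Hom A.snd B.snd n) where
  carrier := {f | ∀ {t : T.Obj} {m p : ℤ} (h : n + m = p) (x : (A.fst.obj t).X m),
    B.hom (app h f.1 x) = D.comp h f.2 (A.hom x)}
  add_mem' ha hb := by
    intro t m p h x
    simp [ha h x, hb h x]
  zero_mem' := by
    intro t m p h x
    simp
  smul_mem' c f hf := by
    intro t m p h x
    simp [hf h x]

end GlueObj

/-- The dg-category of triples of a dg `T`-module `X`, an object `Y` of `D` and a closed morphism
of degree `0` of dg `T`-modules `X → D(P(-), Y)`. -/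
@[reducible]
def glue (P : DGFunctor T.op D) : DGCat K where
  Obj := GlueObj.{w, w', v, v', v''} P
  Hom A B n := A.homs B n
  d {A B} n := (((dgMod T).d n).prodMap (D.d n)).restrict (p := A.homs B n)
    (q := A.homs B (n + 1)) <| by
    intro f hf t m p h x
    obtain ⟨q, rfl⟩ : ∃ q, p = q + 1 := ⟨p - 1, by omega⟩
    -- The compatibility of `d f` is the differential of the compatibility of `f`: both sides expand
    -- by Leibniz, and the terms in `d x` agree by the compatibility of `f` itself and cancel.
    have h₁ := congrArg B.hom (diff_app (show n + m = q by omega) f.1 x)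
    have h₂ := D.leibniz (show n + m = q by omega) f.2 (A.hom x)
    rw [B.hom_d, map_add, hf, h₂, map_sign, hf, A.hom_d] at h₁
    exact (add_right_cancel h₁).symm
  id A := ⟨((dgMod T).id A.fst, D.id A.snd), fun {t m p} h x => by
    obtain rfl : m = p := by omega
    rw [app_id, D.id_comp]⟩
  comp {A B C n m p} h := LinearMap.mk₂ K
    (fun g f => ⟨((dgMod T).comp h g.1.1 f.1.1, D.comp h g.1.2 f.1.2), fun {t l q} h' x => by
      rw [app_comp h h' rfl (by omega), g.2, f.2, ← D.assoc h h' rfl (by omega)]⟩)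
    (fun _ _ _ => Subtype.ext <| Prod.ext (LinearMap.map_add₂ _ _ _ _) (LinearMap.map_add₂ _ _ _ _))
    (fun _ _ _ => Subtype.ext <| Prod.ext (LinearMap.map_smul₂ _ _ _ _) (LinearMap.map_smul₂ _ _ _ _))
    (fun _ _ _ => Subtype.ext <| Prod.ext (map_add _ _ _) (map_add _ _ _))
    (fun _ _ _ => Subtype.ext <| Prod.ext (map_smul _ _ _) (map_smul _ _ _))
  d_d n f := Subtype.ext <| Prod.ext ((dgMod T).d_d n _) (D.d_d n _)
  id_comp f := Subtype.ext <| Prod.ext ((dgMod T).id_comp _) (D.id_comp _)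
  comp_id f := Subtype.ext <| Prod.ext ((dgMod T).comp_id _) (D.comp_id _)
  assoc h₁ h₂ h₃ h₄ h g f :=
    Subtype.ext <| Prod.ext ((dgMod T).assoc h₁ h₂ h₃ h₄ _ _ _) (D.assoc h₁ h₂ h₃ h₄ _ _ _)
  leibniz h g f := Subtype.ext <| Prod.ext ((dgMod T).leibniz h _ _) (D.leibniz h _ _)

end Glue

/-! ### Zero objects, composite adjunctions and fully faithful dg-functors -/

section Adjunction

variable {K : Type u} [CommRing K]

theorem DGCat.eq_zero_of_id_target {A : DGCat.{w, v} K} {X Y : A.Obj} (hY : A.id Y = 0) {n : ℤ}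
    (f : A.Hom X Y n) : f = 0 := by
  rw [← A.id_comp f, hY, map_zero, LinearMap.zero_apply]

theorem DGCat.eq_zero_of_id_source {A : DGCat.{w, v} K} {X Y : A.Obj} (hX : A.id X = 0) {n : ℤ}
    (f : A.Hom X Y n) : f = 0 := by
  rw [← A.comp_id f, hX, map_zero]

universe w₁ w₂ w₃ v₁ v₂ v₃

variable {A : DGCat.{w₁, v₁} K} {B : DGCat.{w₂, v₂} K} {C : DGCat.{w₃, v₃} K}

/-- The composite of two dg-adjunctions. -/
def DGAdjunction.comp {F : DGFunctor A B} {G : DGFunctor B A} {F' : DGFunctor B C}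
    {G' : DGFunctor C B} (adj : DGAdjunction F G) (adj' : DGAdjunction F' G') :
    DGAdjunction (F.comp F') (G'.comp G) where
  homEquiv X Y n := (adj'.homEquiv (F.obj X) Y n).trans (adj.homEquiv X (G'.obj Y) n)
  homEquiv_d X Y n f :=
    (congrArg _ (adj'.homEquiv_d _ _ _ f)).trans (adj.homEquiv_d _ _ _ _)
  homEquiv_naturality_left h f a :=
    (congrArg _ (adj'.homEquiv_naturality_left h f _)).trans (adj.homEquiv_naturality_left h _ a)
  homEquiv_naturality_right h b f :=
    (congrArg _ (adj'.homEquiv_naturality_right h b f)).trans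
      (adj.homEquiv_naturality_right h _ _)

theorem DGFunctor.FullyFaithful.comp {F : DGFunctor A B} {G : DGFunctor B C}
    (hF : F.FullyFaithful) (hG : G.FullyFaithful) : (F.comp G).FullyFaithful :=
  fun _ _ _ => (hG _ _ _).comp (hF _ _ _)

/-- The isomorphisms on morphisms given by a dg-fully faithful dg-functor. -/
noncomputable def DGFunctor.FullyFaithful.equiv {F : DGFunctor A B} (hF : F.FullyFaithful)
    (X Y : A.Obj) (n : ℤ) : A.Hom X Y n ≃ₗ[K] B.Hom (F.obj X) (F.obj Y) n :=
  LinearEquiv.ofBijective F.map (hF X Y n)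

theorem DGFunctor.FullyFaithful.map_equiv_symm {F : DGFunctor A B} (hF : F.FullyFaithful)
    {X Y : A.Obj} {n : ℤ} (f : B.Hom (F.obj X) (F.obj Y) n) :
    F.map ((hF.equiv X Y n).symm f) = f :=
  (hF.equiv X Y n).apply_symm_apply f

end Adjunction

/-! ### The zero dg-module -/

section ZeroModule

variable {K : Type u} [CommRing K]

/-- The zero complex. -/
def zeroComplex (K : Type u) [CommRing K] : CochainComplex (ModuleCat.{v} K) ℤ where
  X _ := ModuleCat.of K PUnit
  d _ _ := 0

instance (n : ℤ) : Subsingleton ((zeroComplex.{v} K).X n) :=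
  inferInstanceAs (Subsingleton PUnit)

/-- The zero dg-module. -/
def zeroModule (A : DGCat.{w, v} K) : (dgMod.{_, _, v''} A).Obj :=
  ofAction (fun _ => zeroComplex K) (fun _ => 0) (fun _ => Subsingleton.elim _ _)
    (fun _ _ _ _ _ _ _ => Subsingleton.elim _ _) (fun _ _ _ => Subsingleton.elim _ _)

instance (A : DGCat.{w, v} K) (X : A.Obj) (n : ℤ) :
    Subsingleton ((DGFunctor.obj (zeroModule.{w, v, v''} A) X).X n) :=
  inferInstanceAs (Subsingleton PUnit)

theorem zeroModule_source_ext {A : DGCat.{w, v} K} {F : (dgMod.{_, _, v''} A).Obj} {n : ℤ}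
    (η θ : (dgMod A).Hom (zeroModule.{w, v, v''} A) F n) : η = θ :=
  app_ext fun {X m p} h x => by rw [Subsingleton.elim x 0, map_zero, map_zero]

theorem zeroModule_target_ext {A : DGCat.{w, v} K} {F : (dgMod.{_, _, v''} A).Obj} {n : ℤ}
    (η θ : (dgMod A).Hom F (zeroModule.{w, v, v''} A) n) : η = θ :=
  app_ext fun _ _ => Subsingleton.elim _ _

theorem zeroModule_id (A : DGCat.{w, v} K) : (dgMod A).id (zeroModule.{w, v, v''} A) = 0 :=
  zeroModule_source_ext _ _

/-- The constant dg-functor at a zero object. -/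
def zeroDGFunctor (A : DGCat.{w, v} K) {B : DGCat.{w', v'} K} {Z : B.Obj} (hZ : B.id Z = 0) :
    DGFunctor A B where
  obj _ := Z
  map := 0
  map_id _ := hZ.symm
  map_comp _ _ _ := by simp
  map_d _ := by simp

end ZeroModule

/-! ### Dg-functors and dg-adjunctions between categories of triples -/

section Glue

universe w₁ w₂ w₃ v₁ v₂ v₃

variable {K : Type u} [CommRing K] {T : DGCat.{w', v'} K} {D : DGCat.{w₁, v₁} K}
  {E : DGCat.{w₂, v₂} K} {C : DGCat.{w₃, v₃} K} {P : DGFunctor T.op D}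

theorem GlueObj.homs_ext {A B : GlueObj.{w₁, w', v₁, v', v''} P} {n : ℤ} {f g : A.homs B n}
    (h₁ : f.1.1 = g.1.1) (h₂ : f.1.2 = g.1.2) : f = g :=
  Subtype.ext (Prod.ext h₁ h₂)

/-- The dg-functor `(X, Y) ↦ (X, G Y)` between categories of triples. -/
def glueMap (P : DGFunctor T.op D) (G : DGFunctor D E) :
    DGFunctor (glue.{w₁, w', v₁, v', v''} P) (glue.{w₂, w', v₂, v', v''} (P.comp G)) where
  obj A :=
    { fst := A.fst
      snd := G.obj A.snd
      hom := G.map ∘ₗ A.hom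
      hom_d := fun x => (congrArg G.map (A.hom_d x)).trans (G.map_d _)
      hom_act := fun h a x =>
        (congrArg G.map (A.hom_act h a x)).trans
          ((map_sign _ _ _).trans (congrArg _ (G.map_comp _ _ _))) }
  map {A B n} :=
    { toFun := fun f => ⟨(f.1.1, G.map f.1.2), fun {t m p} h x => by
        exact (congrArg G.map (f.2 h x)).trans (G.map_comp _ _ _)⟩
      map_add' := fun f g => GlueObj.homs_ext rfl (map_add _ _ _)
      map_smul' := fun c f => GlueObj.homs_ext rfl (map_smul _ _ _) }
  map_id A := GlueObj.homs_ext rfl (G.map_id _)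
  map_comp h g f := GlueObj.homs_ext rfl (G.map_comp h _ _)
  map_d f := GlueObj.homs_ext rfl (G.map_d _)

/-- Only second components change, and these correspond bijectively by `hG`. The compatibility of
the lifted pair with the structure maps is the image under `G` of the wanted equation, so
faithfulness of `G` lets it be lifted as well. -/
theorem glueMap_fullyFaithful {G : DGFunctor D E} (hG : G.FullyFaithful) :
    (glueMap.{w', v', v''} P G).FullyFaithful := fun A B n => by
  refine ⟨fun f g h => ?_, fun f => ?_⟩
  · exact GlueObj.homs_ext (congrArg (fun z => z.1.1) h)
      ((hG _ _ _).1 (congrArg (fun z => z.1.2) h))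
  · refine ⟨⟨(f.1.1, (hG.equiv _ _ n).symm f.1.2), fun {t m p} h x => (hG _ _ _).1 ?_⟩,
      GlueObj.homs_ext rfl (hG.map_equiv_symm _)⟩
    refine (f.2 h x).trans (Eq.trans ?_ (G.map_comp _ _ _).symm)
    exact congrArg (fun z => E.comp h z (G.map (A.hom x))) (hG.map_equiv_symm _).symm

/-- A natural family of morphisms of complexes `E(G X, Y) → D(X, H Y)`. -/
structure DGTransfer (G : DGFunctor D E) (H : DGFunctor E D) where
  hom : ∀ (X : D.Obj) (Y : E.Obj) (n : ℤ), E.Hom (G.obj X) Y n →ₗ[K] D.Hom X (H.obj Y) n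
  hom_d : ∀ {X : D.Obj} {Y : E.Obj} {n : ℤ} (f : E.Hom (G.obj X) Y n),
    hom X Y (n + 1) (E.d n f) = D.d n (hom X Y n f)
  hom_left : ∀ {X' X : D.Obj} {Y : E.Obj} {n m p : ℤ} (h : n + m = p)
    (f : E.Hom (G.obj X) Y n) (a : D.Hom X' X m),
    hom X' Y p (E.comp h f (G.map a)) = D.comp h (hom X Y n f) a
  hom_right : ∀ {X : D.Obj} {Y Y' : E.Obj} {n m p : ℤ} (h : n + m = p)
    (b : E.Hom Y Y' n) (f : E.Hom (G.obj X) Y m),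
    hom X Y' p (E.comp h b f) = D.comp h (H.map b) (hom X Y m f)

/-- The natural isomorphisms of a dg-adjunction. -/
def DGAdjunction.transfer {G : DGFunctor D E} {H : DGFunctor E D} (adj : DGAdjunction G H) :
    DGTransfer G H where
  hom X Y n := (adj.homEquiv X Y n).toLinearMap
  hom_d f := adj.homEquiv_d _ _ _ f
  hom_left h f a := adj.homEquiv_naturality_left h f a
  hom_right h b f := adj.homEquiv_naturality_right h b f

/-- For a left dg-adjoint `H` of a dg-fully faithful dg-functor `G`, the map which sends
`f : G X → Y` to the composite of the inverse of the counit at `X` with `H f`. -/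
noncomputable def DGFunctor.FullyFaithful.transferHom {G : DGFunctor D E} {H : DGFunctor E D}
    (hG : G.FullyFaithful) (adj : DGAdjunction H G) (X : D.Obj) (Y : E.Obj) (n : ℤ) :
    E.Hom (G.obj X) Y n →ₗ[K] D.Hom X (H.obj Y) n :=
  (hG.equiv _ _ n).symm.toLinearMap ∘ₗ (adj.homEquiv _ _ n).toLinearMap ∘ₗ H.map

/-- This characterises the transfer, since `G` is faithful: every identity about it is checked after
applying `G`, where no inverse of the counit appears. -/
theorem DGFunctor.FullyFaithful.map_transferHom {G : DGFunctor D E} {H : DGFunctor E D}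
    (hG : G.FullyFaithful) (adj : DGAdjunction H G) {X : D.Obj} {Y : E.Obj} {n : ℤ}
    (f : E.Hom (G.obj X) Y n) :
    G.map (hG.transferHom adj X Y n f) = adj.homEquiv _ _ n (H.map f) :=
  hG.map_equiv_symm _

/-- The natural family attached to a left dg-adjoint of a dg-fully faithful dg-functor. -/
noncomputable def DGFunctor.FullyFaithful.transfer {G : DGFunctor D E} {H : DGFunctor E D}
    (hG : G.FullyFaithful) (adj : DGAdjunction H G) : DGTransfer G H where
  hom := hG.transferHom adj
  hom_d f := (hG _ _ _).1 <| by
    rw [G.map_d, hG.map_transferHom, hG.map_transferHom, H.map_d, adj.homEquiv_d]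
  hom_left h f a := (hG _ _ _).1 <| by
    rw [G.map_comp, hG.map_transferHom, hG.map_transferHom, H.map_comp,
      adj.homEquiv_naturality_left]
  hom_right h b f := (hG _ _ _).1 <| by
    rw [G.map_comp, hG.map_transferHom, hG.map_transferHom, H.map_comp,
      adj.homEquiv_naturality_right]

/-- The dg-functor `(X, Y) ↦ (X, H Y)` on triples. -/
def glueTransfer (P : DGFunctor T.op D) {G : DGFunctor D E} {H : DGFunctor E D}
    (κ : DGTransfer G H) :
    DGFunctor (glue.{w₂, w', v₂, v', v''} (P.comp G)) (glue.{w₁, w', v₁, v', v''} P) where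
  obj A :=
    { fst := A.fst
      snd := H.obj A.snd
      hom := κ.hom _ _ _ ∘ₗ A.hom
      hom_d := fun x => (congrArg _ (A.hom_d x)).trans (κ.hom_d _)
      hom_act := fun h a x => (congrArg _ (A.hom_act h a x)).trans
        ((map_sign (κ.hom _ _ _) _ _).trans (congrArg _ (κ.hom_left _ _ _))) }
  map {A B n} :=
    { toFun := fun f => ⟨(f.1.1, H.map f.1.2), fun {t m p} h x =>
        (congrArg _ (f.2 h x)).trans (κ.hom_right h _ _)⟩
      map_add' := fun f g => GlueObj.homs_ext rfl (map_add _ _ _)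
      map_smul' := fun c f => GlueObj.homs_ext rfl (map_smul _ _ _) }
  map_id A := GlueObj.homs_ext rfl (H.map_id _)
  map_comp h g f := GlueObj.homs_ext rfl (H.map_comp h _ _)
  map_d f := GlueObj.homs_ext rfl (H.map_d _)

/-- A dg-adjunction induces a dg-adjunction between categories of triples. -/
def glueRightAdjunction (P : DGFunctor T.op D) {G : DGFunctor D E} {H : DGFunctor E D}
    (adj : DGAdjunction G H) :
    DGAdjunction (glueMap.{w', v', v''} P G) (glueTransfer P adj.transfer) where
  homEquiv A B n :=
    { toFun := fun f => ⟨(f.1.1, adj.homEquiv _ _ n f.1.2), fun h x =>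
        (congrArg _ (f.2 h x)).trans (adj.homEquiv_naturality_left h _ _)⟩
      map_add' := fun f g => GlueObj.homs_ext rfl (map_add _ _ _)
      map_smul' := fun c f => GlueObj.homs_ext rfl (map_smul _ _ _)
      invFun := fun f => ⟨(f.1.1, (adj.homEquiv _ _ n).symm f.1.2), fun {t m p} h x => by
        refine (adj.homEquiv _ _ _).injective ((f.2 h x).trans ?_)
        refine Eq.trans ?_ (adj.homEquiv_naturality_left h _ _).symm
        exact congrArg (fun z => D.comp h z (A.hom x))
          ((adj.homEquiv _ _ n).apply_symm_apply _).symm⟩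
      left_inv := fun f => GlueObj.homs_ext rfl ((adj.homEquiv _ _ n).symm_apply_apply _)
      right_inv := fun f => GlueObj.homs_ext rfl ((adj.homEquiv _ _ n).apply_symm_apply _) }
  homEquiv_d A B n f := GlueObj.homs_ext rfl (adj.homEquiv_d _ _ _ _)
  homEquiv_naturality_left h f a :=
    GlueObj.homs_ext rfl (adj.homEquiv_naturality_left h _ _)
  homEquiv_naturality_right h b f :=
    GlueObj.homs_ext rfl (adj.homEquiv_naturality_right h _ _)

/-- A dg-adjunction with dg-fully faithful right adjoint induces a dg-adjunction between categories
of triples. -/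
noncomputable def glueLeftAdjunction (P : DGFunctor T.op D) {G : DGFunctor D E}
    {H : DGFunctor E D} (adj : DGAdjunction H G) (hG : G.FullyFaithful) :
    DGAdjunction (glueTransfer.{w', v', v''} P (hG.transfer adj)) (glueMap P G) where
  homEquiv A B n :=
    { toFun := fun f => ⟨(f.1.1, adj.homEquiv _ _ n f.1.2), fun {t m p} h x => by
        refine (congrArg G.map (f.2 h x)).trans ((G.map_comp _ _ _).trans ?_)
        refine (congrArg _ (hG.map_transferHom adj (A.hom x))).trans ?_
        -- Both sides are the adjunct of `f.1.2 ∘ H (A.hom x)`, computed by naturality in one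
        -- variable and then in the other.
        exact (adj.homEquiv_naturality_right h _ _).symm.trans
          (adj.homEquiv_naturality_left h _ _)⟩
      map_add' := fun f g => GlueObj.homs_ext rfl (map_add _ _ _)
      map_smul' := fun c f => GlueObj.homs_ext rfl (map_smul _ _ _)
      invFun := fun f => ⟨(f.1.1, (adj.homEquiv _ _ n).symm f.1.2), fun {t m p} h x => by
        refine (hG _ _ _).1 ((f.2 h x).trans (Eq.trans ?_ (G.map_comp _ _ _).symm))
        refine Eq.trans ?_ (congrArg _ (hG.map_transferHom adj (A.hom x))).symm
        refine Eq.trans ?_ (adj.homEquiv_naturality_right h _ _)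
        refine Eq.trans ?_ (adj.homEquiv_naturality_left h _ _).symm
        exact congrArg (fun z => E.comp h z (A.hom x))
          ((adj.homEquiv _ _ n).apply_symm_apply _).symm⟩
      left_inv := fun f => GlueObj.homs_ext rfl ((adj.homEquiv _ _ n).symm_apply_apply _)
      right_inv := fun f => GlueObj.homs_ext rfl ((adj.homEquiv _ _ n).apply_symm_apply _) }
  homEquiv_d A B n f := GlueObj.homs_ext rfl (adj.homEquiv_d _ _ _ _)
  homEquiv_naturality_left h f a :=
    GlueObj.homs_ext rfl (adj.homEquiv_naturality_left h _ _)
  homEquiv_naturality_right h b f :=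
    GlueObj.homs_ext rfl (adj.homEquiv_naturality_right h _ _)

/-- The dg-functor `(X, Y) ↦ Y`. -/
def glueSnd (P : DGFunctor T.op D) : DGFunctor (glue.{w₁, w', v₁, v', v''} P) D where
  obj A := A.snd
  map {A B n} := LinearMap.snd K _ _ ∘ₗ (A.homs B n).subtype
  map_id _ := rfl
  map_comp _ _ _ := rfl
  map_d _ := rfl

/-- The dg-functor `Y ↦ (0, Y)`. -/
def glueZero (P : DGFunctor T.op D) : DGFunctor D (glue.{w₁, w', v₁, v', v''} P) where
  obj Y :=
    { fst := zeroModule T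
      snd := Y
      hom := 0
      hom_d := fun _ => by simp
      hom_act := fun _ _ _ => by simp }
  map {Y Y' n} :=
    { toFun := fun f => ⟨(0, f), fun _ _ => by simp⟩
      map_add' := fun _ _ => GlueObj.homs_ext (zeroModule_source_ext _ _) rfl
      map_smul' := fun _ _ => GlueObj.homs_ext (zeroModule_source_ext _ _) rfl }
  map_id _ := GlueObj.homs_ext (zeroModule_source_ext _ _) rfl
  map_comp _ _ _ := GlueObj.homs_ext (zeroModule_source_ext _ _) rfl
  map_d _ := GlueObj.homs_ext (zeroModule_source_ext _ _) rfl

theorem glueZero_fullyFaithful (P : DGFunctor T.op D) :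
    (glueZero.{w', v', v''} P).FullyFaithful := fun Y Y' n =>
  ⟨fun _ _ h => congrArg (fun z => z.1.2) h,
    fun f => ⟨f.1.2, GlueObj.homs_ext (zeroModule_source_ext _ _) rfl⟩⟩

/-- The dg-functor `Y ↦ (0, Y)` is left dg-adjoint to `(X, Y) ↦ Y`. -/
def glueZeroAdjunction (P : DGFunctor T.op D) :
    DGAdjunction (glueZero.{w', v', v''} P) (glueSnd P) where
  homEquiv Y A n :=
    { toFun := fun f => f.1.2
      map_add' := fun _ _ => rfl
      map_smul' := fun _ _ => rfl
      invFun := fun f => ⟨(0, f), fun {t m p} h x => by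
        obtain rfl : x = 0 := Subsingleton.elim (α := (DGFunctor.obj (zeroModule T) t).X m) _ _
        simp⟩
      left_inv := fun _ => GlueObj.homs_ext (zeroModule_source_ext _ _) rfl
      right_inv := fun _ => rfl }
  homEquiv_d _ _ _ _ := rfl
  homEquiv_naturality_left _ _ _ := rfl
  homEquiv_naturality_right _ _ _ := rfl

/-- If `D(P(-), I Z) = 0` for all `Z`, then a left dg-adjoint of `I` induces a left dg-adjoint of
`Z ↦ (0, I Z)`. -/
def glueSndAdjunction (P : DGFunctor T.op D) {J : DGFunctor D C} {I : DGFunctor C D}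
    (adj : DGAdjunction J I)
    (hI : ∀ (t : T.Obj) (Z : C.Obj) (n : ℤ) (f : D.Hom (P.obj t) (I.obj Z) n), f = 0) :
    DGAdjunction ((glueSnd.{w', v', v''} P).comp J) (I.comp (glueZero P)) where
  homEquiv A Z n :=
    { toFun := fun f => ⟨(0, adj.homEquiv _ _ _ f), fun {t m p} h x =>
        -- Both sides of the compatibility lie in `D(P t, I Z) = 0`, so every morphism from the
        -- second component to `I Z` is a morphism of triples.
        (hI _ _ _ _).trans (hI _ _ _ _).symm⟩
      map_add' := fun _ _ => GlueObj.homs_ext (zeroModule_target_ext _ _) (map_add _ _ _)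
      map_smul' := fun _ _ => GlueObj.homs_ext (zeroModule_target_ext _ _) (map_smul _ _ _)
      invFun := fun f => (adj.homEquiv _ _ _).symm f.1.2
      left_inv := fun f => (adj.homEquiv _ _ n).symm_apply_apply _
      right_inv := fun f =>
        GlueObj.homs_ext (zeroModule_target_ext _ _) ((adj.homEquiv _ _ n).apply_symm_apply _) }
  homEquiv_d A Z n f := GlueObj.homs_ext (zeroModule_target_ext _ _) (adj.homEquiv_d _ _ _ _)
  homEquiv_naturality_left h f a :=
    GlueObj.homs_ext (zeroModule_target_ext _ _) (adj.homEquiv_naturality_left h _ _)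
  homEquiv_naturality_right h b f :=
    GlueObj.homs_ext (zeroModule_target_ext _ _) (adj.homEquiv_naturality_right h _ _)

end Glue

/-! ### Dg-equivalences and transport of recollements -/

section Equivalence

universe w₁ w₂ w₃ w₄ w₅ v₁ v₂ v₃ v₄ v₅

variable {K : Type u} [CommRing K] {A : DGCat.{w₁, v₁} K} {B : DGCat.{w₂, v₂} K}
  {C : DGCat.{w₃, v₃} K} {A' : DGCat.{w₄, v₄} K} {B' : DGCat.{w₅, v₅} K}

/-- A pair of mutually inverse closed morphisms of degree `0`. -/
structure DGIso (A : DGCat.{w, v} K) (X Y : A.Obj) where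
  hom : A.Hom X Y 0
  inv : A.Hom Y X 0
  d_hom : A.d 0 hom = 0
  d_inv : A.d 0 inv = 0
  hom_inv_id : A.comp (add_zero 0) inv hom = A.id X
  inv_hom_id : A.comp (add_zero 0) hom inv = A.id Y

namespace DGIso

theorem hom_inv_comp {W X Y : A.Obj} (e : DGIso A X Y) {n : ℤ} (f : A.Hom W Y n) :
    A.comp (zero_add n) e.hom (A.comp (zero_add n) e.inv f) = f := by
  rw [← A.assoc (add_zero 0) (zero_add n), e.inv_hom_id, A.id_comp]

theorem inv_hom_comp {W X Y : A.Obj} (e : DGIso A X Y) {n : ℤ} (f : A.Hom W X n) :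
    A.comp (zero_add n) e.inv (A.comp (zero_add n) e.hom f) = f := by
  rw [← A.assoc (add_zero 0) (zero_add n), e.hom_inv_id, A.id_comp]

theorem comp_hom_inv {X Y Z : A.Obj} (e : DGIso A X Y) {n : ℤ} (f : A.Hom X Z n) :
    A.comp (add_zero n) (A.comp (add_zero n) f e.inv) e.hom = f := by
  rw [A.assoc _ _ (add_zero 0) (add_zero n), e.hom_inv_id, A.comp_id]

theorem comp_inv_hom {X Y Z : A.Obj} (e : DGIso A X Y) {n : ℤ} (f : A.Hom Y Z n) :
    A.comp (add_zero n) (A.comp (add_zero n) f e.hom) e.inv = f := by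
  rw [A.assoc _ _ (add_zero 0) (add_zero n), e.inv_hom_id, A.comp_id]

/-- Composition with an isomorphism on the left. -/
def postcomp {X Y : A.Obj} (e : DGIso A X Y) (W : A.Obj) (n : ℤ) : A.Hom W X n ≃ₗ[K] A.Hom W Y n :=
  LinearEquiv.ofLinearMap (A.comp (zero_add n) e.hom) (A.comp (zero_add n) e.inv)
    (LinearMap.ext fun f => e.hom_inv_comp f) (LinearMap.ext fun f => e.inv_hom_comp f)

/-- Composition with an isomorphism on the right. -/
def precomp {X Y : A.Obj} (e : DGIso A X Y) (Z : A.Obj) (n : ℤ) : A.Hom Y Z n ≃ₗ[K] A.Hom X Z n :=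
  LinearEquiv.ofLinearMap ((A.comp (add_zero n)).flip e.hom) ((A.comp (add_zero n)).flip e.inv)
    (LinearMap.ext fun f => e.comp_hom_inv f) (LinearMap.ext fun f => e.comp_inv_hom f)

/-- The inverse isomorphism. -/
def symm {X Y : A.Obj} (e : DGIso A X Y) : DGIso A Y X where
  hom := e.inv
  inv := e.hom
  d_hom := e.d_inv
  d_inv := e.d_hom
  hom_inv_id := e.inv_hom_id
  inv_hom_id := e.hom_inv_id

theorem d_postcomp {X Y : A.Obj} (e : DGIso A X Y) {W : A.Obj} {n : ℤ} (f : A.Hom W X n) :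
    e.postcomp W (n + 1) (A.d n f) = A.d n (e.postcomp W n f) := by
  refine Eq.trans ?_ (A.leibniz _ _ _).symm
  rw [e.d_hom, map_zero, LinearMap.zero_apply, Int.negOnePow_zero, one_smul, zero_add]
  rfl

theorem d_precomp {X Y : A.Obj} (e : DGIso A X Y) {Z : A.Obj} {n : ℤ} (f : A.Hom Y Z n) :
    e.precomp Z (n + 1) (A.d n f) = A.d n (e.precomp Z n f) := by
  refine Eq.trans ?_ (A.leibniz _ _ _).symm
  rw [e.d_hom, map_zero, smul_zero, add_zero]
  rfl

theorem postcomp_comp {W V X Y : A.Obj} (e : DGIso A X Y) {n m p : ℤ} (h : n + m = p)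
    (f : A.Hom W X n) (g : A.Hom V W m) :
    e.postcomp V p (A.comp h f g) = A.comp h (e.postcomp W n f) g :=
  (A.assoc _ _ _ _ _ _ _).symm

theorem precomp_comp {X Y Z W : A.Obj} (e : DGIso A X Y) {n m p : ℤ} (h : n + m = p)
    (g : A.Hom Z W n) (f : A.Hom Y Z m) :
    e.precomp W p (A.comp h g f) = A.comp h g (e.precomp Z m f) :=
  A.assoc _ _ _ _ _ _ _

theorem comp_postcomp {X Y Z W : A.Obj} (e : DGIso A X Y) {n m p : ℤ} (h : n + m = p)
    (g : A.Hom Y Z n) (f : A.Hom W X m) :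
    A.comp h g (e.postcomp W m f) = A.comp h (e.precomp Z n g) f :=
  (A.assoc _ _ _ _ _ _ _).symm

theorem symm_precomp_precomp {X Y : A.Obj} (e : DGIso A X Y) {Z : A.Obj} {n : ℤ}
    (f : A.Hom Y Z n) : e.symm.precomp Z n (e.precomp Z n f) = f :=
  (e.precomp Z n).symm_apply_apply f

/-- The isomorphism and its inverse meet in the middle of the composite and cancel. This is why
conjugation by a family of isomorphisms respects composition. -/
theorem precomp_comp_symm_postcomp {X Y Z W : A.Obj} (e : DGIso A X Y) {n m p : ℤ} (h : n + m = p)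
    (g : A.Hom Y Z n) (f : A.Hom W Y m) :
    A.comp h (e.precomp Z n g) (e.symm.postcomp W m f) = A.comp h g f := by
  rw [← comp_postcomp]
  exact congrArg _ ((e.postcomp W m).apply_symm_apply f)

end DGIso

/-- Two dg-functors are inverse to each other up to isomorphism. -/
structure IsDGEquivalence (F : DGFunctor A B) (G : DGFunctor B A) : Prop where
  adj : Nonempty (DGAdjunction F G)
  adj_symm : Nonempty (DGAdjunction G F)
  fullyFaithful : F.FullyFaithful
  fullyFaithful_symm : G.FullyFaithful

section Inverse

variable {F : DGFunctor A B} (hF : F.FullyFaithful) (obj : B.Obj → A.Obj)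
  (e : ∀ Y, DGIso B (F.obj (obj Y)) Y)

theorem DGFunctor.FullyFaithful.equiv_symm_comp {X Y Z : A.Obj} {n m p : ℤ} (h : n + m = p)
    (g : B.Hom (F.obj Y) (F.obj Z) n) (f : B.Hom (F.obj X) (F.obj Y) m) :
    (hF.equiv X Z p).symm (B.comp h g f) =
      A.comp h ((hF.equiv Y Z n).symm g) ((hF.equiv X Y m).symm f) :=
  (hF _ _ _).1 <| by
    rw [F.map_comp, hF.map_equiv_symm, hF.map_equiv_symm, hF.map_equiv_symm]

theorem DGFunctor.FullyFaithful.equiv_symm_d {X Y : A.Obj} {n : ℤ}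
    (f : B.Hom (F.obj X) (F.obj Y) n) :
    (hF.equiv X Y (n + 1)).symm (B.d n f) = A.d n ((hF.equiv X Y n).symm f) :=
  (hF _ _ _).1 <| by rw [F.map_d, hF.map_equiv_symm, hF.map_equiv_symm]

theorem DGFunctor.FullyFaithful.equiv_symm_map {X Y : A.Obj} {n : ℤ} (f : A.Hom X Y n) :
    (hF.equiv X Y n).symm (F.map f) = f :=
  (hF.equiv X Y n).symm_apply_apply f

/-- The isomorphism on morphisms given by conjugation. -/
noncomputable def DGFunctor.FullyFaithful.inverseEquiv (Y Y' : B.Obj) (n : ℤ) :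
    B.Hom Y Y' n ≃ₗ[K] A.Hom (obj Y) (obj Y') n :=
  ((e Y).precomp Y' n).trans (((e Y').symm.postcomp (F.obj (obj Y)) n).trans
    (hF.equiv (obj Y) (obj Y') n).symm)

/-- The inverse of a dg-fully faithful dg-functor which is surjective on objects up to
isomorphism. -/
noncomputable def DGFunctor.FullyFaithful.inverse : DGFunctor B A where
  obj := obj
  map {Y Y' n} := (hF.inverseEquiv obj e Y Y' n).toLinearMap
  map_id Y := (hF _ _ _).1 <| by
    refine (hF.map_equiv_symm _).trans ?_
    rw [F.map_id]
    refine (congrArg _ (B.id_comp _)).trans (e Y).hom_inv_id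
  map_comp {X Y Z n m p} h g f := by
    refine Eq.trans (congrArg (hF.equiv _ _ _).symm ?_) (hF.equiv_symm_comp h _ _)
    refine Eq.trans ?_ ((e Z).symm.postcomp_comp h _ _)
    exact congrArg _ (((e X).precomp_comp h g f).trans
      ((e Y).precomp_comp_symm_postcomp h _ _).symm)
  map_d {X Y n} f := by
    refine Eq.trans (congrArg (hF.equiv _ _ _).symm ?_) (hF.equiv_symm_d _)
    exact (congrArg _ ((e X).d_precomp f)).trans ((e Y).symm.d_postcomp _)

/-- Both adjunctions combine `hF` with composition by the isomorphisms `e Y`: `B(F X, Y) ≅ B(F X, F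
(obj Y)) ≅ A(X, obj Y)` in one direction and `A(obj Y, X) ≅ B(F (obj Y), F X) ≅ B(Y, F X)` in the
other. -/
theorem DGFunctor.FullyFaithful.isDGEquivalence_inverse :
    IsDGEquivalence F (hF.inverse obj e) where
  adj := ⟨
    { homEquiv := fun X Y n =>
        ((e Y).symm.postcomp (F.obj X) n).trans (hF.equiv X (obj Y) n).symm
      homEquiv_d := fun X Y n f =>
        (congrArg _ ((e Y).symm.d_postcomp f)).trans (hF.equiv_symm_d _)
      homEquiv_naturality_left := fun {X' X Y n m p} h f a => by
        refine (congrArg _ ((e Y).symm.postcomp_comp h f _)).trans ?_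
        refine (hF.equiv_symm_comp h _ _).trans ?_
        rw [hF.equiv_symm_map]
        rfl
      homEquiv_naturality_right := fun {X Y Y' n m p} h b f => by
        refine Eq.trans (congrArg (hF.equiv _ _ _).symm ?_) (hF.equiv_symm_comp h _ _)
        refine Eq.trans ?_ ((e Y').symm.postcomp_comp h _ _)
        exact congrArg _ ((e Y).precomp_comp_symm_postcomp h b f).symm }⟩
  adj_symm := ⟨
    { homEquiv := fun Y X n =>
        (hF.equiv (obj Y) X n).trans ((e Y).symm.precomp (F.obj X) n)
      homEquiv_d := fun Y X n f =>
        (congrArg _ (F.map_d f)).trans ((e Y).symm.d_precomp _)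
      homEquiv_naturality_left := fun {X' X Y n m p} h f a => by
        refine (congrArg ((e X').symm.precomp (F.obj Y) p) ((F.map_comp h f _).trans
          (congrArg _ (hF.map_equiv_symm _)))).trans ?_
        refine (congrArg _ ((e X).symm.comp_postcomp h (F.map f) _)).trans ?_
        refine ((e X').symm.precomp_comp h _ _).trans ?_
        exact congrArg _ ((e X').symm_precomp_precomp a)
      homEquiv_naturality_right := fun {X Y Y' n m p} h b f =>
        (congrArg _ (F.map_comp h b f)).trans ((e X).symm.precomp_comp h _ _) }⟩
  fullyFaithful := hF
  fullyFaithful_symm := fun X Y n => (hF.inverseEquiv obj e X Y n).bijective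

end Inverse

/-- By adjunction `A(L X, I Z) ≅ B(X, U (I Z))`, which vanishes for all `X` exactly when the
identity of `U (I Z)` does. In this form the condition `j^! i_* = 0` is an orthogonality of images
and passes through fully faithful dg-functors. -/
theorem DGAdjunction.isZero_comp_right_iff {L : DGFunctor B A} {U : DGFunctor A B}
    (adj : DGAdjunction L U) (I : DGFunctor C A) :
    (I.comp U).IsZero ↔
      ∀ (X : B.Obj) (Z : C.Obj) (n : ℤ) (f : A.Hom (L.obj X) (I.obj Z) n), f = 0 := by
  refine ⟨fun h X Z n f => ?_, fun h Z => ?_⟩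
  · rw [← (adj.homEquiv _ _ _).map_eq_zero_iff]
    exact eq_zero_of_id_target (h Z) _
  · exact (adj.homEquiv _ _ 0).symm.map_eq_zero_iff.1 (h _ _ _ _)

/-- The mirror image, from `B(U (I Z), X) ≅ A(I Z, L X)`; it serves for the condition `j^* i_! = 0`.
-/
theorem DGAdjunction.isZero_comp_left_iff {L : DGFunctor B A} {U : DGFunctor A B}
    (adj : DGAdjunction U L) (I : DGFunctor C A) :
    (I.comp U).IsZero ↔
      ∀ (X : B.Obj) (Z : C.Obj) (n : ℤ) (f : A.Hom (I.obj Z) (L.obj X) n), f = 0 := by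
  refine ⟨fun h X Z n f => ?_, fun h Z => ?_⟩
  · rw [← (adj.homEquiv _ _ _).symm.map_eq_zero_iff]
    exact eq_zero_of_id_source (h Z) _
  · exact (adj.homEquiv _ _ 0).map_eq_zero_iff.1 (h _ _ _ _)

theorem DGFunctor.FullyFaithful.eq_zero {F : DGFunctor A B} (hF : F.FullyFaithful) {X Y : A.Obj}
    {n : ℤ} (h : ∀ f : A.Hom X Y n, f = 0) (f : B.Hom (F.obj X) (F.obj Y) n) : f = 0 := by
  rw [← hF.map_equiv_symm f, h ((hF.equiv X Y n).symm f), map_zero]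

/-- Left dg-recollements may be transported along equivalences. -/
theorem IsLeftDGRecollement.transport {iU : DGFunctor A C} {iL : DGFunctor C A}
    {jL : DGFunctor B A} {jU : DGFunctor A B} (h : IsLeftDGRecollement iU iL jL jU)
    {F : DGFunctor A A'} {F' : DGFunctor A' A} (hF : IsDGEquivalence F F')
    {G : DGFunctor B B'} {G' : DGFunctor B' B} (hG : IsDGEquivalence G G') :
    IsLeftDGRecollement (F'.comp iU) (iL.comp F) (G'.comp (jL.comp F)) ((F'.comp jU).comp G) := by
  obtain ⟨⟨a₁⟩, ⟨a₂⟩, hF₁, hF₂⟩ := hF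
  obtain ⟨⟨b₁⟩, ⟨b₂⟩, hG₁, hG₂⟩ := hG
  obtain ⟨⟨c₁⟩, ⟨c₂⟩, h₀, h₁, h₂⟩ := h
  have adj := b₂.comp (c₂.comp a₁)
  refine ⟨⟨a₂.comp c₁⟩, ⟨adj⟩, ?_, h₁.comp hF₁, hG₂.comp (h₂.comp hF₁)⟩
  -- The transported `j^! i_*` contains the composite of `F` with its quasi-inverse. Orthogonality
  -- avoids simplifying it: `F` is fully faithful, so it suffices that the morphisms before applying
  -- `F` vanish.
  refine (adj.isZero_comp_right_iff _).2 fun X Z n f => ?_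
  exact hF₁.eq_zero ((c₂.isZero_comp_right_iff _).1 h₀ _ _ _) f

/-- Right dg-recollements may be transported along equivalences. -/
theorem IsRightDGRecollement.transport {iL : DGFunctor C A} {iU : DGFunctor A C}
    {jU : DGFunctor A B} {jL : DGFunctor B A} (h : IsRightDGRecollement iL iU jU jL)
    {F : DGFunctor A A'} {F' : DGFunctor A' A} (hF : IsDGEquivalence F F')
    {G : DGFunctor B B'} {G' : DGFunctor B' B} (hG : IsDGEquivalence G G') :
    IsRightDGRecollement (iL.comp F) (F'.comp iU) ((F'.comp jU).comp G) (G'.comp (jL.comp F)) := by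
  obtain ⟨⟨a₁⟩, ⟨a₂⟩, hF₁, hF₂⟩ := hF
  obtain ⟨⟨b₁⟩, ⟨b₂⟩, hG₁, hG₂⟩ := hG
  obtain ⟨⟨c₁⟩, ⟨c₂⟩, h₀, h₁, h₂⟩ := h
  have adj := (a₂.comp c₂).comp b₁
  refine ⟨⟨c₁.comp a₁⟩, ⟨adj⟩, ?_, h₁.comp hF₁, hG₂.comp (h₂.comp hF₁)⟩
  refine (adj.isZero_comp_left_iff _).2 fun X Z n f => ?_
  exact hF₁.eq_zero ((c₂.isZero_comp_left_iff _).1 h₀ _ _ _) f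

end Equivalence

/-! ### Entries of triangular matrices, and the dg-module attached to a triple -/

section TriangularModules

variable {K : Type u} [CommRing K] {T : DGCat.{w', v'} K} {R : DGCat.{w, v} K}

section Entries

variable (M : (dgMod.{_, _, v''} (R.tensor T.op)).Obj)

/-- The morphism of a triangular matrix dg-category with entry `a` in the upper left corner. -/
def triT {t t' : T.Obj} (r r' : R.Obj) {n : ℤ} :
    T.Hom t t' n →ₗ[K] (triMat T R M).Hom (t, r) (t', r') n :=
  LinearMap.inl K _ _

/-- The morphism of a triangular matrix dg-category with entry `x` in the lower left corner. -/
def triM (t t' : T.Obj) (r r' : R.Obj) {n : ℤ} :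
    (M.obj (tobj r' t)).X n →ₗ[K] (triMat T R M).Hom (t, r) (t', r') n :=
  LinearMap.inr K _ _ ∘ₗ LinearMap.inl K _ _

/-- The morphism of a triangular matrix dg-category with entry `b` in the lower right corner. -/
def triR (t t' : T.Obj) {r r' : R.Obj} {n : ℤ} :
    R.Hom r r' n →ₗ[K] (triMat T R M).Hom (t, r) (t', r') n :=
  LinearMap.inr K _ _ ∘ₗ LinearMap.inr K _ _

variable {M}

theorem triMat_hom_ext {X Y : (triMat T R M).Obj} {n : ℤ} {f g : (triMat T R M).Hom X Y n}
    (h₁ : f.1 = g.1) (h₂ : f.2.1 = g.2.1) (h₃ : f.2.2 = g.2.2) : f = g :=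
  Prod.ext h₁ (Prod.ext h₂ h₃)

theorem triMat_hom_eq {X Y : (triMat T R M).Obj} {n : ℤ} (f : (triMat T R M).Hom X Y n) :
    f = triT M X.2 Y.2 f.1 + triM M X.1 Y.1 X.2 Y.2 f.2.1 + triR M X.1 Y.1 f.2.2 :=
  triMat_hom_ext (by simp [triT, triM, triR]) (by simp [triT, triM, triR])
    (by simp [triT, triM, triR])

theorem triMat_id_eq (t : T.Obj) (r : R.Obj) :
    (triMat T R M).id (t, r) = triT M r r (T.id t) + triR M t t (R.id r) :=
  triMat_hom_ext (by simp [triT, triR]) (by simp [triT, triR]) (by simp [triT, triR])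

theorem d_triT {t t' : T.Obj} (r r' : R.Obj) {n : ℤ} (a : T.Hom t t' n) :
    (triMat T R M).d n (triT M r r' a) = triT M r r' (T.d n a) :=
  triMat_hom_ext rfl (map_zero _) (map_zero _)

theorem d_triM (t t' : T.Obj) (r r' : R.Obj) {n : ℤ} (x : (M.obj (tobj r' t)).X n) :
    (triMat T R M).d n (triM M t t' r r' x) = triM M t t' r r' (diffCochain _ n x) :=
  triMat_hom_ext (map_zero (T.d n)) rfl (map_zero (R.d n))

theorem d_triR (t t' : T.Obj) {r r' : R.Obj} {n : ℤ} (b : R.Hom r r' n) :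
    (triMat T R M).d n (triR M t t' b) = triR M t t' (R.d n b) :=
  triMat_hom_ext (map_zero (T.d n)) (map_zero (diffCochain _ n)) rfl

section Comp

variable {t t' t'' : T.Obj} {r r' r'' : R.Obj} {n m p : ℤ} (h : n + m = p)

theorem triT_comp_triT (a : T.Hom t' t'' n) (b : T.Hom t t' m) :
    (triMat T R M).comp h (triT M r' r'' a) (triT M r r' b) = triT M r r'' (T.comp h a b) :=
  triMat_hom_ext (by simp [triT]) (by simp [triT]) (by simp [triT])

/-- Opposite diagonal corners multiply to zero. Together with `triR_comp_triT`, this makes the two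
diagonal parts of the identity of `(t, r)` orthogonal idempotents. -/
theorem triT_comp_triR (a : T.Hom t' t'' n) (b : R.Hom r r' m) :
    (triMat T R M).comp h (triT M r' r'' a) (triR M t t' b) = 0 :=
  triMat_hom_ext (by simp [triT, triR]) (by simp [triT, triR]) (by simp [triT, triR])

theorem triM_comp_triT (a : (M.obj (tobj r'' t')).X n) (b : T.Hom t t' m) :
    (triMat T R M).comp h (triM M t' t'' r' r'' a) (triT M r r' b) =
      triM M t t'' r r'' (ract M r'' h a b) :=
  triMat_hom_ext (by simp [triT, triM]) (by simp [triT, triM]) (by simp [triT, triM])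

theorem triR_comp_triT (a : R.Hom r' r'' n) (b : T.Hom t t' m) :
    (triMat T R M).comp h (triR M t' t'' a) (triT M r r' b) = 0 :=
  triMat_hom_ext (by simp [triT, triR]) (by simp [triT, triR]) (by simp [triT, triR])

theorem triR_comp_triM (a : R.Hom r' r'' n) (b : (M.obj (tobj r' t)).X m) :
    (triMat T R M).comp h (triR M t' t'' a) (triM M t t' r r' b) =
      triM M t t'' r r'' (lact M t h a b) :=
  triMat_hom_ext (by simp [triM, triR]) (by simp [triM, triR]) (by simp [triM, triR])

theorem triM_comp_triR (a : (M.obj (tobj r'' t')).X n) (b : R.Hom r r' m) :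
    (triMat T R M).comp h (triM M t' t'' r' r'' a) (triR M t t' b) = 0 :=
  triMat_hom_ext (by simp [triM, triR]) (by simp [triM, triR]) (by simp [triM, triR])

theorem triR_comp_triR (a : R.Hom r' r'' n) (b : R.Hom r r' m) :
    (triMat T R M).comp h (triR M t' t'' a) (triR M t t' b) = triR M t t'' (R.comp h a b) :=
  triMat_hom_ext (by simp [triR]) (by simp [triR]) (by simp [triR])

end Comp

end Entries

/-- The direct sum of two complexes. -/
abbrev sumComplex (F G : CochainComplex (ModuleCat.{v} K) ℤ) : CochainComplex (ModuleCat.{v} K) ℤ where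
  X n := ModuleCat.of K (F.X n × G.X n)
  d i j := ModuleCat.ofHom ((F.d i j).hom.prodMap (G.d i j).hom)
  shape i j h := by
    rw [F.shape i j h, G.shape i j h]
    rfl
  d_comp_d' i j k _ _ := ModuleCat.hom_ext <| LinearMap.ext fun x => Prod.ext
    (LinearMap.congr_fun (congrArg ModuleCat.Hom.hom (F.d_comp_d i j k)) x.1)
    (LinearMap.congr_fun (congrArg ModuleCat.Hom.hom (G.d_comp_d i j k)) x.2)

variable (P : DGFunctor T.op (dgMod.{_, _, v''} R))

/-- The `T` variable is held at an identity, which `P` preserves, so only the action on the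
`R`-module `P.obj t` is left. In `uncurry_ract` the `R` variable is held fixed instead, and what
remains is `P.map` with the sign of a right action. -/
theorem uncurry_lact {r r' : R.Obj} (t : T.Obj) {n m p : ℤ} (h : n + m = p) (b : R.Hom r r' n)
    (x : ((P.obj t).obj r).X m) : lact P.uncurry t h b x = (P.obj t).act h b x := by
  refine (congrArg (fun z => evalCochain h z x) (uncurry_map_ten P _ b (T.op.id t))).trans ?_
  refine (evalCochain_comp _ _ (zero_add m) h _ _ x).trans (congrArg _ ?_)
  rw [P.map_id]
  exact evalCochain_id _ x

theorem uncurry_ract {t t' : T.Obj} (r : R.Obj) {n m p : ℤ} (h : n + m = p)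
    (x : ((P.obj t').obj r).X n) (a : T.Hom t t' m) :
    ract P.uncurry r h x a =
      (n * m).negOnePow • app (show m + n = p by omega) (P.map (X := t') (Y := t) a) x := by
  refine congrArg _ ((congrArg (fun z => evalCochain (show m + n = p by omega) z x)
    (uncurry_map_ten P (zero_add m) (R.id r) a)).trans ?_)
  refine (evalCochain_comp _ _ (show m + n = p by omega) (zero_add p) _ _ x).trans ?_
  exact (P.obj t).id_act _

variable {P}

namespace GlueObj

variable (A : GlueObj P)

/-- The action of a dg-bimodule on a triple. -/
def mact {t : T.Obj} {r : R.Obj} {n m p : ℤ} (h : n + m = p) :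
    ((P.obj t).obj r).X n →ₗ[K] (A.fst.obj t).X m →ₗ[K] (A.snd.obj r).X p :=
  (n * m).negOnePow • (app (X := r) (show m + n = p by omega) ∘ₗ A.hom).flip

theorem mact_apply {t : T.Obj} {r : R.Obj} {n m p : ℤ} (h : n + m = p)
    (x : ((P.obj t).obj r).X n) (y : (A.fst.obj t).X m) :
    A.mact h x y = (n * m).negOnePow • app (show m + n = p by omega) (A.hom y) x := rfl

/-- Linearity of `A.hom` over `T`, rewritten for the pairing: the pairing is balanced, that is, `(x
a) y = x (a y)`. The sign on the left is that of the right action on the bimodule. -/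
theorem app_map_mact {t t' : T.Obj} {r : R.Obj} {n m l nm ml p : ℤ} (h₁ : n + m = nm)
    (h₂ : nm + l = p) (h₃ : m + l = ml) (h₄ : n + ml = p) (x : ((P.obj t').obj r).X n)
    (a : T.Hom t t' m) (y : (A.fst.obj t).X l) :
    (n * m).negOnePow •
      A.mact h₂ (app (show m + n = nm by omega) (P.map (X := t') (Y := t) a) x) y =
      A.mact h₄ x (A.fst.act h₃ a y) := by
  rw [mact_apply, mact_apply, A.hom_act, map_sign₂, sign_sign, sign_sign,
    app_comp _ _ (show m + n = nm by omega) (show l + nm = p by omega)]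
  exact sign_congr ⟨0, by subst h₁ h₃; ring⟩ _

/-- Naturality of `A.hom y` in the `R` variable, rewritten for the pairing: `(b x) y = b (x y)`. The
sign built into `mact` absorbs the naturality sign. -/
theorem act_mact {t : T.Obj} {r r' : R.Obj} {n m l nm ml p : ℤ} (h₁ : n + m = nm)
    (h₂ : nm + l = p) (h₃ : m + l = ml) (h₄ : n + ml = p) (b : R.Hom r r' n)
    (x : ((P.obj t).obj r).X m) (y : (A.fst.obj t).X l) :
    A.mact h₂ ((P.obj t).act h₁ b x) y = A.snd.act h₄ b (A.mact h₃ x y) := by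
  rw [mact_apply, mact_apply, map_sign, act_app h₄ _ (show l + nm = p by omega) h₁, sign_sign]
  exact sign_congr ⟨0, by subst h₁; ring⟩ _

/-- Since `A.hom` commutes with differentials, the pairing is a morphism of complexes and obeys the
Leibniz rule. -/
theorem diff_mact {t : T.Obj} {r : R.Obj} {n m p : ℤ} (h : n + m = p)
    (x : ((P.obj t).obj r).X n) (y : (A.fst.obj t).X m) :
    diffCochain _ p (A.mact h x y) =
      A.mact (show (n + 1) + m = p + 1 by omega) (diffCochain _ n x) y +
        n.negOnePow • A.mact (show n + (m + 1) = p + 1 by omega) x (diffCochain _ m y) := by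
  rw [mact_apply, mact_apply, mact_apply, map_sign, diff_app, A.hom_d, smul_add, sign_sign,
    sign_sign]
  refine (add_comm _ _).trans (congrArg₂ _ ?_ ?_)
  · exact sign_congr ⟨0, by ring⟩ _
  · exact sign_congr ⟨-n, by ring⟩ _

theorem ract_mact {t t' : T.Obj} {r : R.Obj} {n m l nm ml p : ℤ} (h₁ : n + m = nm)
    (h₂ : nm + l = p) (h₃ : m + l = ml) (h₄ : n + ml = p) (x : ((P.obj t').obj r).X n)
    (a : T.Hom t t' m) (y : (A.fst.obj t).X l) :
    A.mact h₂ (ract P.uncurry r h₁ x a) y = A.mact h₄ x (A.fst.act h₃ a y) :=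
  (congrArg (fun z => A.mact h₂ z y) (uncurry_ract P r h₁ x a)).trans
    ((map_sign₂ _ _ _ _).trans (A.app_map_mact h₁ h₂ h₃ h₄ x a y))

theorem lact_mact {t : T.Obj} {r r' : R.Obj} {n m l nm ml p : ℤ} (h₁ : n + m = nm)
    (h₂ : nm + l = p) (h₃ : m + l = ml) (h₄ : n + ml = p) (b : R.Hom r r' n)
    (x : ((P.obj t).obj r).X m) (y : (A.fst.obj t).X l) :
    A.mact h₂ (lact P.uncurry t h₁ b x) y = A.snd.act h₄ b (A.mact h₃ x y) :=
  (congrArg (fun z => A.mact h₂ z y) (uncurry_lact P t h₁ b x)).trans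
    (A.act_mact h₁ h₂ h₃ h₄ b x y)

/-- The action of the triangular matrix dg-category on the direct sum attached to a triple. -/
def triAct {X Y : T.Obj × R.Obj} {n m p : ℤ} (h : n + m = p) :
    (triMat T R P.uncurry).Hom X Y n →ₗ[K]
      ((A.fst.obj X.1).X m × (A.snd.obj X.2).X m) →ₗ[K]
      (A.fst.obj Y.1).X p × (A.snd.obj Y.2).X p :=
  LinearMap.mk₂ K
    (fun f x => (A.fst.act h f.1 x.1, A.mact (t := X.1) (r := Y.2) h f.2.1 x.1 + A.snd.act h f.2.2 x.2))
    (fun f g x => Prod.ext (LinearMap.map_add₂ _ _ _ _) <|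
      (congrArg₂ (· + ·) (LinearMap.map_add₂ (A.mact (t := X.1) (r := Y.2) h) _ _ _)
        (LinearMap.map_add₂ _ _ _ _)).trans (add_add_add_comm _ _ _ _))
    (fun c f x => Prod.ext (LinearMap.map_smul₂ _ _ _ _) <|
      (congrArg₂ (· + ·) (LinearMap.map_smul₂ (A.mact (t := X.1) (r := Y.2) h) _ _ _)
        (LinearMap.map_smul₂ _ _ _ _)).trans (smul_add _ _ _).symm)
    (fun f x y => Prod.ext (map_add _ _ _) <|
      (congrArg₂ (· + ·) (map_add (A.mact (t := X.1) (r := Y.2) h _) _ _)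
        (map_add _ _ _)).trans (add_add_add_comm _ _ _ _))
    (fun c f x => Prod.ext (map_smul _ _ _) <|
      (congrArg₂ (· + ·) (map_smul (A.mact (t := X.1) (r := Y.2) h _) _ _)
        (map_smul _ _ _)).trans (smul_add _ _ _).symm)

/-- The dg-module over the triangular matrix dg-category attached to a triple. -/
def toModule : (dgMod.{_, _, v''} (triMat T R P.uncurry)).Obj :=
  ofAction (fun X => sumComplex (A.fst.obj X.1) (A.snd.obj X.2)) (fun h => A.triAct h)
    (fun {X n} x => Prod.ext (id_act _ _) <|
      (congrArg₂ _ (LinearMap.map_zero₂ (A.mact (t := X.1) (r := X.2) (zero_add n)) x.1)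
        (id_act _ _)).trans (zero_add _))
    (fun {X _ Z _ _ _ _ _ p} h₁ h₂ h₃ h₄ g f x => Prod.ext (comp_act _ h₁ h₂ h₃ h₄ _ _ _) <| by
      refine (congrArg₂ (fun a b : (A.snd.obj Z.2).X p => a + b)
        ((LinearMap.map_add₂ (A.mact (t := X.1) (r := Z.2) h₂) _ _ _).trans
        (congrArg₂ (· + ·) (A.ract_mact h₁ h₂ h₃ h₄ _ _ _) (A.lact_mact h₁ h₂ h₃ h₄ _ _ _)))
        (comp_act _ h₁ h₂ h₃ h₄ _ _ _)).trans ?_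
      -- Two of the three terms begin with the lower right entry of `g`; grouped together they are
      -- that entry applied to the second component of `f x`.
      refine (add_assoc _ _ _).trans ?_
      exact congrArg _ (map_add _ _ _).symm)
    (fun h f x => Prod.ext (diff_act _ h _ _) <| by
      refine (map_add _ _ _).trans ((congrArg₂ (· + ·) (A.diff_mact h _ _)
        (diff_act _ h _ _)).trans ?_)
      refine (add_add_add_comm _ _ _ _).trans ?_
      exact congrArg _ (smul_add _ _ _).symm)

/-- The element of `toModule` given by its two components. -/
def elt (X : T.Obj × R.Obj) (n : ℤ) :
    ((A.fst.obj X.1).X n × (A.snd.obj X.2).X n) ≃ₗ[K] (DGFunctor.obj A.toModule X).X n :=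
  LinearEquiv.refl K _

theorem act_elt {X Y : T.Obj × R.Obj} {n m p : ℤ} (h : n + m = p)
    (f : (triMat T R P.uncurry).Hom X Y n) (x : (A.fst.obj X.1).X m × (A.snd.obj X.2).X m) :
    A.toModule.act h f (A.elt X m x) = A.elt Y p (A.triAct h f x) :=
  ofAction_act (A := triMat T R P.uncurry) (fun X => sumComplex (A.fst.obj X.1) (A.snd.obj X.2)) (fun h => A.triAct h)
    _ _ _ h f x

end GlueObj

end TriangularModules

/-! ### The dg-functor from triples to dg-modules, and its full faithfulness -/

section TriangularModules

variable {K : Type u} [CommRing K] {T : DGCat.{w', v'} K} {R : DGCat.{w, v} K}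
  {P : DGFunctor T.op (dgMod.{_, _, v''} R)}

namespace GlueObj

section Entries

variable (A : GlueObj P) {t t' : T.Obj} {r r' : R.Obj} {n m p : ℤ} (h : n + m = p)
  (x : (A.fst.obj t).X m × (A.snd.obj r).X m)

theorem triAct_triT (a : T.Hom t t' n) :
    A.triAct (X := (t, r)) (Y := (t', r')) h (triT _ r r' a) x = (A.fst.act h a x.1, 0) :=
  Prod.ext rfl <| (congrArg₂ (· + ·) (LinearMap.map_zero₂ (A.mact h) x.1)
    (LinearMap.map_zero₂ (A.snd.act h) x.2)).trans (zero_add 0)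

theorem triAct_triM (y : ((P.obj t).obj r').X n) :
    A.triAct (X := (t, r)) (Y := (t', r')) h (triM _ t t' r r' y) x = (0, A.mact h y x.1) :=
  Prod.ext (LinearMap.map_zero₂ (A.fst.act h) x.1) <|
    (congrArg _ (LinearMap.map_zero₂ (A.snd.act h) x.2)).trans (add_zero _)

theorem triAct_triR (b : R.Hom r r' n) :
    A.triAct (X := (t, r)) (Y := (t', r')) h (triR _ t t' b) x = (0, A.snd.act h b x.2) :=
  Prod.ext (LinearMap.map_zero₂ (A.fst.act h) x.1) <|
    (congrArg (fun z => z + A.snd.act h b x.2) (LinearMap.map_zero₂ (A.mact h) x.1)).trans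
      (zero_add _)

end Entries

variable {A B C : GlueObj P}

theorem elt_surjective (X : T.Obj × R.Obj) (n : ℤ) (z : (DGFunctor.obj A.toModule X).X n) :
    ∃ x y, z = A.elt X n (x, y) := ⟨z.1, z.2, rfl⟩

theorem toModule_ext {G : (dgMod (triMat T R P.uncurry)).Obj} {n : ℤ}
    {η θ : (dgMod (triMat T R P.uncurry)).Hom A.toModule G n}
    (H : ∀ {X : T.Obj × R.Obj} {m p : ℤ} (h : n + m = p) (x), app h η (A.elt X m x) =
      app h θ (A.elt X m x)) : η = θ :=
  app_ext fun {X m p} h z => H h z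

/-- The compatibility defining morphisms of triples, rewritten for the pairings. It supplies
naturality of `toModuleHom` with respect to lower left entries. -/
theorem mact_app (f : A.homs B n) {t : T.Obj} {r : R.Obj} {m l p nl ml : ℤ} (h₁ : m + nl = p)
    (h₂ : n + l = nl) (h₃ : n + ml = p) (h₄ : m + l = ml) (y : ((P.obj t).obj r).X m)
    (x : (A.fst.obj t).X l) :
    B.mact h₁ y (app h₂ f.1.1 x) = (n * m).negOnePow • app h₃ f.1.2 (A.mact h₄ y x) := by
  rw [mact_apply, mact_apply, f.2, map_sign, sign_sign,
    app_comp h₂ _ (show l + m = ml by omega) h₃]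
  exact sign_congr ⟨0, by subst h₂; ring⟩ _

/-- The morphism of dg-modules attached to a morphism of triples. -/
def toModuleHom (f : A.homs B n) : (dgMod (triMat T R P.uncurry)).Hom A.toModule B.toModule n :=
  mkNat (fun {X m p} h => (B.elt X p).toLinearMap ∘ₗ ((app h f.1.1).prodMap (app h f.1.2)) ∘ₗ
    (A.elt X m).symm.toLinearMap) <| by
  intro X Y m l p nl ml h₁ h₂ h₃ h₄ a z
  obtain ⟨x, y, rfl⟩ := A.elt_surjective X l z
  rw [act_elt]
  refine (B.act_elt h₁ a _).trans ?_
  refine Eq.trans ?_ (map_sign (B.elt Y p).toLinearMap _ _)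
  refine congrArg _ (Prod.ext (act_app h₁ h₂ h₃ h₄ f.1.1 a.1 x) ?_)
  refine (congrArg₂ (· + ·) (mact_app f h₁ h₂ h₃ h₄ _ _)
    (act_app h₁ h₂ h₃ h₄ f.1.2 a.2.2 y)).trans ?_
  exact (smul_add _ _ _).symm.trans (congrArg _ (map_add _ _ _).symm)

theorem app_toModuleHom (f : A.homs B n) {X : T.Obj × R.Obj} {m p : ℤ} (h : n + m = p)
    (x : (A.fst.obj X.1).X m × (A.snd.obj X.2).X m) :
    app h (toModuleHom f) (A.elt X m x) = B.elt X p (app h f.1.1 x.1, app h f.1.2 x.2) :=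
  app_mkNat _ _ _ _

end GlueObj

theorem DGFunctor.app_d {A : DGCat.{w, v} K} {F G : DGFunctor A (dgModBase.{v''} K)} {X : A.Obj}
    {n m p : ℤ} (h : n + m = p) (h' : n + 1 + m = p + 1) (η : (dgMod A).Hom F G n)
    (x : (F.obj X).X m) :
    app h' ((dgMod A).d n η) x = diffCochain _ p (app h η x) -
      n.negOnePow • app (show n + (m + 1) = p + 1 by omega) η (diffCochain _ m x) :=
  eq_sub_of_add_eq (diff_app h η x).symm

open GlueObj

/-- The dg-functor from triples to dg-modules over the triangular matrix dg-category. -/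
def glueToModule (P : DGFunctor T.op (dgMod.{_, _, v''} R)) :
    DGFunctor (glue.{_, _, _, _, v''} P) (dgMod.{_, _, v''} (triMat T R P.uncurry)) where
  obj A := A.toModule
  map {A B n} :=
    { toFun := fun f => toModuleHom f
      map_add' := fun f g => toModule_ext fun {X m p} h x => by
        rw [map_add (app h), LinearMap.add_apply, app_toModuleHom, app_toModuleHom,
          app_toModuleHom, ← map_add]
        exact congrArg _ (Prod.ext (LinearMap.map_add₂ _ _ _ _) (LinearMap.map_add₂ _ _ _ _))
      map_smul' := fun c f => toModule_ext fun {X m p} h x => by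
        rw [map_smul (app h), LinearMap.smul_apply, app_toModuleHom, app_toModuleHom,
          RingHom.id_apply, ← map_smul]
        exact congrArg _ (Prod.ext (LinearMap.map_smul₂ _ _ _ _) (LinearMap.map_smul₂ _ _ _ _)) }
  map_id A := toModule_ext fun {X m p} h x => by
    obtain rfl : m = p := by omega
    refine (app_toModuleHom _ h x).trans ?_
    refine Eq.trans ?_ (app_id _).symm
    exact congrArg _ (Prod.ext (app_id _) (app_id _))
  map_comp {A B C n m p} h g f := toModule_ext fun {X l q} h' x => by
    refine (app_toModuleHom _ h' x).trans ?_
    refine Eq.trans ?_ (app_comp h h' rfl (by omega) _ _ _).symm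
    refine Eq.trans ?_ (congrArg _ (app_toModuleHom f rfl x)).symm
    refine Eq.trans ?_ (app_toModuleHom g _ _).symm
    exact congrArg _ (Prod.ext (app_comp h h' rfl (by omega) _ _ _)
      (app_comp h h' rfl (by omega) _ _ _))
  map_d {A B n} f := toModule_ext fun {X m p} h x => by
    obtain ⟨q, rfl⟩ : ∃ q, p = q + 1 := ⟨p - 1, by omega⟩
    refine (app_toModuleHom _ h x).trans ?_
    refine Eq.trans ?_ (app_d (show n + m = q by omega) h _ _).symm
    refine Eq.trans ?_ (congrArg₂ (fun y z => diffCochain _ q y - n.negOnePow • z)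
      (app_toModuleHom f (show n + m = q by omega) x)
      (app_toModuleHom f (show n + (m + 1) = q + 1 by omega) _)).symm
    exact congrArg _ (Prod.ext (app_d (show n + m = q by omega) h f.1.1 x.1)
      (app_d (show n + m = q by omega) h f.1.2 x.2))

section FullyFaithful

variable {A B : GlueObj P} {n : ℤ}
  (η : (dgMod (triMat T R P.uncurry)).Hom A.toModule B.toModule n)

theorem act_app_elt {X Y : T.Obj × R.Obj} {m l p nl ml : ℤ} (h₁ : m + nl = p)
    (h₂ : n + l = nl) (h₃ : n + ml = p) (h₄ : m + l = ml) (f : (triMat T R P.uncurry).Hom X Y m)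
    (x : (A.fst.obj X.1).X l × (A.snd.obj X.2).X l) :
    B.triAct h₁ f ((B.elt X nl).symm (app h₂ η (A.elt X l x))) =
      (n * m).negOnePow • (B.elt Y p).symm (app h₃ η (A.elt Y ml (A.triAct h₄ f x))) := by
  have h := act_app h₁ h₂ h₃ h₄ η f (A.elt X l x)
  rw [A.act_elt] at h
  exact (B.act_elt h₁ f _).symm.trans h

/-- Naturality of `η` along the matrix `(t, r) → (t, r')` whose only entry is the identity of `t`.
This matrix carries `(x, y)` to `(x, 0)`, so `η` maps first summands to first summands,
independently of the object of `R`. -/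
theorem app_elt_inl (t : T.Obj) (r r' : R.Obj) {m p : ℤ} (h : n + m = p) (x : (A.fst.obj t).X m) :
    (B.elt (t, r') p).symm (app h η (A.elt (t, r') m (x, 0))) =
      (((B.elt (t, r) p).symm (app h η (A.elt (t, r) m (x, 0)))).1, 0) := by
  have h₁ := act_app_elt η (zero_add p) h h (zero_add m) (triT P.uncurry r r' (T.id t)) (x, 0)
  rw [triAct_triT, triAct_triT, id_act, id_act, mul_zero, Int.negOnePow_zero, one_smul] at h₁
  exact h₁.symm

/-- The same argument with the matrix whose only entry is the identity of `r`. -/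
theorem app_elt_inr (t t' : T.Obj) (r : R.Obj) {m p : ℤ} (h : n + m = p) (y : (A.snd.obj r).X m) :
    (B.elt (t', r) p).symm (app h η (A.elt (t', r) m (0, y))) =
      (0, ((B.elt (t, r) p).symm (app h η (A.elt (t, r) m (0, y)))).2) := by
  have h₁ := act_app_elt η (zero_add p) h h (zero_add m) (triR P.uncurry t t' (R.id r)) (0, y)
  rw [triAct_triR, triAct_triR, id_act, id_act, mul_zero, Int.negOnePow_zero, one_smul] at h₁
  exact h₁.symm

/-- The restriction of a morphism of dg-modules to the first summands. -/
def homFst (r : R.Obj) : (dgMod T).Hom A.fst B.fst n :=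
  mkNat (fun {t m p} h => LinearMap.fst K _ _ ∘ₗ (B.elt (t, r) p).symm.toLinearMap ∘ₗ
    app h η ∘ₗ (A.elt (t, r) m).toLinearMap ∘ₗ LinearMap.inl K _ _) <| by
  intro t t' m l p nl ml h₁ h₂ h₃ h₄ a x
  have h := act_app_elt η h₁ h₂ h₃ h₄ (triT P.uncurry r r a) (x, 0)
  rw [triAct_triT, triAct_triT] at h
  exact congrArg Prod.fst h

/-- The restriction of a morphism of dg-modules to the second summands. -/
def homSnd (t : T.Obj) : (dgMod R).Hom A.snd B.snd n :=
  mkNat (fun {r m p} h => LinearMap.snd K _ _ ∘ₗ (B.elt (t, r) p).symm.toLinearMap ∘ₗ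
    app h η ∘ₗ (A.elt (t, r) m).toLinearMap ∘ₗ LinearMap.inr K _ _) <| by
  intro r r' m l p nl ml h₁ h₂ h₃ h₄ b y
  have h := act_app_elt η h₁ h₂ h₃ h₄ (triR P.uncurry t t b) (0, y)
  rw [triAct_triR, triAct_triR] at h
  exact congrArg Prod.snd h

theorem app_homFst (r : R.Obj) {t : T.Obj} {m p : ℤ} (h : n + m = p) (x : (A.fst.obj t).X m) :
    app h (homFst η r) x = ((B.elt (t, r) p).symm (app h η (A.elt (t, r) m (x, 0)))).1 :=
  app_mkNat _ _ h x

theorem app_homSnd (t : T.Obj) {r : R.Obj} {m p : ℤ} (h : n + m = p) (y : (A.snd.obj r).X m) :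
    app h (homSnd η t) y = ((B.elt (t, r) p).symm (app h η (A.elt (t, r) m (0, y)))).2 :=
  app_mkNat _ _ h y

/-- Combining the two preceding facts, `η` is diagonal, and its diagonal blocks can be read off at
any fixed `r₀` and `t₀`. -/
theorem app_elt (t₀ : T.Obj) (r₀ : R.Obj) (t : T.Obj) (r : R.Obj) {m p : ℤ} (h : n + m = p)
    (x : (A.fst.obj t).X m × (A.snd.obj r).X m) :
    app h η (A.elt (t, r) m x) =
      B.elt (t, r) p (app h (homFst η r₀) x.1, app h (homSnd η t₀) x.2) := by
  obtain ⟨x, y⟩ := x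
  have e : A.elt (t, r) m (x, y) = A.elt (t, r) m (x, 0) + A.elt (t, r) m (0, y) := by
    rw [← map_add, Prod.mk_add_mk, add_zero, zero_add]
  refine (B.elt (t, r) p).symm.injective ?_
  rw [e, map_add (app h η), map_add, app_elt_inl η t r₀ r, app_elt_inr η t₀ t r]
  refine (Prod.ext ?_ ?_ : (_ : (B.fst.obj t).X p × (B.snd.obj r).X p) = _)
  · exact (add_zero _).trans (app_homFst η r₀ h x).symm
  · exact (zero_add _).trans (app_homSnd η t₀ h y).symm

/-- Naturality of `η` along matrices whose only entry `y` is in the lower left corner is exactly the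
compatibility that makes the two diagonal blocks a morphism of triples. -/
theorem homFst_hom (t₀ : T.Obj) (r₀ : R.Obj) {t : T.Obj} {m p : ℤ} (h : n + m = p)
    (x : (A.fst.obj t).X m) :
    B.hom (app h (homFst η r₀) x) = (dgMod R).comp h (homSnd η t₀) (A.hom x) := by
  refine app_ext fun {r l q} h' y => ?_
  have h₁ := act_app_elt η (show l + p = q by omega) h (show n + (l + m) = q by omega) rfl
    (triM P.uncurry t t r r y) (x, 0)
  rw [triAct_triM, triAct_triM, app_elt η t₀ r₀, app_elt η t₀ r₀] at h₁
  have h₂ : B.mact (show l + p = q by omega) y (app h (homFst η r₀) x) =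
      (n * l).negOnePow • app (show n + (l + m) = q by omega) (homSnd η t₀) (A.mact rfl y x) :=
    congrArg Prod.snd h₁
  rw [mact_apply, mact_apply, map_sign, sign_sign] at h₂
  -- The signs on the two sides are `l * p` and `l * (n + m)`, equal because `n + m = p`;
  -- multiplying by this sign removes both.
  have h₃ := congrArg (fun z => (l * p).negOnePow • z) h₂
  simp only [sign_sign] at h₃
  rw [sign_congr (b := 0) ⟨l * p, by ring⟩, Int.negOnePow_zero, one_smul,
    sign_congr (b := 0) ⟨l * (n + m), by subst h; ring⟩, Int.negOnePow_zero, one_smul] at h₃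
  rw [app_comp h h' (show m + l = l + m by omega) (show n + (l + m) = q by omega)]
  exact h₃

/-- Every morphism of dg-modules is diagonal with compatible blocks, so it comes from a morphism of
triples. The base points are essential: the component of a morphism of triples at `t` is visible
only at objects `(t, r)`, and that at `r` only at objects `(t, r)` with some `t`. -/
theorem glueToModule_fullyFaithful [Nonempty T.Obj] [Nonempty R.Obj] :
    (glueToModule P).FullyFaithful := fun A B n => by
  obtain ⟨t₀⟩ := ‹Nonempty T.Obj›
  obtain ⟨r₀⟩ := ‹Nonempty R.Obj›
  refine ⟨fun f g hfg => ?_, fun η => ?_⟩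
  · have H : ∀ (X : T.Obj × R.Obj) {m p : ℤ} (h : n + m = p)
        (x : (A.fst.obj X.1).X m × (A.snd.obj X.2).X m),
        (app h f.1.1 x.1, app h f.1.2 x.2) = (app h g.1.1 x.1, app h g.1.2 x.2) :=
      fun X m p h x => (B.elt X p).injective <| (app_toModuleHom f h x).symm.trans <|
        (congrArg (fun z => app h z (A.elt X m x)) hfg).trans (app_toModuleHom g h x)
    exact homs_ext (app_ext fun {t m p} h x => congrArg Prod.fst (H (t, r₀) h (x, 0)))
      (app_ext fun {r m p} h y => congrArg Prod.snd (H (t₀, r) h (0, y)))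
  · exact ⟨⟨(homFst η r₀, homSnd η t₀), fun h x => homFst_hom η t₀ r₀ h x⟩,
      toModule_ext fun {X m p} h x => (app_toModuleHom _ h x).trans
        (app_elt η t₀ r₀ X.1 X.2 h x).symm⟩

end FullyFaithful

end TriangularModules

/-! ### Subcomplexes, and closedness in degree zero -/

section SubComplex

variable {K : Type u} [CommRing K]

/-- The subcomplex given by a family of submodules stable under the differential. -/
abbrev subComplex (F : CochainComplex (ModuleCat.{v} K) ℤ) (S : ∀ n, Submodule K (F.X n))
    (hS : ∀ {n} {x : F.X n}, x ∈ S n → diffCochain F n x ∈ S (n + 1)) :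
    CochainComplex (ModuleCat.{v} K) ℤ where
  X n := ModuleCat.of K (S n)
  d i j := ModuleCat.ofHom ((F.d i j).hom.restrict (p := S i) (q := S j) fun x hx => by
    -- Stability is assumed only for consecutive degrees; all other components of the differential
    -- are zero.
    by_cases h : i + 1 = j
    · subst h
      exact hS hx
    · rw [F.shape i j h]
      exact (S j).zero_mem)
  shape i j h := ModuleCat.hom_ext <| LinearMap.ext fun x =>
    Subtype.ext (LinearMap.congr_fun (congrArg ModuleCat.Hom.hom (F.shape i j h)) x.1)
  d_comp_d' i j k _ _ := ModuleCat.hom_ext <| LinearMap.ext fun x =>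
    Subtype.ext (LinearMap.congr_fun (congrArg ModuleCat.Hom.hom (F.d_comp_d i j k)) x.1)

variable {A : DGCat.{w, v} K} {F G : DGFunctor A (dgModBase.{v''} K)}

theorem DGFunctor.d_eq_zero_of_diff_app {η : (dgMod A).Hom F G 0}
    (h : ∀ {X : A.Obj} {n : ℤ} (x : (F.obj X).X n),
      diffCochain _ n (app (zero_add n) η x) = app (zero_add (n + 1)) η (diffCochain _ n x)) :
    (dgMod A).d 0 η = 0 :=
  app_ext fun {X m p} h' x => by
    obtain rfl : p = m + 1 := by omega
    rw [app_d (zero_add m) h', h, Int.negOnePow_zero, one_smul, sub_self, map_zero,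
      LinearMap.zero_apply]

end SubComplex

/-! ### Corner idempotents acting on a dg-module over a triangular matrix dg-category -/

section Splitting

variable {K : Type u} [CommRing K] {T : DGCat.{w', v'} K} {R : DGCat.{w, v} K}

section Act

variable {M : (dgMod.{_, _, v''} (R.tensor T.op)).Obj}
  (F : DGFunctor (triMat T R M) (dgModBase.{v''} K)) {t t' t'' : T.Obj} {r r' r'' : R.Obj}
  {n m l p : ℤ}

section Comp

variable {nm ml : ℤ} (h₁ : n + m = nm) (h₂ : nm + l = p) (h₃ : m + l = ml) (h₄ : n + ml = p)
  (x : (F.obj (t, r)).X l)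

theorem act_triT_triT (a : T.Hom t' t'' n) (b : T.Hom t t' m) :
    F.act h₄ (triT M r' r'' a) (F.act h₃ (triT M r r' b) x) =
      F.act h₂ (triT M r r'' (T.comp h₁ a b)) x := by
  rw [← F.comp_act h₁ h₂ h₃ h₄, triT_comp_triT]

theorem act_triM_triT (a : (M.obj (tobj r'' t')).X n) (b : T.Hom t t' m) :
    F.act h₄ (triM M t' t'' r' r'' a) (F.act h₃ (triT M r r' b) x) =
      F.act h₂ (triM M t t'' r r'' (ract M r'' h₁ a b)) x := by
  rw [← F.comp_act h₁ h₂ h₃ h₄, triM_comp_triT]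

theorem act_triR_triM (a : R.Hom r' r'' n) (b : (M.obj (tobj r' t)).X m) :
    F.act h₄ (triR M t' t'' a) (F.act h₃ (triM M t t' r r' b) x) =
      F.act h₂ (triM M t t'' r r'' (lact M t h₁ a b)) x := by
  rw [← F.comp_act h₁ h₂ h₃ h₄, triR_comp_triM]

theorem act_triR_triR (a : R.Hom r' r'' n) (b : R.Hom r r' m) :
    F.act h₄ (triR M t' t'' a) (F.act h₃ (triR M t t' b) x) =
      F.act h₂ (triR M t t'' (R.comp h₁ a b)) x := by
  rw [← F.comp_act h₁ h₂ h₃ h₄, triR_comp_triR]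

theorem act_triT_triR (a : T.Hom t' t'' n) (b : R.Hom r r' m) :
    F.act h₄ (triT M r' r'' a) (F.act h₃ (triR M t t' b) x) = 0 := by
  rw [← F.comp_act rfl (by omega) h₃ h₄, triT_comp_triR, map_zero, LinearMap.zero_apply]

theorem act_triR_triT (a : R.Hom r' r'' n) (b : T.Hom t t' m) :
    F.act h₄ (triR M t' t'' a) (F.act h₃ (triT M r r' b) x) = 0 := by
  rw [← F.comp_act rfl (by omega) h₃ h₄, triR_comp_triT, map_zero, LinearMap.zero_apply]

theorem act_triM_triR (a : (M.obj (tobj r'' t')).X n) (b : R.Hom r r' m) :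
    F.act h₄ (triM M t' t'' r' r'' a) (F.act h₃ (triR M t t' b) x) = 0 := by
  rw [← F.comp_act rfl (by omega) h₃ h₄, triM_comp_triR, map_zero, LinearMap.zero_apply]

end Comp

variable (x : (F.obj (t, r)).X l)

/-- The identity matrix is the sum of the two corner idempotents; this is the source of the
splitting. -/
theorem act_triT_id_add_act_triR_id :
    F.act (zero_add l) (triT M r r (T.id t)) x + F.act (zero_add l) (triR M t t (R.id r)) x = x := by
  rw [← LinearMap.add_apply, ← map_add, ← triMat_id_eq, id_act]

theorem diff_act_triT (a : T.Hom t t' n) (h : n + l = p) :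
    diffCochain _ p (F.act h (triT M r r' a) x) =
      F.act (show (n + 1) + l = p + 1 by omega) (triT M r r' (T.d n a)) x +
        n.negOnePow • F.act (show n + (l + 1) = p + 1 by omega) (triT M r r' a)
          (diffCochain _ l x) := by
  rw [diff_act, d_triT]

theorem diff_act_triR (b : R.Hom r r' n) (h : n + l = p) :
    diffCochain _ p (F.act h (triR M t t' b) x) =
      F.act (show (n + 1) + l = p + 1 by omega) (triR M t t' (R.d n b)) x +
        n.negOnePow • F.act (show n + (l + 1) = p + 1 by omega) (triR M t t' b)
          (diffCochain _ l x) := by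
  rw [diff_act, d_triR]

/-- Identities are closed of degree `0`, so these matrices act by morphisms of complexes. In
particular the elements fixed by a corner idempotent form a subcomplex. -/
theorem diff_act_triT_id (r r' : R.Obj) (x : (F.obj (t, r)).X l) :
    diffCochain _ l (F.act (zero_add l) (triT M r r' (T.id t)) x) =
      F.act (zero_add (l + 1)) (triT M r r' (T.id t)) (diffCochain _ l x) := by
  rw [diff_act_triT, T.d_id, map_zero, map_zero, LinearMap.zero_apply, zero_add,
    Int.negOnePow_zero, one_smul]

theorem diff_act_triR_id (t t' : T.Obj) (x : (F.obj (t, r)).X l) :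
    diffCochain _ l (F.act (zero_add l) (triR M t t' (R.id r)) x) =
      F.act (zero_add (l + 1)) (triR M t t' (R.id r)) (diffCochain _ l x) := by
  rw [diff_act_triR, R.d_id, map_zero, map_zero, LinearMap.zero_apply, zero_add,
    Int.negOnePow_zero, one_smul]

/-- The elements fixed by the idempotent of the upper left corner. -/
def fixT (r₀ : R.Obj) (t : T.Obj) (n : ℤ) : Submodule K ((F.obj (t, r₀)).X n) :=
  LinearMap.eqLocus (F.act (zero_add n) (triT M r₀ r₀ (T.id t))) LinearMap.id

/-- The elements fixed by the idempotent of the lower right corner. -/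
def fixR (t₀ : T.Obj) (r : R.Obj) (n : ℤ) : Submodule K ((F.obj (t₀, r)).X n) :=
  LinearMap.eqLocus (F.act (zero_add n) (triR M t₀ t₀ (R.id r))) LinearMap.id

theorem mem_fixT {r₀ : R.Obj} {x : (F.obj (t, r₀)).X n} :
    x ∈ fixT F r₀ t n ↔ F.act (zero_add n) (triT M r₀ r₀ (T.id t)) x = x := Iff.rfl

theorem mem_fixR {t₀ : T.Obj} {x : (F.obj (t₀, r)).X n} :
    x ∈ fixR F t₀ r n ↔ F.act (zero_add n) (triR M t₀ t₀ (R.id r)) x = x := Iff.rfl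

theorem act_triT_mem (r₀ : R.Obj) (h : n + l = p) (a : T.Hom t t' n) :
    F.act h (triT M r r₀ a) x ∈ fixT F r₀ t' p := by
  rw [mem_fixT, act_triT_triT F (zero_add n) h, T.id_comp]

theorem act_triR_mem (t₀ : T.Obj) (h : n + l = p) (b : R.Hom r r' n) :
    F.act h (triR M t t₀ b) x ∈ fixR F t₀ r' p := by
  rw [mem_fixR, act_triR_triR F (zero_add n) h, R.id_comp]

/-- A lower left entry `y` lands in the lower right corner, where the `T` coordinate can be changed
from `t'` to `t''` by a matrix with the identity of `r'`. So the choice of base point `t₀` in the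
target is harmless. -/
theorem act_triM_id_lact (r r' : R.Obj) (t t' : T.Obj) (h : n + l = p)
    (y : (M.obj (tobj r' t)).X n) (x : (F.obj (t, r)).X l) (t'' : T.Obj) :
    F.act (zero_add p) (triR M t' t'' (R.id r')) (F.act h (triM M t t' r r' y) x) =
      F.act h (triM M t t'' r r' y) x := by
  rw [act_triR_triM F (zero_add n) h, id_lact]

/-- Dually, a lower left entry sees only the upper left part of its argument, so the `R` coordinate
of the source may be changed to the base point `r₀`. -/
theorem act_triM_ract_id (r r' r'' : R.Obj) (t t' : T.Obj) (h : n + l = p)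
    (y : (M.obj (tobj r'' t)).X n) (x : (F.obj (t, r)).X l) :
    F.act h (triM M t t' r' r'' y) (F.act (zero_add l) (triT M r r' (T.id t)) x) =
      F.act h (triM M t t' r r'' y) x := by
  rw [act_triM_triT F (add_zero n) h, ract_id]

theorem act_triM_mem (t₀ : T.Obj) (h : n + l = p) (y : (M.obj (tobj r' t)).X n) :
    F.act h (triM M t t₀ r r' y) x ∈ fixR F t₀ r' p :=
  act_triM_id_lact F r r' t t₀ h y x t₀

/-- The dg `T`-module of elements fixed by the idempotents of the upper left corner. -/
def fstPart (r₀ : R.Obj) : (dgMod.{_, _, v''} T).Obj :=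
  ofAction (fun t => subComplex (F.obj (t, r₀)) (fixT F r₀ t) fun {n x} hx => by
      rw [mem_fixT] at hx ⊢
      rw [← diff_act_triT_id, hx])
    (fun {t t' n m p} h => LinearMap.mk₂ K
      (fun a x => (⟨F.act h (triT M r₀ r₀ a) x.1, act_triT_mem F x.1 r₀ h a⟩ : fixT F r₀ t' p))
      (fun _ _ _ => Subtype.ext (by simp)) (fun _ _ _ => Subtype.ext (by simp))
      (fun _ _ _ => Subtype.ext (by simp)) (fun _ _ _ => Subtype.ext (by simp)))
    (fun x => Subtype.ext x.2)
    (fun h₁ h₂ h₃ h₄ a b x => Subtype.ext (act_triT_triT F h₁ h₂ h₃ h₄ x.1 a b).symm)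
    (fun h a x => Subtype.ext (diff_act_triT F x.1 a h))

/-- The dg `R`-module of elements fixed by the idempotents of the lower right corner. -/
def sndPart (t₀ : T.Obj) : (dgMod.{_, _, v''} R).Obj :=
  ofAction (fun r => subComplex (F.obj (t₀, r)) (fixR F t₀ r) fun {n x} hx => by
      rw [mem_fixR] at hx ⊢
      rw [← diff_act_triR_id, hx])
    (fun {r r' n m p} h => LinearMap.mk₂ K
      (fun b x => (⟨F.act h (triR M t₀ t₀ b) x.1, act_triR_mem F x.1 t₀ h b⟩ : fixR F t₀ r' p))
      (fun _ _ _ => Subtype.ext (by simp)) (fun _ _ _ => Subtype.ext (by simp))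
      (fun _ _ _ => Subtype.ext (by simp)) (fun _ _ _ => Subtype.ext (by simp)))
    (fun x => Subtype.ext x.2)
    (fun h₁ h₂ h₃ h₄ a b x => Subtype.ext (act_triR_triR F h₁ h₂ h₃ h₄ x.1 a b).symm)
    (fun h a x => Subtype.ext (diff_act_triR F x.1 a h))

/-- The inclusion of `fstPart`. -/
def fstIncl (r₀ : R.Obj) (t : T.Obj) (n : ℤ) :
    (DGFunctor.obj (fstPart F r₀) t).X n →ₗ[K] (F.obj (t, r₀)).X n :=
  (fixT F r₀ t n).subtype

/-- The inclusion of `sndPart`. -/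
def sndIncl (t₀ : T.Obj) (r : R.Obj) (n : ℤ) :
    (DGFunctor.obj (sndPart F t₀) r).X n →ₗ[K] (F.obj (t₀, r)).X n :=
  (fixR F t₀ r n).subtype

theorem fstIncl_injective (r₀ : R.Obj) (t : T.Obj) (n : ℤ) :
    Function.Injective (fstIncl F r₀ t n) := Subtype.val_injective

theorem sndIncl_injective (t₀ : T.Obj) (r : R.Obj) (n : ℤ) :
    Function.Injective (sndIncl F t₀ r n) := Subtype.val_injective

theorem fstIncl_act (r₀ : R.Obj) (h : n + m = p) (a : T.Hom t t' n)
    (x : (DGFunctor.obj (fstPart F r₀) t).X m) :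
    fstIncl F r₀ t' p (act (fstPart F r₀) h a x) =
      F.act h (triT M r₀ r₀ a) (fstIncl F r₀ t m x) :=
  congrArg (fstIncl F r₀ t' p) (ofAction_act (A := T) _ _ _ _ _ h a x)

theorem sndIncl_act (t₀ : T.Obj) (h : n + m = p) (b : R.Hom r r' n)
    (x : (DGFunctor.obj (sndPart F t₀) r).X m) :
    sndIncl F t₀ r' p (act (sndPart F t₀) h b x) =
      F.act h (triR M t₀ t₀ b) (sndIncl F t₀ r m x) :=
  congrArg (sndIncl F t₀ r' p) (ofAction_act (A := R) _ _ _ _ _ h b x)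

theorem fstIncl_diff (r₀ : R.Obj) (x : (DGFunctor.obj (fstPart F r₀) t).X m) :
    fstIncl F r₀ t (m + 1) (diffCochain _ m x) = diffCochain _ m (fstIncl F r₀ t m x) := rfl

theorem sndIncl_diff (t₀ : T.Obj) (x : (DGFunctor.obj (sndPart F t₀) r).X m) :
    sndIncl F t₀ r (m + 1) (diffCochain _ m x) = diffCochain _ m (sndIncl F t₀ r m x) := rfl

theorem act_fstIncl (r₀ : R.Obj) (x : (DGFunctor.obj (fstPart F r₀) t).X m) :
    F.act (zero_add m) (triT M r₀ r₀ (T.id t)) (fstIncl F r₀ t m x) = fstIncl F r₀ t m x := x.2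

theorem act_sndIncl (t₀ : T.Obj) (x : (DGFunctor.obj (sndPart F t₀) r).X m) :
    F.act (zero_add m) (triR M t₀ t₀ (R.id r)) (sndIncl F t₀ r m x) = sndIncl F t₀ r m x := x.2

end Act

end Splitting

/-! ### The triple cut out of a dg-module by the corner idempotents -/

section Splitting

variable {K : Type u} [CommRing K] {T : DGCat.{w', v'} K} {R : DGCat.{w, v} K}
  {P : DGFunctor T.op (dgMod.{_, _, v''} R)}
  (F : DGFunctor (triMat T R P.uncurry) (dgModBase.{v''} K)) (t₀ : T.Obj) (r₀ : R.Obj)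

/-- The action of the lower left entries of a triangular matrix dg-category. -/
def actM (t t' : T.Obj) (r r' : R.Obj) {n m p : ℤ} (h : n + m = p) :
    ((P.obj t).obj r').X n →ₗ[K] (F.obj (t, r)).X m →ₗ[K] (F.obj (t', r')).X p :=
  F.act h ∘ₗ triM P.uncurry t t' r r'

section ActM

variable {t t' t'' : T.Obj} {r r' r'' : R.Obj} {n m l nm ml p : ℤ} (h₁ : n + m = nm)
  (h₂ : nm + l = p) (h₃ : m + l = ml) (h₄ : n + ml = p) (x : (F.obj (t, r)).X l)

theorem act_triR_actM (b : R.Hom r' r'' n) (y : ((P.obj t).obj r').X m) :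
    F.act h₄ (triR P.uncurry t' t'' b) (actM F t t' r r' h₃ y x) =
      actM F t t'' r r'' h₂ ((P.obj t).act h₁ b y) x :=
  (act_triR_triM F h₁ h₂ h₃ h₄ x b y).trans <|
    congrArg (fun z => actM F t t'' r r'' h₂ z x) (uncurry_lact P t h₁ b y)

theorem actM_act_triT (y : ((P.obj t').obj r'').X n) (a : T.Hom t t' m) :
    actM F t' t'' r' r'' h₄ y (F.act h₃ (triT P.uncurry r r' a) x) = (n * m).negOnePow •
      actM F t t'' r r'' h₂ (app (show m + n = nm by omega) (P.map (X := t') (Y := t) a) y) x :=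
  (act_triM_triT F h₁ h₂ h₃ h₄ x y a).trans <|
    (congrArg (fun z => actM F t t'' r r'' h₂ z x) (uncurry_ract P r'' h₁ y a)).trans
      (map_sign₂ _ _ _ _)

end ActM

theorem diff_actM {t t' : T.Obj} {r r' : R.Obj} {n m p : ℤ} (h : n + m = p)
    (y : ((P.obj t).obj r').X n) (x : (F.obj (t, r)).X m) :
    diffCochain _ p (actM F t t' r r' h y x) =
      actM F t t' r r' (show (n + 1) + m = p + 1 by omega) (diffCochain _ n y) x +
        n.negOnePow • actM F t t' r r' (show n + (m + 1) = p + 1 by omega) y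
          (diffCochain _ m x) :=
  (F.diff_act h _ x).trans <|
    congrArg (fun z => F.act (show (n + 1) + m = p + 1 by omega) z x +
      n.negOnePow • actM F t t' r r' (show n + (m + 1) = p + 1 by omega) y (diffCochain _ m x))
      (d_triM (M := P.uncurry) t t' r r' y)

/-- The map `x ↦ (y ↦ (-1) ^ (|x| * |y|) • y x)` defined by the lower left entries. -/
def splitHomApp {t : T.Obj} {r : R.Obj} {n m p : ℤ} (h : n + m = p) :
    (DGFunctor.obj (fstPart F r₀) t).X n →ₗ[K] ((P.obj t).obj r).X m →ₗ[K]
      (DGFunctor.obj (sndPart F t₀) r).X p :=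
  (n * m).negOnePow • LinearMap.mk₂ K
    (fun x y => (⟨actM F t t₀ r₀ r (show m + n = p by omega) y (fstIncl F r₀ t n x),
      act_triM_mem F _ t₀ (show m + n = p by omega) y⟩ : fixR F t₀ r p))
    (fun x x' y => Subtype.ext ((congrArg _ (map_add (fstIncl F r₀ t n) x x')).trans
      (map_add (actM F t t₀ r₀ r _ y) _ _)))
    (fun c x y => Subtype.ext ((congrArg _ (map_smul (fstIncl F r₀ t n) c x)).trans
      (map_smul (actM F t t₀ r₀ r _ y) _ _)))
    (fun _ y y' => Subtype.ext (LinearMap.map_add₂ (actM F t t₀ r₀ r _) y y' _))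
    (fun c _ y => Subtype.ext (LinearMap.map_smul₂ (actM F t t₀ r₀ r _) c y _))

theorem sndIncl_splitHomApp {t : T.Obj} {r : R.Obj} {n m p : ℤ} (h : n + m = p)
    (x : (DGFunctor.obj (fstPart F r₀) t).X n) (y : ((P.obj t).obj r).X m) :
    sndIncl F t₀ r p (splitHomApp F t₀ r₀ h x y) = (n * m).negOnePow •
      actM F t t₀ r₀ r (show m + n = p by omega) y (fstIncl F r₀ t n x) := rfl

theorem act_splitHomApp {t : T.Obj} {n : ℤ} (x : (DGFunctor.obj (fstPart F r₀) t).X n)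
    {r r' : R.Obj} {m l p nl ml : ℤ} (h₁ : m + nl = p) (h₂ : n + l = nl) (h₃ : n + ml = p)
    (h₄ : m + l = ml) (b : R.Hom r r' m) (y : ((P.obj t).obj r).X l) :
    act (sndPart F t₀) h₁ b (splitHomApp F t₀ r₀ h₂ x y) =
      (n * m).negOnePow • splitHomApp F t₀ r₀ h₃ x ((P.obj t).act h₄ b y) := by
  refine sndIncl_injective F t₀ r' p ((sndIncl_act F t₀ _ _ _).trans ?_)
  rw [map_sign, sndIncl_splitHomApp, sndIncl_splitHomApp, map_sign, sign_sign,
    act_triR_actM F h₄ (show ml + n = p by omega)]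
  exact sign_congr ⟨- (n * m), by subst h₄; ring⟩ _

/-- The structure morphism of the triple attached to a dg-module. -/
def splitHom {t : T.Obj} {n : ℤ} :
    (DGFunctor.obj (fstPart F r₀) t).X n →ₗ[K] (dgMod R).Hom (P.obj t) (sndPart F t₀) n where
  toFun x := mkNat (fun h => splitHomApp F t₀ r₀ h x) (act_splitHomApp F t₀ r₀ x)
  map_add' x x' := app_ext fun h y => by
    rw [map_add (app h), LinearMap.add_apply, app_mkNat, app_mkNat, app_mkNat, map_add,
      LinearMap.add_apply]
  map_smul' c x := app_ext fun h y => by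
    rw [RingHom.id_apply, map_smul (app h), LinearMap.smul_apply, app_mkNat, app_mkNat, map_smul,
      LinearMap.smul_apply]

theorem app_splitHom {t : T.Obj} {r : R.Obj} {n m p : ℤ} (h : n + m = p)
    (x : (DGFunctor.obj (fstPart F r₀) t).X n) (y : ((P.obj t).obj r).X m) :
    app h (splitHom F t₀ r₀ x) y = splitHomApp F t₀ r₀ h x y :=
  app_mkNat (fun h => splitHomApp F t₀ r₀ h x) (act_splitHomApp F t₀ r₀ x) h y

/-- The triple attached to a dg-module over a triangular matrix dg-category. -/
def splitObj : GlueObj.{_, _, _, _, v''} P where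
  fst := fstPart F r₀
  snd := sndPart F t₀
  hom := splitHom F t₀ r₀
  hom_d {t n} x := app_ext fun {r m p} h y => by
    obtain ⟨q, rfl⟩ : ∃ q, p = q + 1 := ⟨p - 1, by omega⟩
    refine sndIncl_injective F t₀ r _ ?_
    rw [app_d (show n + m = q by omega), app_splitHom, app_splitHom, app_splitHom, map_sub,
      map_sign, sndIncl_diff, sndIncl_splitHomApp, sndIncl_splitHomApp, sndIncl_splitHomApp,
      fstIncl_diff, map_sign, diff_actM, smul_add, sign_sign, sign_sign]
    -- The terms in `d y` cancel. The remaining term in `d x` has sign `n * m + m`, which is the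
    -- sign `(n + 1) * m` attached to `d x`.
    rw [sign_congr (a := n * m) (b := n + n * (m + 1)) ⟨-n, by ring⟩, add_sub_cancel_left]
    exact sign_congr ⟨0, by ring⟩ _
  hom_act {t t' n m p} h a x := app_ext fun {r l q} h' y => by
    refine sndIncl_injective F t₀ r _ ?_
    rw [map_sign₂, app_comp _ h' (show n + l = n + l from rfl) (by omega), app_splitHom,
      app_splitHom, map_sign, sndIncl_splitHomApp, sndIncl_splitHomApp, fstIncl_act, sign_sign]
    rw [actM_act_triT F (add_comm l n) (show (n + l) + m = q by omega), sign_sign]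
    exact sign_congr ⟨n * l - n * m, by subst h; ring⟩ _

end Splitting

/-! ### A dg-module over the triangular matrix dg-category is the sum of its two corners -/

section Splitting

variable {K : Type u} [CommRing K] {T : DGCat.{w', v'} K} {R : DGCat.{w, v} K}
  {P : DGFunctor T.op (dgMod.{_, _, v''} R)}
  (F : DGFunctor (triMat T R P.uncurry) (dgModBase.{v''} K)) (t₀ : T.Obj) (r₀ : R.Obj)

/-- The sign in the structure map of the triple and the sign in `mact` are the same and cancel, so
the pairing is the original action of the lower left entries. -/
theorem mact_splitObj {t : T.Obj} {r : R.Obj} {n m p : ℤ} (h : n + m = p)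
    (y : ((P.obj t).obj r).X n) (x : (DGFunctor.obj (fstPart F r₀) t).X m) :
    sndIncl F t₀ r p ((splitObj F t₀ r₀).mact h y x) =
      actM F t t₀ r₀ r h y (fstIncl F r₀ t m x) := by
  refine (congrArg (fun z => sndIncl F t₀ r p ((n * m).negOnePow • z))
    (app_splitHom F t₀ r₀ (show m + n = p by omega) x y)).trans ?_
  rw [map_sign, sndIncl_splitHomApp, sign_sign, sign_congr (b := 0) ⟨n * m, by ring⟩,
    Int.negOnePow_zero, one_smul]

/-- The action of a morphism, decomposed into the actions of its entries. -/
theorem act_eq {X Y : T.Obj × R.Obj} {n m p : ℤ} (h : n + m = p)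
    (f : (triMat T R P.uncurry).Hom X Y n) (z : (F.obj X).X m) :
    F.act h f z = F.act (X := (X.1, X.2)) (Y := (Y.1, Y.2)) h (triT P.uncurry X.2 Y.2 f.1) z +
      actM F X.1 Y.1 X.2 Y.2 h f.2.1 z +
      F.act (X := (X.1, X.2)) (Y := (Y.1, Y.2)) h (triR P.uncurry X.1 Y.1 f.2.2) z := by
  refine (congrArg (fun w => F.act h w z) (triMat_hom_eq f)).trans ?_
  exact (LinearMap.map_add₂ _ _ _ _).trans (congrArg (fun w => w + _) (LinearMap.map_add₂ _ _ _ _))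

/-- The sum of the two summands of a split dg-module, as a linear map. -/
def splitSum (X : T.Obj × R.Obj) {m p : ℤ} (h : 0 + m = p) :
    (((splitObj F t₀ r₀).fst.obj X.1).X m × ((splitObj F t₀ r₀).snd.obj X.2).X m) →ₗ[K]
      (F.obj X).X p :=
  LinearMap.coprod
    (F.act (X := (X.1, r₀)) (Y := (X.1, X.2)) h (triT P.uncurry r₀ X.2 (T.id X.1)) ∘ₗ
      fstIncl F r₀ X.1 m)
    (F.act (X := (t₀, X.2)) (Y := (X.1, X.2)) h (triR P.uncurry t₀ X.1 (R.id X.2)) ∘ₗ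
      sndIncl F t₀ X.2 m)

theorem splitSum_apply (t : T.Obj) (r : R.Obj) {m p : ℤ} (h : 0 + m = p)
    (x : ((splitObj F t₀ r₀).fst.obj t).X m × ((splitObj F t₀ r₀).snd.obj r).X m) :
    splitSum F t₀ r₀ (t, r) h x =
      F.act h (triT P.uncurry r₀ r (T.id t)) (fstIncl F r₀ t m x.1) +
      F.act h (triR P.uncurry t₀ t (R.id r)) (sndIncl F t₀ r m x.2) := rfl

/-- The projections onto the two summands of a split dg-module, as a linear map. -/
def splitProj (X : T.Obj × R.Obj) {m p : ℤ} (h : 0 + m = p) :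
    (F.obj X).X m →ₗ[K]
      (((splitObj F t₀ r₀).fst.obj X.1).X p × ((splitObj F t₀ r₀).snd.obj X.2).X p) :=
  LinearMap.prod
    (LinearMap.codRestrict (fixT F r₀ X.1 p)
      (F.act (X := (X.1, X.2)) h (triT P.uncurry X.2 r₀ (T.id X.1)))
      fun z => act_triT_mem F z r₀ h _)
    (LinearMap.codRestrict (fixR F t₀ X.2 p)
      (F.act (X := (X.1, X.2)) h (triR P.uncurry X.1 t₀ (R.id X.2)))
      fun z => act_triR_mem F z t₀ h _)

theorem fstIncl_splitProj (t : T.Obj) (r : R.Obj) {m p : ℤ} (h : 0 + m = p)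
    (z : (F.obj (t, r)).X m) :
    fstIncl F r₀ t p (splitProj F t₀ r₀ (t, r) h z).1 =
      F.act h (triT P.uncurry r r₀ (T.id t)) z := rfl

theorem sndIncl_splitProj (t : T.Obj) (r : R.Obj) {m p : ℤ} (h : 0 + m = p)
    (z : (F.obj (t, r)).X m) :
    sndIncl F t₀ r p (splitProj F t₀ r₀ (t, r) h z).2 =
      F.act h (triR P.uncurry t t₀ (R.id r)) z := rfl

theorem split_ext {t : T.Obj} {r : R.Obj} {n : ℤ}
    {x y : ((splitObj F t₀ r₀).fst.obj t).X n × ((splitObj F t₀ r₀).snd.obj r).X n}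
    (h₁ : fstIncl F r₀ t n x.1 = fstIncl F r₀ t n y.1)
    (h₂ : sndIncl F t₀ r n x.2 = sndIncl F t₀ r n y.2) : x = y :=
  Prod.ext (fstIncl_injective F r₀ t n h₁) (sndIncl_injective F t₀ r n h₂)

/-- Passing to the base points and back is the action of the corner idempotents at `(t, r)`, and
these sum to the identity. -/
theorem splitSum_splitProj (t : T.Obj) (r : R.Obj) {m : ℤ} (z : (F.obj (t, r)).X m) :
    splitSum F t₀ r₀ (t, r) (zero_add m) (splitProj F t₀ r₀ (t, r) (zero_add m) z) = z := by
  rw [splitSum_apply, fstIncl_splitProj, sndIncl_splitProj,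
    act_triT_triT F (zero_add 0) (zero_add m), act_triR_triR F (zero_add 0) (zero_add m),
    T.id_comp, R.id_comp, act_triT_id_add_act_triR_id]

/-- Orthogonality of the corners kills the cross terms, and each diagonal term is an idempotent
applied to an element it fixes. -/
theorem splitProj_splitSum (t : T.Obj) (r : R.Obj) {m : ℤ}
    (x : ((splitObj F t₀ r₀).fst.obj t).X m × ((splitObj F t₀ r₀).snd.obj r).X m) :
    splitProj F t₀ r₀ (t, r) (zero_add m) (splitSum F t₀ r₀ (t, r) (zero_add m) x) = x := by
  refine split_ext F t₀ r₀ ?_ ?_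
  · rw [fstIncl_splitProj, splitSum_apply, map_add, act_triT_triT F (zero_add 0) (zero_add m),
      act_triT_triR, T.id_comp, add_zero]
    exact act_fstIncl F r₀ x.1
  · rw [sndIncl_splitProj, splitSum_apply, map_add, act_triR_triR F (zero_add 0) (zero_add m),
      act_triR_triT, R.id_comp, zero_add]
    exact act_sndIncl F t₀ x.2

theorem splitSum_injective (t : T.Obj) (r : R.Obj) (m : ℤ) :
    Function.Injective (splitSum F t₀ r₀ (t, r) (zero_add m)) :=
  Function.LeftInverse.injective (splitProj_splitSum F t₀ r₀ t r)

/-- The action of `f` is expanded into its three entries on the two summands. Diagonal entries act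
within their own corner; the lower left entry carries the first summand into the second and kills
the second. The base points drop out because lower left entries ignore the `R` coordinate of the
source and the `T` coordinate of the target. -/
theorem act_splitSum {t t' : T.Obj} {r r' : R.Obj} {n m p : ℤ} (h : n + m = p)
    (f : (triMat T R P.uncurry).Hom (t, r) (t', r') n)
    (x : ((splitObj F t₀ r₀).fst.obj t).X m × ((splitObj F t₀ r₀).snd.obj r).X m) :
    F.act h f (splitSum F t₀ r₀ (t, r) (zero_add m) x) =
      splitSum F t₀ r₀ (t', r') (zero_add p)
        ((splitObj F t₀ r₀).triAct (X := (t, r)) (Y := (t', r')) h f x) := by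
  have h₁ : actM F t t' r r' h f.2.1 (F.act (zero_add m) (triT P.uncurry r₀ r (T.id t))
      (fstIncl F r₀ t m x.1)) = actM F t t' r₀ r' h f.2.1 (fstIncl F r₀ t m x.1) :=
    act_triM_ract_id F r₀ r r' t t' h _ _
  have h₂ : actM F t t' r r' h f.2.1 (F.act (zero_add m) (triR P.uncurry t₀ t (R.id r))
      (sndIncl F t₀ r m x.2)) = 0 :=
    act_triM_triR F (zero_add m) h _ _ _
  have h₃ : F.act (zero_add p) (triR P.uncurry t₀ t' (R.id r'))
      (actM F t t₀ r₀ r' h f.2.1 (fstIncl F r₀ t m x.1)) =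
      actM F t t' r₀ r' h f.2.1 (fstIncl F r₀ t m x.1) :=
    act_triM_id_lact F r₀ r' t t₀ h _ _ t'
  have h₄ : fstIncl F r₀ t' p
      ((splitObj F t₀ r₀).triAct (X := (t, r)) (Y := (t', r')) h f x).1 =
      F.act h (triT P.uncurry r₀ r₀ f.1) (fstIncl F r₀ t m x.1) :=
    fstIncl_act F r₀ h f.1 x.1
  have h₅ : sndIncl F t₀ r' p
      ((splitObj F t₀ r₀).triAct (X := (t, r)) (Y := (t', r')) h f x).2 =
      actM F t t₀ r₀ r' h f.2.1 (fstIncl F r₀ t m x.1) +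
        F.act h (triR P.uncurry t₀ t₀ f.2.2) (sndIncl F t₀ r m x.2) :=
    (map_add (sndIncl F t₀ r' p) _ _).trans (congrArg₂ (· + ·)
      (mact_splitObj F t₀ r₀ h f.2.1 x.1) (sndIncl_act F t₀ h f.2.2 x.2))
  rw [act_eq, splitSum_apply, splitSum_apply, h₄, h₅]
  simp only [map_add]
  rw [h₁, h₂, h₃, act_triT_triT F (add_zero n) h, act_triT_triT F (zero_add n) h, act_triT_triR,
    act_triR_triT, act_triR_triR F (add_zero n) h, act_triR_triR F (zero_add n) h, T.comp_id,
    T.id_comp, R.comp_id, R.id_comp, add_zero, add_zero, zero_add, add_assoc]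

theorem diff_splitSum (t : T.Obj) (r : R.Obj) {m : ℤ}
    (x : ((splitObj F t₀ r₀).fst.obj t).X m × ((splitObj F t₀ r₀).snd.obj r).X m) :
    diffCochain _ m (splitSum F t₀ r₀ (t, r) (zero_add m) x) =
      splitSum F t₀ r₀ (t, r) (zero_add (m + 1)) (diffCochain _ m x.1, diffCochain _ m x.2) := by
  rw [splitSum_apply, map_add, diff_act_triT_id, diff_act_triR_id, splitSum_apply]
  rfl

/-- A dg-module over a triangular matrix dg-category is isomorphic to the dg-module attached to
its triple. -/
def splitIso : DGIso (dgMod.{_, _, v''} (triMat T R P.uncurry)) (splitObj F t₀ r₀).toModule F where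
  hom := mkNat (fun {X m p} h => splitSum F t₀ r₀ X h ∘ₗ
      ((splitObj F t₀ r₀).elt X m).symm.toLinearMap) <| by
    intro X Y m l p nl ml h₁ h₂ h₃ h₄ f x
    obtain rfl : nl = l := by omega
    obtain rfl : p = ml := by omega
    rw [zero_mul, Int.negOnePow_zero, one_smul]
    refine (act_splitSum F t₀ r₀ h₁ f x).trans ?_
    exact congrArg _ ((splitObj F t₀ r₀).act_elt h₁ f x).symm
  inv := mkNat (fun {X m p} h => ((splitObj F t₀ r₀).elt X p).toLinearMap ∘ₗ
      splitProj F t₀ r₀ X h) <| by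
    intro X Y m l p nl ml h₁ h₂ h₃ h₄ f z
    obtain rfl : nl = l := by omega
    obtain rfl : p = ml := by omega
    rw [zero_mul, Int.negOnePow_zero, one_smul]
    refine ((splitObj F t₀ r₀).act_elt h₁ f _).trans ?_
    -- Naturality of the inverse is deduced from that of `splitSum`, which is injective and is
    -- undone by the projections.
    refine congrArg _ (splitSum_injective F t₀ r₀ Y.1 Y.2 p ?_)
    refine (act_splitSum F t₀ r₀ h₁ f _).symm.trans ?_
    refine (congrArg _ (splitSum_splitProj F t₀ r₀ X.1 X.2 z)).trans ?_
    exact (splitSum_splitProj F t₀ r₀ Y.1 Y.2 _).symm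
  d_hom := d_eq_zero_of_diff_app fun {X n} x => by
    rw [app_mkNat, app_mkNat]
    exact diff_splitSum F t₀ r₀ X.1 X.2 x
  d_inv := d_eq_zero_of_diff_app fun {X n} z => by
    rw [app_mkNat, app_mkNat]
    refine splitSum_injective F t₀ r₀ X.1 X.2 (n + 1) ?_
    refine (diff_splitSum F t₀ r₀ X.1 X.2 _).symm.trans ?_
    refine (congrArg _ (splitSum_splitProj F t₀ r₀ X.1 X.2 z)).trans ?_
    exact (splitSum_splitProj F t₀ r₀ X.1 X.2 _).symm
  hom_inv_id := app_ext fun {X m p} h x => by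
    obtain rfl : m = p := by omega
    rw [app_comp _ h h h, app_mkNat, app_mkNat, app_id]
    exact splitProj_splitSum F t₀ r₀ X.1 X.2 x
  inv_hom_id := app_ext fun {X m p} h z => by
    obtain rfl : m = p := by omega
    rw [app_comp _ h h h, app_mkNat, app_mkNat, app_id]
    exact splitSum_splitProj F t₀ r₀ X.1 X.2 z

end Splitting

/-! ### Dg-modules over `Λ` are triples; currying -/

section Equivalence

variable {K : Type u} [CommRing K] {T : DGCat.{w', v'} K} {R : DGCat.{w, v} K}

/-- If `T` and `R` have objects, dg-modules over a triangular matrix dg-category are equivalent to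
triples. -/
theorem exists_isDGEquivalence_glueToModule [Nonempty T.Obj] [Nonempty R.Obj]
    (P : DGFunctor T.op (dgMod.{_, _, v''} R)) :
    ∃ G, IsDGEquivalence (glueToModule P) G :=
  ⟨_, glueToModule_fullyFaithful.isDGEquivalence_inverse
    -- The base points only fix where the two summands are realised; any choice gives an isomorphic
    -- dg-module.
    (fun F => splitObj F (Classical.arbitrary T.Obj) (Classical.arbitrary R.Obj))
    (fun F => splitIso F _ _)⟩

/-- With a common object map, the two maps on morphisms have the same type, so dg-functors can be
compared pointwise without casts. -/
theorem DGFunctor.mk_congr {A : DGCat.{w, v} K} {B : DGCat.{w', v'} K} {obj : A.Obj → B.Obj}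
    {map map' : ∀ {X Y : A.Obj} {n : ℤ}, A.Hom X Y n →ₗ[K] B.Hom (obj X) (obj Y) n}
    (h : ∀ {X Y : A.Obj} {n : ℤ} (f : A.Hom X Y n), map f = map' f) (h₁ h₂ h₃ h₁' h₂' h₃') :
    DGFunctor.mk (A := A) (B := B) obj map h₁ h₂ h₃ = DGFunctor.mk obj map' h₁' h₂' h₃' := by
  obtain rfl : @map = @map' := by
    funext X Y n
    exact LinearMap.ext h
  rfl

/-- Because `a ⊗ b = (a ⊗ 1) ∘ (1 ⊗ b)`, with no sign, a dg-functor on a tensor product is recovered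
from its restrictions to each variable. The outcome is an equality, so statements about `(curry
M).uncurry` hold for `M` itself. -/
theorem DGFunctor.uncurry_curry {D : DGCat.{w'', v''} K} (F : DGFunctor (R.tensor T) D) :
    F.curry.uncurry = F := by
  refine DGFunctor.mk_congr (map := F.curry.uncurry.map) (map' := F.map) (fun {X Y n} f => ?_)
    _ _ _ _ _ _
  induction f using ten_induction with
  | zero =>
    exact (map_zero (F.curry.uncurry.map (X := X) (Y := Y) (n := n))).trans
      (map_zero (F.map (X := X) (Y := Y) (n := n))).symm
  | add f g hf hg =>
    exact (map_add (F.curry.uncurry.map (X := X) (Y := Y) (n := n)) f g).trans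
      ((congrArg₂ (· + ·) hf hg).trans (map_add (F.map (X := X) (Y := Y) (n := n)) f g).symm)
  | ten i j h a b =>
    refine (uncurry_map_ten _ h a b).trans ((F.map_comp h _ _).symm.trans (congrArg F.map ?_))
    refine (ten_comp h (add_zero i) (zero_add j) (add_zero i) (zero_add j) a (T.id _) (R.id _)
      b).trans ?_
    rw [R.comp_id, T.id_comp, mul_zero, Int.negOnePow_zero, one_smul]

end Equivalence

/-! ### Recollements of triples and of dg-modules over triangular matrices -/

section Recollement

universe w₁ w₂ w₃ v₁ v₂ v₃

variable {K : Type u} [CommRing K]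

section Glue

variable {T : DGCat.{w', v'} K} {A : DGCat.{w₁, v₁} K} {B : DGCat.{w₂, v₂} K}
  {C : DGCat.{w₃, v₃} K}

/-- A left dg-recollement induces a left dg-recollement of categories of triples. -/
theorem IsLeftDGRecollement.exists_glue {iU : DGFunctor A C} {iL : DGFunctor C A}
    {jL : DGFunctor B A} {jU : DGFunctor A B} (h : IsLeftDGRecollement iU iL jL jU)
    (P : DGFunctor T.op B) :
    ∃ jU', IsLeftDGRecollement ((glueSnd.{w', v', v''} (P.comp jL)).comp iU)
      (iL.comp (glueZero (P.comp jL))) (glueMap P jL) jU' := by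
  obtain ⟨⟨a⟩, ⟨b⟩, h₀, h₁, h₂⟩ := h
  -- The condition `j^! i_* = 0` is used twice: as orthogonality, to obtain the left adjoint of `Z ↦
  -- (0, i_* Z)`, and directly, since the new `j^!` sends `(0, i_* Z)` to `(0, j^! i_* Z)`.
  have hI := (b.isZero_comp_right_iff _).1 h₀
  exact ⟨_, ⟨glueSndAdjunction _ a fun t => hI (P.obj t)⟩, ⟨glueRightAdjunction P b⟩,
    fun Z => GlueObj.homs_ext (zeroModule_source_ext _ _) (h₀ Z),
    h₁.comp (glueZero_fullyFaithful _), glueMap_fullyFaithful h₂⟩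

/-- A right dg-recollement induces a right dg-recollement of categories of triples. -/
theorem IsRightDGRecollement.exists_glue {iL : DGFunctor C A} {iU : DGFunctor A C}
    {jU : DGFunctor A B} {jL : DGFunctor B A} (h : IsRightDGRecollement iL iU jU jL)
    (P : DGFunctor T.op B) :
    ∃ jU', IsRightDGRecollement (iL.comp (glueZero.{w', v', v''} (P.comp jL)))
      ((glueSnd (P.comp jL)).comp iU) jU' (glueMap P jL) := by
  obtain ⟨⟨a⟩, ⟨b⟩, h₀, h₁, h₂⟩ := h
  -- Here the adjunction for `i` is a plain composite and needs no vanishing; full faithfulness `h₂`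
  -- of `j_*` is what defines the new `j^*`.
  exact ⟨_, ⟨a.comp (glueZeroAdjunction _)⟩, ⟨glueLeftAdjunction P b h₂⟩,
    fun Z => GlueObj.homs_ext (zeroModule_source_ext _ _) (h₀ Z),
    h₁.comp (glueZero_fullyFaithful _), glueMap_fullyFaithful h₂⟩

end Glue

section Zero

variable {A : DGCat.{w₁, v₁} K} {B : DGCat.{w₂, v₂} K} {C : DGCat.{w₃, v₃} K}

/-- Zero dg-functors are dg-adjoint. -/
def zeroDGAdjunction {X : A.Obj} (hX : A.id X = 0) {Y : B.Obj} (hY : B.id Y = 0) :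
    DGAdjunction (zeroDGFunctor A hY) (zeroDGFunctor B hX) where
  homEquiv _ _ _ :=
    { toFun := 0
      map_add' := fun _ _ => (add_zero _).symm
      map_smul' := fun _ _ => (smul_zero _).symm
      invFun := 0
      left_inv := fun f => (eq_zero_of_id_source hY f).symm
      right_inv := fun f => (eq_zero_of_id_target hX f).symm }
  homEquiv_d _ _ _ _ := (eq_zero_of_id_target hX _).trans (eq_zero_of_id_target hX _).symm
  homEquiv_naturality_left _ _ _ :=
    (eq_zero_of_id_target hX _).trans (eq_zero_of_id_target hX _).symm
  homEquiv_naturality_right _ _ _ :=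
    (eq_zero_of_id_target hX _).trans (eq_zero_of_id_target hX _).symm

theorem zeroDGFunctor_fullyFaithful (hA : ∀ X : A.Obj, A.id X = 0) {Y : B.Obj}
    (hY : B.id Y = 0) : (zeroDGFunctor A hY).FullyFaithful := fun X X' n =>
  ⟨fun f g _ => (eq_zero_of_id_source (hA X) f).trans (eq_zero_of_id_source (hA X) g).symm,
    fun f => ⟨0, (map_zero _).trans (eq_zero_of_id_source hY f).symm⟩⟩

/-- If every object of `B` is zero, the conditions on the `j` part are met by zero dg-functors. The
definition does not require the images of `i_*` and `j_!` to exhaust `A`, so any fully faithful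
`i_*` with a left adjoint completes to a recollement. -/
theorem IsLeftDGRecollement.of_zero {iU : DGFunctor A C} {iL : DGFunctor C A}
    (adj : DGAdjunction iU iL) (h : iL.FullyFaithful) (hB : ∀ X : B.Obj, B.id X = 0) {X : A.Obj}
    (hX : A.id X = 0) (Y : B.Obj) :
    IsLeftDGRecollement iU iL (zeroDGFunctor B hX) (zeroDGFunctor A (hB Y)) :=
  ⟨⟨adj⟩, ⟨zeroDGAdjunction _ _⟩, fun _ => hB _, h, zeroDGFunctor_fullyFaithful hB hX⟩

theorem IsRightDGRecollement.of_zero {iL : DGFunctor C A} {iU : DGFunctor A C}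
    (adj : DGAdjunction iL iU) (h : iL.FullyFaithful) (hB : ∀ X : B.Obj, B.id X = 0) {X : A.Obj}
    (hX : A.id X = 0) (Y : B.Obj) :
    IsRightDGRecollement iL iU (zeroDGFunctor A (hB Y)) (zeroDGFunctor B hX) :=
  ⟨⟨adj⟩, ⟨zeroDGAdjunction _ _⟩, fun _ => hB _, h, zeroDGFunctor_fullyFaithful hB hX⟩

theorem dgMod_id_eq_zero_of_isEmpty [IsEmpty A.Obj] (F : (dgMod.{_, _, v''} A).Obj) :
    (dgMod A).id F = 0 :=
  Subtype.ext (funext fun X => isEmptyElim X)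

end Zero

section TriangularMatrix

variable {T : DGCat.{w', v'} K} {R : DGCat.{w₁, v₁} K} {S : DGCat.{w₂, v₂} K}
  {C : DGCat.{w₃, v₃} K} [Nonempty S.Obj] [Nonempty T.Obj]

/-- The recollement of triples, carried over to dg-modules. Stating it for `P` rather than for a
bimodule keeps both triangular matrices in the form `uncurry`, to which the equivalence with triples
applies. -/
theorem exists_isLeftDGRecollement_triMat (P : DGFunctor T.op (dgMod.{_, _, v''} R))
    {iU : DGFunctor (dgMod.{_, _, v''} S) C} {iL : DGFunctor C (dgMod.{_, _, v''} S)}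
    {jL : DGFunctor (dgMod.{_, _, v''} R) (dgMod.{_, _, v''} S)}
    {jU : DGFunctor (dgMod.{_, _, v''} S) (dgMod.{_, _, v''} R)}
    (h : IsLeftDGRecollement iU iL jL jU) :
    ∃ (iU' : DGFunctor (dgMod.{_, _, v''} (triMat T S (P.comp jL).uncurry)) C)
      (iL' : DGFunctor C (dgMod.{_, _, v''} (triMat T S (P.comp jL).uncurry)))
      (jL' : DGFunctor (dgMod.{_, _, v''} (triMat T R P.uncurry))
        (dgMod.{_, _, v''} (triMat T S (P.comp jL).uncurry)))
      (jU' : DGFunctor (dgMod.{_, _, v''} (triMat T S (P.comp jL).uncurry))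
        (dgMod.{_, _, v''} (triMat T R P.uncurry))),
      IsLeftDGRecollement iU' iL' jL' jU' := by
  obtain ⟨F', hF⟩ := exists_isDGEquivalence_glueToModule (P.comp jL)
  obtain ⟨jU', h'⟩ := h.exists_glue P
  -- If `R` is empty then so is `T.Obj × R.Obj`: dg-modules over `Λ` are all zero, whereas triples
  -- over `P` still retain a dg `T`-module, so the two need not be equivalent. The `i` part still
  -- comes from triples on the side of `S`, where `S` and `T` have objects.
  rcases isEmpty_or_nonempty R.Obj with hR | hR
  · obtain ⟨a⟩ := h'.adj_i
    obtain ⟨b⟩ := hF.adj_symm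
    have : IsEmpty (triMat T R P.uncurry).Obj := inferInstanceAs (IsEmpty (T.Obj × R.Obj))
    exact ⟨_, _, _, _, .of_zero (b.comp a) (h'.fullyFaithful_i.comp hF.fullyFaithful)
      dgMod_id_eq_zero_of_isEmpty (zeroModule_id _) (zeroModule _)⟩
  · obtain ⟨G', hG⟩ := exists_isDGEquivalence_glueToModule P
    exact ⟨_, _, _, _, h'.transport hF hG⟩

theorem exists_isRightDGRecollement_triMat (P : DGFunctor T.op (dgMod.{_, _, v''} R))
    {iL : DGFunctor C (dgMod.{_, _, v''} S)} {iU : DGFunctor (dgMod.{_, _, v''} S) C}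
    {jU : DGFunctor (dgMod.{_, _, v''} S) (dgMod.{_, _, v''} R)}
    {jL : DGFunctor (dgMod.{_, _, v''} R) (dgMod.{_, _, v''} S)}
    (h : IsRightDGRecollement iL iU jU jL) :
    ∃ (iL' : DGFunctor C (dgMod.{_, _, v''} (triMat T S (P.comp jL).uncurry)))
      (iU' : DGFunctor (dgMod.{_, _, v''} (triMat T S (P.comp jL).uncurry)) C)
      (jU' : DGFunctor (dgMod.{_, _, v''} (triMat T S (P.comp jL).uncurry))
        (dgMod.{_, _, v''} (triMat T R P.uncurry)))
      (jL' : DGFunctor (dgMod.{_, _, v''} (triMat T R P.uncurry))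
        (dgMod.{_, _, v''} (triMat T S (P.comp jL).uncurry))),
      IsRightDGRecollement iL' iU' jU' jL' := by
  obtain ⟨F', hF⟩ := exists_isDGEquivalence_glueToModule (P.comp jL)
  obtain ⟨jU', h'⟩ := h.exists_glue P
  rcases isEmpty_or_nonempty R.Obj with hR | hR
  · obtain ⟨a⟩ := h'.adj_i
    obtain ⟨b⟩ := hF.adj
    have : IsEmpty (triMat T R P.uncurry).Obj := inferInstanceAs (IsEmpty (T.Obj × R.Obj))
    exact ⟨_, _, _, _, .of_zero (a.comp b) (h'.fullyFaithful_i.comp hF.fullyFaithful)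
      dgMod_id_eq_zero_of_isEmpty (zeroModule_id _) (zeroModule _)⟩
  · obtain ⟨G', hG⟩ := exists_isDGEquivalence_glueToModule P
    exact ⟨_, _, _, _, h'.transport hF hG⟩

end TriangularMatrix

end Recollement

theorem mainTheorem2 {K : Type u} [CommRing K] (R S C T : DGCat.{u, u} K)
    [Nonempty S.Obj] [Nonempty T.Obj] (M : (dgMod.{u, u, u, u} (R.tensor T.op)).Obj) :
    (∀ (iU : DGFunctor (dgMod.{u, u, u, u} S) (dgMod.{u, u, u, u} C))
      (iL : DGFunctor (dgMod.{u, u, u, u} C) (dgMod.{u, u, u, u} S))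
      (jL : DGFunctor (dgMod.{u, u, u, u} R) (dgMod.{u, u, u, u} S))
      (jU : DGFunctor (dgMod.{u, u, u, u} S) (dgMod.{u, u, u, u} R)),
      IsLeftDGRecollement iU iL jL jU →
      ∃ (iU' : DGFunctor (dgMod.{u, u, u, u} (triMat T S (pushBimodule jL M))) (dgMod.{u, u, u, u} C))
        (iL' : DGFunctor (dgMod.{u, u, u, u} C) (dgMod.{u, u, u, u} (triMat T S (pushBimodule jL M))))
        (jL' : DGFunctor (dgMod.{u, u, u, u} (triMat T R M))
          (dgMod.{u, u, u, u} (triMat T S (pushBimodule jL M))))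
        (jU' : DGFunctor (dgMod.{u, u, u, u} (triMat T S (pushBimodule jL M)))
          (dgMod.{u, u, u, u} (triMat T R M))),
        IsLeftDGRecollement iU' iL' jL' jU') ∧
    (∀ (iL : DGFunctor (dgMod.{u, u, u, u} C) (dgMod.{u, u, u, u} S))
      (iU : DGFunctor (dgMod.{u, u, u, u} S) (dgMod.{u, u, u, u} C))
      (jU : DGFunctor (dgMod.{u, u, u, u} S) (dgMod.{u, u, u, u} R))
      (jL : DGFunctor (dgMod.{u, u, u, u} R) (dgMod.{u, u, u, u} S)),
      IsRightDGRecollement iL iU jU jL →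
      ∃ (iL' : DGFunctor (dgMod.{u, u, u, u} C) (dgMod.{u, u, u, u} (triMat T S (pushBimodule jL M))))
        (iU' : DGFunctor (dgMod.{u, u, u, u} (triMat T S (pushBimodule jL M))) (dgMod.{u, u, u, u} C))
        (jU' : DGFunctor (dgMod.{u, u, u, u} (triMat T S (pushBimodule jL M)))
          (dgMod.{u, u, u, u} (triMat T R M)))
        (jL' : DGFunctor (dgMod.{u, u, u, u} (triMat T R M))
          (dgMod.{u, u, u, u} (triMat T S (pushBimodule jL M)))),
        IsRightDGRecollement iL' iU' jU' jL') := by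
  have hM : DGFunctor.uncurry (DGFunctor.curry M) = M := DGFunctor.uncurry_curry M
  refine ⟨fun iU iL jL jU h => ?_, fun iL iU jU jL h => ?_⟩
  · have := exists_isLeftDGRecollement_triMat (DGFunctor.curry M) h
    -- Only the matrix with entry `(curry M).uncurry` needs rewriting; `pushBimodule jL M` is
    -- `((curry M).comp jL).uncurry` by definition.
    rwa [hM] at this
  · have := exists_isRightDGRecollement_triMat (DGFunctor.curry M) h
    rwa [hM] at this
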